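/- Let $\mathcal C\subset\mathbb R^3$ be closed and invariant under $SO(3)$, with $\mathcal M=\mathbb R\times(\mathbb R^3\setminus\mathcal C)$ connected, with Cartesian coordinates $(T,\vec x)$ and Minkowski metric $\eta=-dT^2+d\vec x\cdot d\vec x$. Let $h$ be a smooth function and $\boldsymbol K$ a smooth $\eta$-null one-form on $\mathcal M$, neither having a flat zero (a point where it and all its derivatives vanish). Suppose that $g=\eta+h\,\boldsymbol K\otimes\boldsymbol K$ is stationary ($\partial_T$ is Killing) and spherically symmetric (the maps $(T,\vec x)\mapsto(T,R\vec x)$, $R\in SO(3)$, are isometries). **1. Form of the metric.** Then $0\in\mathcal C$, and there are $\sigma\in\{1,-1\}$ and a smooth function, again called $h$, of $r=|\vec x|$ with $$g=-dT^2+d\vec x\cdot d\vec x+h(r)\,(dr-\sigma\,dT)\otimes(dr-\sigma\,dT).$$ Fix any way of writing $g$ in this form, and assume that on no domain $U\subset\mathbb R^3\setminus\mathcal C$ is $h$ of the form $h=\alpha r^2(\beta+\gamma r^2)^{-1}$ with $\alpha,\beta,\gamma\in\mathbb R$ (and $\beta+\gamma r^2\ne0$ on $U$). Let $\mu\in\{-1,0,1\}$,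 let $J\subset\mathbb R$ be an open interval, and call an affinely parametrized $C^2$ geodesic with tangent $u=(\dot T,\dot{\vec x})$, $g(u,u)=-\mu$, a normalized geodesic. For a constant vector $\vec L$ with $L=|\vec L|$ and a constant $E$, a *Newtonian motion* on $J$ is a $C^2$ curve $\vec x$ in $\mathbb R^3\setminus\mathcal C$ with $$\ddot{\vec x}=-\nabla V,\quad V=-\frac{h(r)}2\Big(\frac{L^2}{r^2}+\mu\Big),\qquad \vec L=\vec x\times\dot{\vec x},\qquad \frac{\dot r^2}2+\frac{(1-h)L^2}{2r^2}-\frac{h\mu}2=\frac12(E^2-\mu).$$ Write $\dot r=\vec x\cdot\dot{\vec x}/r$. The *energy relation* is $E=(1-h)\dot T+h\sigma\dot r$. **2. Geodesics and Newtonian motion.** A curve $(T,\vec x)$ on $J$ is a normalized geodesic if and only if $T$ is $C^2$ and there are constants $\vec L,E$ for which $\vec x$ is a Newtonian motion, the energy relation holds, and at every point with $h=1$ one has $g(u,u)=-\mu$ and, if also $\dot r=0$ there, $$\dot q=\frac{L^2}{r^3}+\frac{h'(r)}2(q-\sigma E)^2,\qquad q=(1+h)\dot r-\sigma h\dot T .$$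 **3. Reconstruction of the time part.** Let $\vec x$ be a Newtonian motion on $J$ with constants $\vec L,E$. (a) For $s_0\in J$ and $T_0\in\mathbb R$, there is, on some open interval $J'\subset J$ containing $s_0$, a function $T$ with $T(s_0)=T_0$ such that $(T,\vec x)$ is a normalized geodesic satisfying the energy relation, if and only if either $h\ne1$ at $\vec x(s_0)$, or $\dot r(s_0)=\sigma E$ and ($\dot r(s_0)=0\Rightarrow L^2/r(s_0)^2+\mu=0$). (b) If at every $s\in J$ with $h=1$ one has $\dot r=\sigma E$ and ($\dot r=0\Rightarrow \vec L=0,\ \mu=0$), such a $T$ exists on all of $J$. (c) If $h\neq1$ at some point of $\vec x(J)$, such a $T$ on $J$ is unique up to an additive constant. **4. Future directed causal geodesics.** Choose the time orientation for which the null vector field $\partial_T+\sigma\frac{\vec x}{|\vec x|}\partial_{\vec x}$ is future directed; the zero vector counts as null and future directed. Let $\mu\in\{0,1\}$. For data $\vec x_0\in\mathbb R^3\setminus\mathcal C$, $\dot{\vec x}_0$, $E$ put $r_0=|\vec x_0|$, $\dot r_0=\vec x_0\cdot\dot{\vec x}_0/r_0$, $h_0=h(r_0)$, $L=|\vec x_0\times\dot{\vec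 x}_0|$, $a_0=\sqrt{|1-h_0|\,(L^2/r_0^2+\mu)}$, and consider the condition * if $h_0>1$: $\sigma\dot r_0\in[a_0,\infty)$ and $E=\pm\sqrt{\dot r_0^2-a_0^2}$; * if $h_0<1$: $E\in[a_0,\infty)$ and $\dot r_0=\pm\sqrt{E^2-a_0^2}$; * if $h_0=1$: $\sigma\dot r_0\in[0,\infty)$, with $\dot r_0=0\Rightarrow\mu=L=0$, and $E=\sigma\dot r_0$. (i) A normalized geodesic on $J\ni s_0$ is future directed (at every $s\in J$) if and only if its data at $s_0$, with $E$ given by the energy relation, satisfy this condition and, in the case $h_0=1$, $\dot r_0=0$, also $\dot T(s_0)\ge0$. (ii) For any $T_0,\vec x_0,\dot{\vec x}_0,E$ with $\vec x_0\notin\mathcal C$, there is a future directed normalized geodesic on an open interval containing $0$ with $T(0)=T_0$, $\vec x(0)=\vec x_0$, $\dot{\vec x}(0)=\dot{\vec x}_0$ and energy $E$ if and only if the condition holds. -/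

import Mathlib

open scoped ContDiff

noncomputable section

/-- Euclidean three-space with its Cartesian coordinates. -/
abbrev E3 : Type := EuclideanSpace ℝ (Fin 3)

/-- The coordinate space `ℝ × ℝ³` of points `(T, x)`; it is also the tangent space at every point,
a tangent vector being `(Ṫ, ẋ)`. -/
abbrev Spacetime : Type := ℝ × E3

/-- A field of bilinear forms: `g p v w` is the value at the point `p` on the vectors `v`, `w`. -/
abbrev MetricField : Type := Spacetime → Spacetime → Spacetime → ℝ

/-- The vector product of `ℝ³`. -/
def cross (x y : E3) : E3 :=
  WithLp.toLp 2 (crossProduct (WithLp.ofLp x) (WithLp.ofLp y))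

/-- The manifold `ℝ × (ℝ³ ∖ C)`. -/
def manifold (C : Set E3) : Set Spacetime := {p | p.2 ∉ C}

/-- The Minkowski metric `η = -dT² + dx·dx`. -/
def minkowski (v w : Spacetime) : ℝ := -(v.1 * w.1) + inner ℝ v.2 w.2

/-- The squared length of a covector with respect to the inverse Minkowski metric. -/
def minkowskiCoSq (κ : Spacetime →L[ℝ] ℝ) : ℝ :=
  -(κ (1, 0)) ^ 2 + ∑ i : Fin 3, (κ (0, EuclideanSpace.single i 1)) ^ 2

/-- The Kerr-Schild metric `η + h K ⊗ K`. -/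
def kerrSchild (h : Spacetime → ℝ) (K : Spacetime → (Spacetime →L[ℝ] ℝ)) : MetricField :=
  fun p v w => minkowski v w + h p * K p v * K p w

/-- A flat zero: the map vanishes at `p` together with all its derivatives. -/
def IsFlatZero {F : Type*} [NormedAddCommGroup F] [NormedSpace ℝ F] (f : Spacetime → F)
    (p : Spacetime) : Prop :=
  ∀ n : ℕ, iteratedFDeriv ℝ n f p = 0

/-- The Lie derivative of `g` along the vector field `ξ`, in coordinates. -/
def lieDerivative (ξ : Spacetime → Spacetime) (g : MetricField) : MetricField :=
  fun p v w => fderiv ℝ (fun q => g q v w) p (ξ p)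
    + g p (fderiv ℝ ξ p v) w + g p v (fderiv ℝ ξ p w)

/-- `ξ` is a Killing vector field of `g` on `M`. -/
def IsKillingOn (M : Set Spacetime) (g : MetricField) (ξ : Spacetime → Spacetime) : Prop :=
  ∀ p ∈ M, ∀ v w : Spacetime, lieDerivative ξ g p v w = 0

/-- `∂_T` is a Killing vector field. -/
def IsStationaryMetric (M : Set Spacetime) (g : MetricField) : Prop :=
  IsKillingOn M g (fun _ => (1, 0))

/-- Membership of a linear isometry of `ℝ³` in `SO(3)`. -/
def IsRotation (R : E3 ≃ₗᵢ[ℝ] E3) : Prop :=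
  LinearMap.det (R.toLinearEquiv : E3 →ₗ[ℝ] E3) = 1

/-- The rotations `(T, x) ↦ (T, R x)` are isometries of `g` on `M`. -/
def IsSphericallySymmetric (M : Set Spacetime) (g : MetricField) : Prop :=
  ∀ R : E3 ≃ₗᵢ[ℝ] E3, IsRotation R → ∀ p ∈ M, ∀ v w : Spacetime,
    g (p.1, R p.2) (v.1, R v.2) (w.1, R w.2) = g p v w

/-- `dr` applied to `v` at the point `x ≠ 0`, that is `x·v / |x|`. -/
def radialPart (x v : E3) : ℝ := inner ℝ x v / ‖x‖

/-- The metric `-dT² + dx·dx + H(r) (dr - σ dT) ⊗ (dr - σ dT)`, with `r = |x|`. -/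
def radialKerrSchild (σ : ℝ) (H : ℝ → ℝ) : MetricField :=
  fun p v w => minkowski v w
    + H ‖p.2‖ * (radialPart p.2 v.2 - σ * v.1) * (radialPart p.2 w.2 - σ * w.1)

/-- On the set `U` the function `H(|x|)` is `α |x|² / (β + γ |x|²)` for some constants. -/
def IsExceptionalOn (H : ℝ → ℝ) (U : Set E3) : Prop :=
  ∃ α β γ : ℝ, ∀ x ∈ U, β + γ * ‖x‖ ^ 2 ≠ 0 ∧ H ‖x‖ = α * ‖x‖ ^ 2 / (β + γ * ‖x‖ ^ 2)

/-- The Christoffel symbols of the first kind, `Γ(u, v; w) = g(∇_u v, w)` for constant `u, v`. -/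
def christoffel (g : MetricField) (p u v w : Spacetime) : ℝ :=
  (fderiv ℝ (fun q => g q v w) p u + fderiv ℝ (fun q => g q u w) p v
    - fderiv ℝ (fun q => g q u v) p w) / 2

/-- `γ` is an affinely parametrized geodesic of `g` in `M`, defined on the open interval `J`
(the geodesic equation is written with its free index lowered). -/
structure IsGeodesicOn (M : Set Spacetime) (g : MetricField) (J : Set ℝ) (γ : ℝ → Spacetime) :
    Prop where
  contDiffOn : ContDiffOn ℝ 2 γ J
  mem : ∀ s ∈ J, γ s ∈ M
  equation : ∀ s ∈ J, ∀ w : Spacetime,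
    g (γ s) (deriv (deriv γ) s) w + christoffel g (γ s) (deriv γ s) (deriv γ s) w = 0

/-- A geodesic whose tangent vector `u` satisfies `g(u, u) = -μ`. -/
def IsNormalizedGeodesicOn (M : Set Spacetime) (g : MetricField) (μ : ℝ) (J : Set ℝ)
    (γ : ℝ → Spacetime) : Prop :=
  IsGeodesicOn M g J γ ∧ ∀ s ∈ J, g (γ s) (deriv γ s) (deriv γ s) = -μ

/-- The radial potential `V = -(H(r)/2) (L²/r² + μ)`. -/
def potential (H : ℝ → ℝ) (L μ : ℝ) (x : E3) : ℝ :=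
  -(H ‖x‖ / 2) * (L ^ 2 / ‖x‖ ^ 2 + μ)

/-- Newtonian motion in `ℝ³ ∖ C` in the potential `V`, with angular momentum `L` equal to the vector
whose length enters `V`, and with energy constant `ε = (E² - μ)/2`. -/
structure IsNewtonianMotionOn (C : Set E3) (H : ℝ → ℝ) (μ : ℝ) (L : E3) (E : ℝ) (J : Set ℝ)
    (x : ℝ → E3) : Prop where
  contDiffOn : ContDiffOn ℝ 2 x J
  mem : ∀ s ∈ J, x s ∉ C
  newton : ∀ s ∈ J, deriv (deriv x) s = -gradient (potential H ‖L‖ μ) (x s)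
  angularMomentum : ∀ s ∈ J, L = cross (x s) (deriv x s)
  energy : ∀ s ∈ J,
    (deriv (fun t => ‖x t‖) s) ^ 2 / 2 + (1 - H ‖x s‖) * ‖L‖ ^ 2 / (2 * ‖x s‖ ^ 2)
      - H ‖x s‖ * μ / 2 = (E ^ 2 - μ) / 2

/-- The quantity `(1 - h) Ṫ + h σ (x·ẋ)/|x|` of a tangent vector `u = (Ṫ, ẋ)` at a point with
spatial part `x`. -/
def energyOf (σ : ℝ) (H : ℝ → ℝ) (x : E3) (u : Spacetime) : ℝ :=
  (1 - H ‖x‖) * u.1 + H ‖x‖ * σ * radialPart x u.2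

/-- The radial momentum `(x·p)/|x| = (1 + h) (x·ẋ)/|x| - σ h Ṫ`, where `p` is the spatial part of
`g(u, ·)`. -/
def radialMomentum (σ : ℝ) (H : ℝ → ℝ) (x : E3) (u : Spacetime) : ℝ :=
  (1 + H ‖x‖) * radialPart x u.2 - σ * H ‖x‖ * u.1

/-- What has to be added, at points with `h = 1`, to the Newtonian equations and the energy relation
so that they determine the geodesic: the normalization and, where also `ṙ = 0`, the Hamilton
equation of the radial momentum `q`, namely `q̇ = L²/r³ + h'(r) (q - σ E)² / 2`. -/
def HorizonConditions (g : MetricField) (σ : ℝ) (H : ℝ → ℝ) (μ : ℝ) (L : E3) (E : ℝ) (J : Set ℝ)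
    (T : ℝ → ℝ) (x : ℝ → E3) : Prop :=
  ∀ s ∈ J, H ‖x s‖ = 1 →
    g (T s, x s) (deriv T s, deriv x s) (deriv T s, deriv x s) = -μ ∧
    (radialPart (x s) (deriv x s) = 0 →
      deriv (fun t => radialMomentum σ H (x t) (deriv T t, deriv x t)) s =
        ‖L‖ ^ 2 / ‖x s‖ ^ 3 + deriv H ‖x s‖ / 2 *
          (radialMomentum σ H (x s) (deriv T s, deriv x s) - σ * E) ^ 2)

/-- The null vector `∂_T + σ (x/|x|) ∂_x` at a point with spatial part `x`. -/
def nullVector (σ : ℝ) (x : E3) : Spacetime := (1, (σ / ‖x‖) • x)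

/-- `v` is causal and future directed at `p` when the causal vector `N` is future directed: `v` is
zero or lies in the same half of the causal cone as `N`, i.e. some timelike vector `Z` has negative
product with both. -/
def IsFutureCausal (g : MetricField) (p N v : Spacetime) : Prop :=
  g p v v ≤ 0 ∧ (v = 0 ∨ ∃ Z : Spacetime, g p Z Z < 0 ∧ g p Z N < 0 ∧ g p Z v < 0)

/-- `a₀ = √(|1 - h₀| (L²/r₀² + μ))`. -/
def aZero (h₀ r₀ L μ : ℝ) : ℝ := Real.sqrt (|1 - h₀| * (L ^ 2 / r₀ ^ 2 + μ))

/-- The conditions on the initial data `(ṙ₀, E)`. -/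
def FutureData (σ h₀ r₀ L μ rdot E : ℝ) : Prop :=
  (1 < h₀ → aZero h₀ r₀ L μ ≤ σ * rdot ∧
    (E = Real.sqrt (rdot ^ 2 - aZero h₀ r₀ L μ ^ 2) ∨
      E = -Real.sqrt (rdot ^ 2 - aZero h₀ r₀ L μ ^ 2))) ∧
  (h₀ < 1 → aZero h₀ r₀ L μ ≤ E ∧
    (rdot = Real.sqrt (E ^ 2 - aZero h₀ r₀ L μ ^ 2) ∨
      rdot = -Real.sqrt (E ^ 2 - aZero h₀ r₀ L μ ^ 2))) ∧
  (h₀ = 1 → 0 ≤ σ * rdot ∧ (rdot = 0 → μ = 0 ∧ L = 0) ∧ E = σ * rdot)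

end

open Filter Topology Set

/-! Form of the metric. The tensor S = h K ⊗ K is independent of T and equivariant under rotations.
At x ≠ 0, invariance under the half-turn about x makes the spatial part of the null covector K
radial wherever S ≠ 0. So S = F(r) (dr - σ dT)² with F = S(∂_T, ∂_T) and a sign σ that may still
depend on the point. On the first axis put G = S(∂_T, e₁); then G² = F². Since h and K have no flat
zeros, they are of finite order along a common line, and the leading coefficient of K is again null,
hence has a nonzero time component. So F has finite order at every radius
(`IsStationarySphericalKerrSchild.exists_hasLeadingTerm`). A smooth root of the square of such a
function has one sign near each point (`HasLeadingTerm.eventually_eq_or_eq_neg`), and connectedness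
makes this sign global. At the origin F would be even and G odd, which excludes 0 ∉ C.

Geodesics. Put a = ṙ - σṪ and N = L²/r² + μ. The conserved energy satisfies σE = ṙ - (1 - h) a, the
normalization reads a (ṙ + σE) + N = 0, and the geodesic equations give ȧ = L²/r³ + h' a²/2.
Eliminating a yields Newton's equation and its energy law, the latter being 1 - h times the
normalization. The converse divides by 1 - h. At h = 1 the normalization therefore has to be
demanded; its derivative returns the equation for a up to the factor 2ṙ, so that equation has to be
demanded only where also ṙ = 0.

Time part. Reconstructing T amounts to finding a C¹ function a: (ṙ - σE)/(1 - h) where h ≠ 1, -N/(ṙ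
+ σE) near points with h = 1 and ṙ ≠ 0, and a solution of a Riccati equation with constant
coefficients at a radial equilibrium. Two choices of a differ by a solution of a linear homogeneous
ODE, whence uniqueness.

Future direction. With A = Ṫ - σṙ and B = E + σṙ, a causal vector is future directed exactly if A ≥
0 and B ≥ 0 (`isFutureCausal_iff`). The relations (1 - h) A = E - σṙ and AB = N turn this into the
condition on the data. It persists along the geodesic: A cannot vanish where N > 0, and if L = 0 and
μ = 0 then A solves a linear homogeneous ODE. -/

/-- Near `t₀` the function behaves like `(t - t₀) ^ n • c` with `c ≠ 0`. -/
def HasLeadingTerm {F : Type*} [NormedAddCommGroup F] [NormedSpace ℝ F]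
    (φ : ℝ → F) (n : ℕ) (c : F) (t₀ : ℝ) : Prop :=
  c ≠ 0 ∧ Tendsto (fun t => ((t - t₀) ^ n)⁻¹ • φ t) (𝓝[≠] t₀) (𝓝 c)

/-! ### Smooth functions of finite order at a point of the line. -/

section LeadingTerm

variable {F : Type*} [NormedAddCommGroup F] [NormedSpace ℝ F]

theorem exists_ball_contDiffOn {E : Type*} [NormedAddCommGroup E] [NormedSpace ℝ E]
    {f : E → F} {p : E} (hf : ContDiffAt ℝ ∞ f p) (n : ℕ) :
    ∃ ε > 0, ContDiffOn ℝ n f (Metric.ball p ε) := by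
  obtain ⟨u, hu, hfu⟩ := (hf.of_le (m := n) (mod_cast le_top)).contDiffOn le_rfl (by simp)
  obtain ⟨ε, hε, hsub⟩ := Metric.mem_nhds_iff.1 hu
  exact ⟨ε, hε, hfu.mono hsub⟩

theorem taylor_isLittleO_of_contDiffAt {φ : ℝ → F} {t₀ : ℝ} (hφ : ContDiffAt ℝ ∞ φ t₀) (n : ℕ) :
    (fun t => φ t - ∑ k ∈ Finset.range (n + 1),
      ((k.factorial : ℝ)⁻¹ * (t - t₀) ^ k) • iteratedDeriv k φ t₀) =o[𝓝 t₀]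
        fun t => (t - t₀) ^ n := by
  obtain ⟨ε, hε, hon⟩ := exists_ball_contDiffOn hφ n
  have hmem : t₀ ∈ Metric.ball t₀ ε := Metric.mem_ball_self hε
  have := taylor_isLittleO (convex_ball t₀ ε) hmem hon
  rw [Metric.isOpen_ball.nhdsWithin_eq hmem] at this
  refine this.congr_left fun t => ?_
  rw [taylor_within_apply]
  congr 1
  exact Finset.sum_congr rfl fun k _ => by
    rw [iteratedDerivWithin_of_isOpen Metric.isOpen_ball hmem]

theorem exists_hasLeadingTerm {φ : ℝ → F} {t₀ : ℝ} (hφ : ContDiffAt ℝ ∞ φ t₀)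
    (h : ∃ n, iteratedDeriv n φ t₀ ≠ 0) : ∃ n c, HasLeadingTerm φ n c t₀ := by
  classical
  set n := Nat.find h with hn
  have hne : iteratedDeriv n φ t₀ ≠ 0 := Nat.find_spec h
  have hz : ∀ k < n, iteratedDeriv k φ t₀ = 0 := fun k hk => not_not.1 (Nat.find_min h hk)
  refine ⟨n, (n.factorial : ℝ)⁻¹ • iteratedDeriv n φ t₀,
    smul_ne_zero (by positivity) hne, ?_⟩
  have ho := (taylor_isLittleO_of_contDiffAt hφ n).mono (nhdsWithin_le_nhds (s := {t₀}ᶜ))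
  have hsum : ∀ t, ∑ k ∈ Finset.range (n + 1),
      ((k.factorial : ℝ)⁻¹ * (t - t₀) ^ k) • iteratedDeriv k φ t₀ =
        (t - t₀) ^ n • (n.factorial : ℝ)⁻¹ • iteratedDeriv n φ t₀ := by
    intro t
    rw [Finset.sum_range_succ, Finset.sum_eq_zero, zero_add, mul_comm, mul_smul]
    intro k hk
    rw [hz k (Finset.mem_range.1 hk), smul_zero]
  simp only [hsum] at ho
  have hlim : Tendsto (fun t => ((t - t₀) ^ n)⁻¹ •
      (φ t - (t - t₀) ^ n • (n.factorial : ℝ)⁻¹ • iteratedDeriv n φ t₀)) (𝓝[≠] t₀) (𝓝 0) := by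
    rw [tendsto_zero_iff_norm_tendsto_zero]
    simpa [norm_smul, div_eq_inv_mul] using ho.norm_norm.tendsto_div_nhds_zero
  have := hlim.add_const ((n.factorial : ℝ)⁻¹ • iteratedDeriv n φ t₀)
  rw [zero_add] at this
  refine this.congr' ?_
  filter_upwards [self_mem_nhdsWithin] with t ht
  have : (t - t₀) ^ n ≠ 0 := pow_ne_zero _ (sub_ne_zero.2 ht)
  rw [smul_sub, smul_smul, inv_mul_cancel₀ this, one_smul, sub_add_cancel]

theorem isLittleO_pow_of_iteratedDeriv_eq_zero {φ : ℝ → F} {t₀ : ℝ} (hφ : ContDiffAt ℝ ∞ φ t₀)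
    (h : ∀ n, iteratedDeriv n φ t₀ = 0) (n : ℕ) : φ =o[𝓝 t₀] fun t => (t - t₀) ^ n := by
  simpa [h] using taylor_isLittleO_of_contDiffAt hφ n

theorem HasLeadingTerm.not_isLittleO {φ : ℝ → F} {n : ℕ} {c : F} {t₀ : ℝ}
    (h : HasLeadingTerm φ n c t₀) : ¬ φ =o[𝓝 t₀] fun t => (t - t₀) ^ n := by
  intro ho
  refine h.1 (tendsto_nhds_unique h.2 ?_)
  rw [tendsto_zero_iff_norm_tendsto_zero]
  simpa [norm_smul, div_eq_inv_mul] using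
    (ho.mono (nhdsWithin_le_nhds (s := {t₀}ᶜ))).norm_norm.tendsto_div_nhds_zero

theorem HasLeadingTerm.mul {φ ψ : ℝ → ℝ} {m n : ℕ} {c d t₀ : ℝ} (hφ : HasLeadingTerm φ m c t₀)
    (hψ : HasLeadingTerm ψ n d t₀) : HasLeadingTerm (fun t => φ t * ψ t) (m + n) (c * d) t₀ := by
  refine ⟨mul_ne_zero hφ.1 hψ.1, (hφ.2.mul hψ.2).congr fun t => ?_⟩
  simp only [smul_eq_mul, pow_add, mul_inv]
  ring

theorem HasLeadingTerm.eventually_ne {φ : ℝ → F} {n : ℕ} {c : F} {t₀ : ℝ}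
    (h : HasLeadingTerm φ n c t₀) : ∀ᶠ t in 𝓝[≠] t₀, φ t ≠ 0 := by
  filter_upwards [h.2.eventually_ne h.1] with t ht h0
  exact ht (by rw [h0, smul_zero])

/-- Divided by (t - t₀)^n, the factor u + 2φ tends to 2c ≠ 0, so only the factor u can vanish near
t₀. -/
theorem HasLeadingTerm.eventually_eq_zero_of_mul_add {φ u : ℝ → ℝ} {n : ℕ} {c t₀ : ℝ}
    (h : HasLeadingTerm φ n c t₀) (hu : u =o[𝓝 t₀] fun t => (t - t₀) ^ n)
    (hmul : ∀ᶠ t in 𝓝[≠] t₀, u t * (u t + 2 * φ t) = 0) : ∀ᶠ t in 𝓝[≠] t₀, u t = 0 := by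
  have hu0 : Tendsto (fun t => ((t - t₀) ^ n)⁻¹ • u t) (𝓝[≠] t₀) (𝓝 0) := by
    rw [tendsto_zero_iff_norm_tendsto_zero]
    simpa [norm_smul, div_eq_inv_mul] using
      (hu.mono (nhdsWithin_le_nhds (s := {t₀}ᶜ))).norm_norm.tendsto_div_nhds_zero
  have hlim := hu0.add (h.2.const_mul 2)
  filter_upwards [hmul, hlim.eventually_ne (b₂ := 0) (by simpa using h.1)] with t ht hne
  refine (mul_eq_zero.1 ht).resolve_right fun h0 => hne ?_
  simp only [smul_eq_mul]
  linear_combination ((t - t₀) ^ n)⁻¹ * h0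

/-- A smooth square root of the square of a function of finite order is that function up to a
constant sign. -/
theorem HasLeadingTerm.eventually_eq_or_eq_neg {φ ψ : ℝ → ℝ} {n : ℕ} {c t₀ : ℝ}
    (h : HasLeadingTerm φ n c t₀) (hφ : ContDiffAt ℝ ∞ φ t₀) (hψ : ContDiffAt ℝ ∞ ψ t₀)
    (hsq : ∀ᶠ t in 𝓝[≠] t₀, ψ t ^ 2 = φ t ^ 2) :
    (∀ᶠ t in 𝓝[≠] t₀, ψ t = φ t) ∨ ∀ᶠ t in 𝓝[≠] t₀, ψ t = -φ t := by
  have hsub : ContDiffAt ℝ ∞ (fun t => ψ t - φ t) t₀ := hψ.sub hφ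
  -- Both u = ψ - φ and u = -(ψ + φ) satisfy u (u + 2φ) = ψ² - φ², which is why the sum carries a
  -- minus sign. They cannot both have finite order, since their product vanishes; the flat one is
  -- negligible against φ and so vanishes near t₀.
  have hadd : ContDiffAt ℝ ∞ (fun t => -(ψ t + φ t)) t₀ := (hψ.add hφ).neg
  by_cases h1 : ∃ k, iteratedDeriv k (fun t => ψ t - φ t) t₀ ≠ 0
  · by_cases h2 : ∃ k, iteratedDeriv k (fun t => -(ψ t + φ t)) t₀ ≠ 0
    · obtain ⟨_, _, l1⟩ := exists_hasLeadingTerm hsub h1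
      obtain ⟨_, _, l2⟩ := exists_hasLeadingTerm hadd h2
      obtain ⟨t, hne, ht⟩ := ((l1.mul l2).eventually_ne.and hsq).exists
      exact absurd (by linear_combination -ht) hne
    · right
      have hu := isLittleO_pow_of_iteratedDeriv_eq_zero hadd (by simpa using h2) n
      filter_upwards [h.eventually_eq_zero_of_mul_add hu
        (hsq.mono fun t ht => by linear_combination ht)] with t ht
      linarith
  · left
    have hu := isLittleO_pow_of_iteratedDeriv_eq_zero hsub (by simpa using h1) n
    filter_upwards [h.eventually_eq_zero_of_mul_add hu
      (hsq.mono fun t ht => by linear_combination ht)] with t ht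
    linarith

end LeadingTerm

/-! ### Symmetry of higher derivatives and restriction to lines. -/

section Symmetry

variable {E F : Type*} [NormedAddCommGroup E] [NormedSpace ℝ E] [NormedAddCommGroup F]
  [NormedSpace ℝ F]

theorem iteratedFDeriv_succ_apply_of_contDiffAt {f : E → F} {q : E} (hf : ContDiffAt ℝ ∞ f q)
    (n : ℕ) (v : Fin (n + 1) → E) :
    iteratedFDeriv ℝ (n + 1) f q v =
      fderiv ℝ (fun y => iteratedFDeriv ℝ n f y (Fin.tail v)) q (v 0) := by
  have hd : DifferentiableAt ℝ (iteratedFDeriv ℝ n f) q :=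
    (hf.of_le (m := (n + 1 : ℕ)) (mod_cast le_top)).differentiableAt_iteratedFDeriv
      (by exact_mod_cast n.lt_succ_self)
  rw [iteratedFDeriv_succ_apply_left]
  have := hd.hasFDerivAt.continuousMultilinear_apply_const (Fin.tail v)
  rw [this.fderiv]
  rfl

/-- The first two slots are exchanged by the symmetry of the second derivative of the derivative of
order n; later pairs follow by differentiating the induction hypothesis, which holds on the whole
open set. -/
theorem iteratedFDeriv_comp_swap {f : E → F} {U : Set E} (hU : IsOpen U)
    (hf : ContDiffOn ℝ ∞ f U) (n : ℕ) : ∀ q ∈ U, ∀ (i : Fin n) (v : Fin (n + 1) → E),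
      iteratedFDeriv ℝ (n + 1) f q (v ∘ Equiv.swap i.castSucc i.succ) =
        iteratedFDeriv ℝ (n + 1) f q v := by
  induction n with
  | zero => exact fun _ _ i => i.elim0
  | succ n ih =>
    intro q hq i v
    have hfa : ∀ y ∈ U, ContDiffAt ℝ ∞ f y := fun y hy => hf.contDiffAt (hU.mem_nhds hy)
    refine Fin.cases ?_ (fun j => ?_) i
    · set w : Fin n → E := fun k => v k.succ.succ
      have hG : ContDiffAt ℝ ∞ (fun y => iteratedFDeriv ℝ n f y w) q := by
        have := (hfa q hq).iteratedFDeriv_right (i := n) (m := ∞) (by exact_mod_cast le_top)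
        exact (ContinuousMultilinearMap.apply ℝ (fun _ : Fin n => E) F w).contDiff.contDiffAt.comp
          q this
      have key : ∀ u : Fin (n + 2) → E, (∀ k : Fin n, u k.succ.succ = w k) →
          iteratedFDeriv ℝ (n + 2) f q u =
            fderiv ℝ (fderiv ℝ (fun y => iteratedFDeriv ℝ n f y w)) q (u 0) (u 1) := by
        intro u hu
        rw [iteratedFDeriv_succ_apply_of_contDiffAt (hfa q hq)]
        have he : (fun y => iteratedFDeriv ℝ (n + 1) f y (Fin.tail u)) =ᶠ[𝓝 q]
            fun y => fderiv ℝ (fun y => iteratedFDeriv ℝ n f y w) y (u 1) := by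
          filter_upwards [hU.mem_nhds hq] with y hy
          rw [iteratedFDeriv_succ_apply_of_contDiffAt (hfa y hy)]
          have : Fin.tail (Fin.tail u) = w := funext hu
          rw [this]
          rfl
        rw [he.fderiv_eq]
        have hd : DifferentiableAt ℝ (fderiv ℝ (fun y => iteratedFDeriv ℝ n f y w)) q :=
          (hG.fderiv_right (m := 1) (by norm_cast)).differentiableAt one_ne_zero
        rw [(hd.hasFDerivAt.clm_apply (hasFDerivAt_const (u 1) q)).fderiv]
        simp
      rw [key v fun _ => rfl, key]
      · have hs := ((hG.of_le (m := ((2 : ℕ∞) : ℕ∞ω)) (WithTop.coe_le_coe.2 le_top)).isSymmSndFDerivAt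
          (by simp)).eq (v 1) (v 0)
        simpa using hs
      · intro k
        simp only [Function.comp_apply, w]
        rw [Equiv.swap_apply_of_ne_of_ne (by simp [Fin.ext_iff]) (by simp [Fin.ext_iff])]
    · rw [iteratedFDeriv_succ_apply_of_contDiffAt (hfa q hq),
        iteratedFDeriv_succ_apply_of_contDiffAt (hfa q hq)]
      have ht : Fin.tail (v ∘ Equiv.swap j.succ.castSucc j.succ.succ) =
          Fin.tail v ∘ Equiv.swap j.castSucc j.succ := by
        ext k
        simp only [Fin.tail, Function.comp_apply, Equiv.swap_apply_def, Fin.ext_iff]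
        split_ifs <;> simp_all
      have h0 : (v ∘ Equiv.swap j.succ.castSucc j.succ.succ) 0 = v 0 := by
        rw [Function.comp_apply,
          Equiv.swap_apply_of_ne_of_ne (by simp [Fin.ext_iff]) (by simp [Fin.ext_iff])]
      have he : (fun y => iteratedFDeriv ℝ (n + 1) f y
          (Fin.tail (v ∘ Equiv.swap j.succ.castSucc j.succ.succ))) =ᶠ[𝓝 q]
            fun y => iteratedFDeriv ℝ (n + 1) f y (Fin.tail v) := by
        filter_upwards [hU.mem_nhds hq] with y hy
        rw [ht, ih y hy]
      rw [h0, he.fderiv_eq]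

/-- The iterated derivatives of a smooth function are symmetric. -/
theorem iteratedFDeriv_comp_perm_of_contDiffOn {f : E → F} {U : Set E} (hU : IsOpen U)
    (hf : ContDiffOn ℝ ∞ f U) {q : E} (hq : q ∈ U) (n : ℕ) (σ : Equiv.Perm (Fin n))
    (v : Fin n → E) : iteratedFDeriv ℝ n f q (v ∘ σ) = iteratedFDeriv ℝ n f q v := by
  cases n with
  | zero => congr 1; ext i; exact i.elim0
  | succ n =>
    have hσ : σ ∈ Submonoid.closure
        (range fun i : Fin n => Equiv.swap i.castSucc i.succ) := by
      rw [Equiv.Perm.mclosure_swap_castSucc_succ]; trivial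
    induction hσ using Submonoid.closure_induction generalizing v with
    | mem τ hτ =>
      obtain ⟨i, rfl⟩ := hτ
      exact iteratedFDeriv_comp_swap hU hf n q hq i v
    | one => rfl
    | mul τ τ' _ _ h h' =>
      rw [Equiv.Perm.coe_mul, ← Function.comp_assoc, h', h]

/-- A smooth function with a nonzero derivative of order `n` has one along a line. -/
theorem exists_iteratedFDeriv_diagonal_ne_zero {f : E → F} {U : Set E} (hU : IsOpen U)
    (hf : ContDiffOn ℝ ∞ f U) {q : E} (hq : q ∈ U) {n : ℕ} (hn : iteratedFDeriv ℝ n f q ≠ 0) :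
    ∃ v : E, iteratedFDeriv ℝ n f q (fun _ => v) ≠ 0 := by
  by_contra! hcon
  refine hn (ContinuousMultilinearMap.ext fun v => ?_)
  -- Polarization: differentiating the diagonal n times gives the sum over all permutations of the
  -- arguments, which by symmetry is n! times the multilinear form.
  have h := (iteratedFDeriv ℝ n f q).iteratedFDeriv_comp_diagonal 0 v
  have hzero : (fun x : E => iteratedFDeriv ℝ n f q fun _ => x) = fun _ => 0 := funext hcon
  have hsum : ∑ σ : Equiv.Perm (Fin n), iteratedFDeriv ℝ n f q (fun i => v (σ i)) =
      (n.factorial : ℝ) • iteratedFDeriv ℝ n f q v := by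
    have hperm : ∀ σ : Equiv.Perm (Fin n), iteratedFDeriv ℝ n f q (fun i => v (σ i)) =
        iteratedFDeriv ℝ n f q v := fun σ =>
      iteratedFDeriv_comp_perm_of_contDiffOn hU hf hq n σ v
    simp [hperm, Finset.card_univ, Fintype.card_perm, Nat.cast_smul_eq_nsmul]
  rw [hzero, hsum] at h
  have h0 : iteratedFDeriv ℝ n (fun _ : E => (0 : F)) 0 = 0 := by
    have := iteratedFDeriv_fun_zero (𝕜 := ℝ) (E := E) (F := F) (n := n)
    exact congrFun this 0
  rw [h0] at h
  have := (smul_eq_zero.1 h.symm).resolve_left (by positivity)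
  simpa using this

/-- The derivatives along a line. -/
theorem iteratedDeriv_comp_line {f : E → F} {U : Set E} (hU : IsOpen U)
    (hf : ContDiffOn ℝ ∞ f U) {q : E} (hq : q ∈ U) (n : ℕ) (v : E) :
    iteratedDeriv n (fun t : ℝ => f (q + t • v)) 0 = iteratedFDeriv ℝ n f q fun _ => v := by
  set g : ℝ →L[ℝ] E := ContinuousLinearMap.toSpanSingleton ℝ v
  set f' : E → F := fun y => f (q + y)
  set W : Set E := (fun y => q + y) ⁻¹' U
  have hW : IsOpen W := hU.preimage (by fun_prop)
  have hf' : ContDiffOn ℝ ∞ f' W := hf.comp (by fun_prop) fun _ h => h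
  have hg0 : g 0 ∈ W := by simpa [W] using hq
  have hgW : IsOpen (g ⁻¹' W) := hW.preimage g.continuous
  have h := g.iteratedFDerivWithin_comp_right hf' hW.uniqueDiffOn hgW.uniqueDiffOn hg0
    (i := n) (mod_cast le_top)
  rw [iteratedFDerivWithin_of_isOpen n hgW hg0, iteratedFDerivWithin_of_isOpen n hW hg0,
    iteratedFDeriv_comp_add_left] at h
  rw [iteratedDeriv_eq_iteratedFDeriv]
  have h' := congrArg (fun T => T fun _ => (1 : ℝ)) h
  simpa [g, f', Function.comp_def] using h'

theorem exists_hasLeadingTerm_line {f : E → F} {U : Set E} (hU : IsOpen U)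
    (hf : ContDiffOn ℝ ∞ f U) {q : E} (hq : q ∈ U) {n : ℕ} {v : E}
    (hn : iteratedFDeriv ℝ n f q (fun _ => v) ≠ 0) :
    ∃ m c, HasLeadingTerm (fun t : ℝ => f (q + t • v)) m c 0 := by
  refine exists_hasLeadingTerm ?_ ⟨n, by rwa [iteratedDeriv_comp_line hU hf hq]⟩
  refine ContDiffAt.comp (0 : ℝ) (g := f) ?_ (by fun_prop)
  simpa using hf.contDiffAt (hU.mem_nhds hq)

/-- Two functions without flat zero at `q` are of finite order along a common line. -/
theorem exists_common_line {F' : Type*} [NormedAddCommGroup F'] [NormedSpace ℝ F']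
    {f : E → F} {k : E → F'} {U : Set E} (hU : IsOpen U)
    (hf : ContDiffOn ℝ ∞ f U) (hk : ContDiffOn ℝ ∞ k U) {q : E} (hq : q ∈ U)
    (hfn : ∃ n, iteratedFDeriv ℝ n f q ≠ 0) (hkn : ∃ n, iteratedFDeriv ℝ n k q ≠ 0) :
    ∃ v, (∃ m c, HasLeadingTerm (fun t : ℝ => f (q + t • v)) m c 0) ∧
      ∃ m c, HasLeadingTerm (fun t : ℝ => k (q + t • v)) m c 0 := by
  obtain ⟨n, hn⟩ := hfn
  obtain ⟨m, hm⟩ := hkn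
  obtain ⟨w, hw⟩ := exists_iteratedFDeriv_diagonal_ne_zero hU hk hq hm
  obtain ⟨v, hv⟩ := exists_iteratedFDeriv_diagonal_ne_zero hU hf hq hn
  have hcont : Continuous fun y : E => iteratedFDeriv ℝ m k q fun _ => y :=
    (iteratedFDeriv ℝ m k q).cont.comp (by fun_prop)
  -- The diagonal of a multilinear form is analytic. Were it zero wherever the other diagonal is
  -- not, it would vanish near w and therefore everywhere.
  have han : AnalyticOnNhd ℝ (fun y : E => iteratedFDeriv ℝ n f q fun _ => y) univ := fun y _ =>
    (iteratedFDeriv ℝ n f q).analyticAt.comp 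
      (f := ContinuousLinearMap.pi fun _ : Fin n => ContinuousLinearMap.id ℝ E)
      (ContinuousLinearMap.analyticAt _ y)
  have hex : ∃ y, iteratedFDeriv ℝ n f q (fun _ => y) ≠ 0 ∧
      iteratedFDeriv ℝ m k q (fun _ => y) ≠ 0 := by
    by_contra! hcon
    have hev : (fun y : E => iteratedFDeriv ℝ n f q fun _ => y) =ᶠ[𝓝 w] 0 := by
      filter_upwards [hcont.continuousAt.eventually_ne hw] with y hy
      exact not_not.1 fun h => hy (hcon y h)
    exact hv (han.eqOn_zero_of_preconnected_of_eventuallyEq_zero isPreconnected_univ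
      (mem_univ w) hev (mem_univ v))
  obtain ⟨y, hy, hy'⟩ := hex
  exact ⟨y, exists_hasLeadingTerm_line hU hf hq hy, exists_hasLeadingTerm_line hU hk hq hy'⟩

end Symmetry

/-! ### Rotations of three-space. -/

section Rotations

/-- The reflection in the line ℝe changes the sign on a plane, so its determinant is 1. Having no
fixed vectors off the line, this single rotation replaces the whole stabilizer of e. -/
theorem exists_half_turn {e : E3} (he : e ≠ 0) :
    ∃ R : E3 ≃ₗᵢ[ℝ] E3, IsRotation R ∧ R e = e ∧ ∀ v, R v = v → ∃ c : ℝ, v = c • e := by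
  refine ⟨(ℝ ∙ e).reflection, ?_, ?_, fun v hv => ?_⟩
  · have h1 : Module.finrank ℝ (ℝ ∙ e) = 1 := finrank_span_singleton he
    have h2 := (ℝ ∙ e).finrank_add_finrank_orthogonal
    rw [h1, finrank_euclideanSpace_fin] at h2
    have h3 : Module.finrank ℝ (ℝ ∙ e)ᗮ = 2 := by omega
    have := (ℝ ∙ e).det_reflection
    rw [h3] at this
    simpa [IsRotation] using this
  · exact Submodule.reflection_mem_subspace_eq_self (Submodule.mem_span_singleton_self e)
  · rw [Submodule.reflection_eq_self_iff, Submodule.mem_span_singleton] at hv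
    exact hv.imp fun c hc => hc.symm

theorem det_reflection_orthogonal {e : E3} (he : e ≠ 0) :
    LinearMap.det (((ℝ ∙ e)ᗮ).reflection.toLinearEquiv : E3 →ₗ[ℝ] E3) = -1 := by
  have h1 : Module.finrank ℝ (ℝ ∙ e)ᗮᗮ = 1 := by
    rw [Submodule.orthogonal_orthogonal]; exact finrank_span_singleton he
  have := ((ℝ ∙ e)ᗮ).det_reflection
  rw [h1] at this
  simpa using this

theorem exists_ne_zero_inner_eq_zero (x : E3) : ∃ u : E3, u ≠ 0 ∧ inner ℝ x u = 0 := by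
  by_contra! hcon
  have hbot : (ℝ ∙ x)ᗮ = ⊥ := by
    rw [eq_bot_iff]
    intro u hu
    rw [Submodule.mem_orthogonal_singleton_iff_inner_right] at hu
    by_contra hne
    exact hcon u hne hu
  have h2 := (ℝ ∙ x).finrank_add_finrank_orthogonal
  rw [hbot, finrank_bot, finrank_euclideanSpace_fin] at h2
  have := finrank_span_le_card (R := ℝ) ({x} : Set E3)
  simp at this
  omega

/-- The mirror exchanging x and y has determinant -1; a second mirror, whose plane contains y,
corrects the determinant and leaves y in place. -/
theorem exists_rotation_map {x y : E3} (hxy : ‖x‖ = ‖y‖) :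
    ∃ R : E3 ≃ₗᵢ[ℝ] E3, IsRotation R ∧ R x = y := by
  rcases eq_or_ne x y with rfl | hne
  · exact ⟨LinearIsometryEquiv.refl ℝ E3, by simp [IsRotation], rfl⟩
  obtain ⟨u, hu, hyu⟩ := exists_ne_zero_inner_eq_zero y
  refine ⟨((ℝ ∙ (x - y))ᗮ).reflection.trans ((ℝ ∙ u)ᗮ).reflection, ?_, ?_⟩
  · have h1 := det_reflection_orthogonal (sub_ne_zero.2 hne)
    have h2 := det_reflection_orthogonal hu
    have hcomp : (((((ℝ ∙ (x - y))ᗮ).reflection.trans ((ℝ ∙ u)ᗮ).reflection).toLinearEquiv :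
        E3 ≃ₗ[ℝ] E3) : E3 →ₗ[ℝ] E3) =
        (((ℝ ∙ u)ᗮ).reflection.toLinearEquiv : E3 →ₗ[ℝ] E3) ∘ₗ
          (((ℝ ∙ (x - y))ᗮ).reflection.toLinearEquiv : E3 →ₗ[ℝ] E3) := rfl
    rw [IsRotation, hcomp, LinearMap.det_comp, h1, h2]
    norm_num
  · rw [LinearIsometryEquiv.trans_apply, Submodule.reflection_sub hxy]
    refine Submodule.reflection_mem_subspace_eq_self ?_
    rw [Submodule.mem_orthogonal_singleton_iff_inner_right, real_inner_comm]
    exact hyu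

theorem map_mem_iff_of_rotation_invariant {C : Set E3}
    (hC : ∀ R : E3 ≃ₗᵢ[ℝ] E3, IsRotation R → ∀ x ∈ C, R x ∈ C) {x y : E3} (hxy : ‖x‖ = ‖y‖) :
    x ∈ C ↔ y ∈ C := by
  constructor
  · intro h
    obtain ⟨R, hR, rfl⟩ := exists_rotation_map hxy
    exact hC R hR x h
  · intro h
    obtain ⟨R, hR, rfl⟩ := exists_rotation_map hxy.symm
    exact hC R hR y h

end Rotations

/-! ### Null covectors invariant under the rotations about an axis. -/

section Covectors

theorem covector_apply (κ : Spacetime →L[ℝ] ℝ) : ∃ k : E3,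
    (∀ v : Spacetime, κ v = κ (1, 0) * v.1 + inner ℝ k v.2) ∧
      minkowskiCoSq κ = -(κ (1, 0)) ^ 2 + ‖k‖ ^ 2 := by
  refine ⟨WithLp.toLp 2 fun i => κ (0, EuclideanSpace.single i 1), fun v => ?_, ?_⟩
  · have hv : v = v.1 • ((1, 0) : Spacetime) +
        ∑ i : Fin 3, v.2 i • ((0, EuclideanSpace.single i 1) : Spacetime) := by
      refine Prod.ext ?_ ?_
      · simp [Fin.sum_univ_three]
      · ext j
        fin_cases j <;> simp [Fin.sum_univ_three]
    conv_lhs => rw [hv]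
    simp only [map_add, map_smul, smul_eq_mul, PiLp.inner_apply, Fin.sum_univ_three]
    simp
    ring
  · simp [minkowskiCoSq, EuclideanSpace.norm_sq_eq]

theorem apply_time_ne_zero_of_null {κ : Spacetime →L[ℝ] ℝ} (hκ : minkowskiCoSq κ = 0)
    (h0 : κ ≠ 0) : κ (1, 0) ≠ 0 := by
  intro h
  obtain ⟨k, hk, hsq⟩ := covector_apply κ
  rw [hκ, h] at hsq
  have hk0 : k = 0 := by simpa using hsq.symm
  exact h0 (ContinuousLinearMap.ext fun v => by rw [hk, h, hk0]; simp)

theorem radialPart_self {x : E3} (hx : x ≠ 0) : radialPart x ((‖x‖)⁻¹ • x) = 1 := by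
  have := norm_ne_zero_iff.2 hx
  rw [radialPart, inner_smul_right, real_inner_self_eq_norm_sq]
  field_simp

/-- The square of a null covector which is invariant under the rotations fixing `x ≠ 0`. -/
theorem exists_sign_of_rotation_invariant {x : E3} (hx : x ≠ 0) {κ : Spacetime →L[ℝ] ℝ}
    (hκ : minkowskiCoSq κ = 0) (a : ℝ)
    (hinv : ∀ R : E3 ≃ₗᵢ[ℝ] E3, IsRotation R → R x = x → ∀ v w : Spacetime,
      a * κ (v.1, R v.2) * κ (w.1, R w.2) = a * κ v * κ w) :
    ∃ σ : ℝ, (σ = 1 ∨ σ = -1) ∧ ∀ v w : Spacetime, a * κ v * κ w =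
      a * κ (1, 0) * κ (1, 0) * (radialPart x v.2 - σ * v.1) * (radialPart x w.2 - σ * w.1) := by
  -- Where the tensor vanishes any sign serves; 1 is the default.
  by_cases ha : a = 0
  · exact ⟨1, Or.inl rfl, fun v w => by simp [ha]⟩
  by_cases h0 : κ = 0
  · exact ⟨1, Or.inl rfl, fun v w => by simp [h0]⟩
  have hκ0 := apply_time_ne_zero_of_null hκ h0
  obtain ⟨k, hk, hsq⟩ := covector_apply κ
  obtain ⟨R, hR, hRx, hfix⟩ := exists_half_turn hx
  -- Pairing with ∂_T, on which κ does not vanish, turns invariance of κ ⊗ κ into invariance of the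
  -- functional k. Then ⟨k, Rk⟩ = ⟨k, k⟩ = ⟨Rk, Rk⟩, so |Rk - k|² = 0.
  have hRk : R k = k := by
    rw [← sub_eq_zero, ← inner_self_eq_zero (𝕜 := ℝ)]
    have h1 : ∀ v, inner ℝ k (R v) = inner ℝ k v := by
      intro v
      have h := hinv R hR hRx (0, v) (1, 0)
      simp only [map_zero] at h
      have h' := mul_right_cancel₀ hκ0 h
      have h'' := mul_left_cancel₀ ha h'
      rw [hk, hk (0, v)] at h''
      simpa using h''
    have h2 := h1 k
    have h3 : inner ℝ (R k) (R k) = inner ℝ k k := R.inner_map_map k k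
    have h4 : inner ℝ (R k) k = inner ℝ k k := by rw [real_inner_comm]; exact h2
    rw [inner_sub_left, inner_sub_right, inner_sub_right, h3, h2, h4]
    ring
  obtain ⟨c, rfl⟩ := hfix k hRk
  have hr := norm_ne_zero_iff.2 hx
  have hcr : (c * ‖x‖) ^ 2 = κ (1, 0) ^ 2 := by
    rw [hκ, norm_smul, mul_pow, Real.norm_eq_abs, sq_abs] at hsq
    linarith
  have hcr0 : c * ‖x‖ ≠ 0 := fun h => hκ0 (by simpa [h] using hcr.symm)
  have happ : ∀ v : Spacetime, κ v = c * ‖x‖ * (radialPart x v.2 + κ (1, 0) / (c * ‖x‖) * v.1) := by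
    intro v
    rw [hk v, inner_smul_left, radialPart]
    have : c ≠ 0 := left_ne_zero_of_mul hcr0
    field_simp
    simp
    ring
  refine ⟨-(κ (1, 0) / (c * ‖x‖)), ?_, fun v w => ?_⟩
  · refine mul_self_eq_one_iff.1 ?_
    rw [← sq, neg_sq, div_pow, ← hcr, div_self (pow_ne_zero 2 hcr0)]
  · rw [happ v, happ w]
    linear_combination (a * (radialPart x v.2 + κ (1, 0) / (c * ‖x‖) * v.1) *
      (radialPart x w.2 + κ (1, 0) / (c * ‖x‖) * w.1)) * hcr

end Covectors

/-! ### The form of the metric. -/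

section FormOfMetric

theorem isOpen_manifold {C : Set E3} (hC : IsClosed C) : IsOpen (manifold C) :=
  hC.isOpen_compl.preimage continuous_snd

variable {C : Set E3} {h : Spacetime → ℝ} {K : Spacetime → (Spacetime →L[ℝ] ℝ)}

theorem kerrSchild_sub_minkowski (p v w : Spacetime) :
    kerrSchild h K p v w - minkowski v w = h p * K p v * K p w := by
  simp [kerrSchild]

theorem contDiffOn_kerrSchildTerm (h_smooth : ContDiffOn ℝ ∞ h (manifold C))
    (K_smooth : ContDiffOn ℝ ∞ K (manifold C)) (v w : Spacetime) :
    ContDiffOn ℝ ∞ (fun p => h p * K p v * K p w) (manifold C) :=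
  (h_smooth.mul (K_smooth.clm_apply contDiffOn_const)).mul (K_smooth.clm_apply contDiffOn_const)

/-- The field ∂_T has constant components, so its Lie derivative is the plain T-derivative of the
metric coefficients; the line ℝ × {x} stays in the manifold, so these are constant on it. -/
theorem kerrSchildTerm_time_independent (hC : IsClosed C)
    (h_smooth : ContDiffOn ℝ ∞ h (manifold C)) (K_smooth : ContDiffOn ℝ ∞ K (manifold C))
    (stationary : IsStationaryMetric (manifold C) (kerrSchild h K)) {x : E3} (hx : x ∉ C)
    (T : ℝ) (v w : Spacetime) :
    h (T, x) * K (T, x) v * K (T, x) w = h (0, x) * K (0, x) v * K (0, x) w := by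
  have hd : ∀ t : ℝ, HasDerivAt (fun t : ℝ => h (t, x) * K (t, x) v * K (t, x) w) 0 t := by
    intro t
    have hp : ((t, x) : Spacetime) ∈ manifold C := hx
    have hdiff : DifferentiableAt ℝ (fun p => h p * K p v * K p w) (t, x) :=
      ((contDiffOn_kerrSchildTerm h_smooth K_smooth v w).contDiffAt
        ((isOpen_manifold hC).mem_nhds hp)).differentiableAt (by simp)
    have hst := stationary (t, x) hp v w
    simp only [lieDerivative, fderiv_fun_const, Pi.zero_apply, zero_apply]
      at hst
    have hg : ∀ q : Spacetime, kerrSchild h K q 0 w = 0 ∧ kerrSchild h K q v 0 = 0 := by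
      intro q; constructor <;> simp [kerrSchild, minkowski]
    rw [(hg _).1, (hg _).2, add_zero, add_zero] at hst
    have hfd : fderiv ℝ (fun q => kerrSchild h K q v w) (t, x) =
        fderiv ℝ (fun p => h p * K p v * K p w) (t, x) := by
      simp only [kerrSchild]
      rw [fderiv_const_add]
    rw [hfd] at hst
    have hline : HasDerivAt (fun t : ℝ => ((t, x) : Spacetime)) (1, 0) t :=
      (hasDerivAt_id t).prodMk (hasDerivAt_const t x)
    have := hdiff.hasFDerivAt.comp_hasDerivAt t hline
    rw [hst] at this
    exact this
  exact is_const_of_deriv_eq_zero (fun t => (hd t).differentiableAt) (fun t => (hd t).deriv) T 0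

theorem kerrSchildTerm_rotation
    (spherical : IsSphericallySymmetric (manifold C) (kerrSchild h K)) {R : E3 ≃ₗᵢ[ℝ] E3}
    (hR : IsRotation R) {p : Spacetime} (hp : p ∈ manifold C) (v w : Spacetime) :
    h (p.1, R p.2) * K (p.1, R p.2) (v.1, R v.2) * K (p.1, R p.2) (w.1, R w.2) =
      h p * K p v * K p w := by
  have hs := spherical R hR p hp v w
  have hm : minkowski (v.1, R v.2) (w.1, R w.2) = minkowski v w := by
    simp [minkowski, LinearIsometryEquiv.inner_map_map]
  simp only [kerrSchild, hm] at hs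
  exact add_left_cancel hs

/-- The first coordinate vector of `ℝ³`. -/
noncomputable def e₁ : E3 := EuclideanSpace.single 0 1

theorem norm_e₁ : ‖e₁‖ = 1 := by simp [e₁]

theorem norm_smul_e₁ (t : ℝ) : ‖t • e₁‖ = |t| := by
  rw [norm_smul, norm_e₁, mul_one, Real.norm_eq_abs]

/-- The bundle of hypotheses on a stationary spherically symmetric Kerr-Schild metric. -/
structure IsStationarySphericalKerrSchild (C : Set E3) (h : Spacetime → ℝ)
    (K : Spacetime → (Spacetime →L[ℝ] ℝ)) : Prop where
  isClosed : IsClosed C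
  rot : ∀ R : E3 ≃ₗᵢ[ℝ] E3, IsRotation R → ∀ x ∈ C, R x ∈ C
  h_smooth : ContDiffOn ℝ ∞ h (manifold C)
  K_smooth : ContDiffOn ℝ ∞ K (manifold C)
  K_null : ∀ p ∈ manifold C, minkowskiCoSq (K p) = 0
  h_flat : ∀ p ∈ manifold C, ¬ IsFlatZero h p
  K_flat : ∀ p ∈ manifold C, ¬ IsFlatZero K p
  stationary : IsStationaryMetric (manifold C) (kerrSchild h K)
  spherical : IsSphericallySymmetric (manifold C) (kerrSchild h K)

/-- The profile of `h K ⊗ K` along the first coordinate axis. -/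
noncomputable def axisProfile (h : Spacetime → ℝ) (K : Spacetime → (Spacetime →L[ℝ] ℝ))
    (v w : Spacetime) (t : ℝ) : ℝ :=
  h (0, t • e₁) * K (0, t • e₁) v * K (0, t • e₁) w

variable (H : IsStationarySphericalKerrSchild C h K)

include H

theorem IsStationarySphericalKerrSchild.axisProfile_norm {x : E3} (hx : x ∉ C) (T : ℝ) :
    h (T, x) * K (T, x) (1, 0) * K (T, x) (1, 0) = axisProfile h K (1, 0) (1, 0) ‖x‖ := by
  obtain ⟨R, hR, hRx⟩ := exists_rotation_map (x := x) (y := ‖x‖ • e₁)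
    (by rw [norm_smul_e₁, abs_norm])
  have := kerrSchildTerm_rotation H.spherical hR (p := (0, x)) hx (1, 0) (1, 0)
  simp only [map_zero, hRx] at this
  rw [kerrSchildTerm_time_independent H.isClosed H.h_smooth H.K_smooth H.stationary hx, ← this,
    axisProfile]

theorem IsStationarySphericalKerrSchild.contDiffAt_axisProfile {t : ℝ} (ht : t • e₁ ∉ C)
    (v w : Spacetime) : ContDiffAt ℝ ∞ (axisProfile h K v w) t := by
  have h1 : ContDiffAt ℝ ∞ (fun p => h p * K p v * K p w) ((0, t • e₁) : Spacetime) :=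
    (contDiffOn_kerrSchildTerm H.h_smooth H.K_smooth v w).contDiffAt
      ((isOpen_manifold H.isClosed).mem_nhds ht)
  exact h1.comp t (f := fun t : ℝ => ((0, t • e₁) : Spacetime)) (by fun_prop)

/-- Along a common line of finite order for h and K the product h K_T² has finite order, and it is
the profile evaluated at the radius. A profile flat at ‖x‖ would make the product flat along the
line. -/
theorem IsStationarySphericalKerrSchild.exists_hasLeadingTerm {x : E3} (hx : x ∉ C) :
    ∃ m c, HasLeadingTerm (axisProfile h K (1, 0) (1, 0)) m c ‖x‖ := by
  have hrx : ‖x‖ • e₁ ∉ C := fun hmem => hx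
    ((map_mem_iff_of_rotation_invariant H.rot (by rw [norm_smul_e₁, abs_norm])).1 hmem)
  have hsm := H.contDiffAt_axisProfile hrx (1, 0) (1, 0)
  refine _root_.exists_hasLeadingTerm hsm ?_
  by_contra! hcon
  have hp : ((0, x) : Spacetime) ∈ manifold C := hx
  have hopen := isOpen_manifold H.isClosed
  obtain ⟨v, ⟨m, c, hm⟩, n, κ, hn⟩ := exists_common_line hopen H.h_smooth H.K_smooth hp
    (by simpa [IsFlatZero] using H.h_flat _ hp) (by simpa [IsFlatZero] using H.K_flat _ hp)
  have hcont : ContinuousAt (fun t : ℝ => ((0, x) : Spacetime) + t • v) 0 := by fun_prop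
  have hev : ∀ᶠ t in 𝓝 (0 : ℝ), ((0, x) : Spacetime) + t • v ∈ manifold C := by
    refine hcont.eventually (hopen.mem_nhds ?_)
    simpa using hp
  -- The null cone is closed and invariant under scaling, so the leading coefficient of K is null;
  -- being nonzero, it has a nonzero time component.
  have hκ : minkowskiCoSq κ = 0 := by
    have hc : Continuous minkowskiCoSq := by unfold minkowskiCoSq; fun_prop
    have h1 := hc.continuousAt.tendsto.comp hn.2
    refine tendsto_nhds_unique h1 (tendsto_const_nhds.congr' ?_)
    filter_upwards [hev.filter_mono nhdsWithin_le_nhds] with t ht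
    have h0 := H.K_null _ ht
    simp only [Function.comp_apply]
    simp only [minkowskiCoSq, smul_apply, smul_eq_mul, mul_pow,
      ← Finset.mul_sum] at h0 ⊢
    linear_combination (-(((t - 0) ^ n)⁻¹) ^ 2) * h0
  have hKT : HasLeadingTerm (fun t : ℝ => K ((0, x) + t • v) (1, 0)) n (κ (1, 0)) 0 := by
    refine ⟨apply_time_ne_zero_of_null hκ hn.1, ?_⟩
    exact ((ContinuousLinearMap.apply ℝ ℝ ((1, 0) : Spacetime)).continuous.continuousAt.tendsto).comp
      hn.2
  have hlead := (hm.mul hKT).mul hKT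
  refine hlead.not_isLittleO ?_
  set N := m + n + n
  have hflat := isLittleO_pow_of_iteratedDeriv_eq_zero hsm hcon N
  have hρ : Tendsto (fun t : ℝ => ‖x + t • v.2‖) (𝓝 0) (𝓝 ‖x‖) := by
    have : Continuous fun t : ℝ => ‖x + t • v.2‖ := by fun_prop
    simpa using this.tendsto 0
  have hcomp := hflat.comp_tendsto hρ
  -- Only the Lipschitz bound on the norm enters, so x = 0 is covered although the norm is not
  -- smooth there.
  have hO : (fun t : ℝ => (‖x + t • v.2‖ - ‖x‖) ^ N) =O[𝓝 0] fun t => (t - 0) ^ N := by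
    refine Asymptotics.IsBigO.pow (Asymptotics.IsBigO.of_bound ‖v.2‖ ?_) N
    filter_upwards with t
    have := abs_norm_sub_norm_le (x + t • v.2) x
    rw [add_sub_cancel_left, norm_smul] at this
    rw [Real.norm_eq_abs, sub_zero, mul_comm]
    exact this
  refine (hcomp.trans_isBigO hO).congr' ?_ (EventuallyEq.refl _ _)
  filter_upwards [hev] with t ht
  have := H.axisProfile_norm (x := x + t • v.2) ht (0 + t * v.1)
  exact this.symm

theorem IsStationarySphericalKerrSchild.exists_sign {x : E3} (hx : x ∉ C) (hx0 : x ≠ 0) (T : ℝ) :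
    ∃ σ : ℝ, (σ = 1 ∨ σ = -1) ∧ ∀ v w : Spacetime, h (T, x) * K (T, x) v * K (T, x) w =
      axisProfile h K (1, 0) (1, 0) ‖x‖ * (radialPart x v.2 - σ * v.1) *
        (radialPart x w.2 - σ * w.1) := by
  rw [← H.axisProfile_norm hx T]
  refine exists_sign_of_rotation_invariant hx0 (H.K_null _ hx) _ fun R hR hRx v w => ?_
  have := kerrSchildTerm_rotation H.spherical hR (p := (T, x)) hx v w
  simpa only [hRx] using this

theorem IsStationarySphericalKerrSchild.axisProfile_sq {t : ℝ} (ht : t • e₁ ∉ C) (ht0 : t ≠ 0) :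
    axisProfile h K (1, 0) (0, e₁) t ^ 2 = axisProfile h K (1, 0) (1, 0) t ^ 2 := by
  have hne : t • e₁ ≠ 0 := by
    rw [← norm_ne_zero_iff, norm_smul_e₁]; exact abs_ne_zero.2 ht0
  obtain ⟨σ, hσ, hS⟩ := H.exists_sign ht hne 0
  have h1 : axisProfile h K (1, 0) (0, e₁) t = _ := hS (1, 0) (0, e₁)
  have h2 : axisProfile h K (1, 0) (1, 0) t = _ := hS (1, 0) (1, 0)
  have hr : radialPart (t • e₁) e₁ ^ 2 = 1 := by
    rw [radialPart, norm_smul_e₁, inner_smul_left, real_inner_self_eq_norm_sq, norm_e₁, div_pow,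
      sq_abs]
    have := pow_ne_zero 2 ht0
    simp [this]
  have hr0 : radialPart (t • e₁) 0 = 0 := by simp [radialPart]
  have hσ2 : σ ^ 2 = 1 := by rcases hσ with rfl | rfl <;> norm_num
  rw [h1, h2]
  simp only [hr0]
  linear_combination (axisProfile h K (1, 0) (1, 0) ‖t • e₁‖) ^ 2 * σ ^ 2 * (hr - hσ2)

theorem IsStationarySphericalKerrSchild.eventually_eq_or_eq_neg {t₀ : ℝ} (ht0 : 0 ≤ t₀)
    (ht : t₀ • e₁ ∉ C) :
    (∀ᶠ t in 𝓝[≠] t₀, axisProfile h K (1, 0) (0, e₁) t = axisProfile h K (1, 0) (1, 0) t) ∨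
      ∀ᶠ t in 𝓝[≠] t₀, axisProfile h K (1, 0) (0, e₁) t = -axisProfile h K (1, 0) (1, 0) t := by
  obtain ⟨m, c, hlead⟩ := H.exists_hasLeadingTerm ht
  rw [norm_smul_e₁, abs_of_nonneg ht0] at hlead
  refine hlead.eventually_eq_or_eq_neg (H.contDiffAt_axisProfile ht _ _)
    (H.contDiffAt_axisProfile ht _ _) ?_
  have hne : ∀ᶠ t in 𝓝[≠] t₀, t ≠ 0 := by
    rcases eq_or_ne t₀ 0 with rfl | h0
    · exact self_mem_nhdsWithin
    · exact (eventually_ne_nhds h0).filter_mono nhdsWithin_le_nhds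
  have hopen : ∀ᶠ t in 𝓝 t₀, t • e₁ ∉ C :=
    (H.isClosed.isOpen_compl.preimage (f := fun t : ℝ => t • e₁) (by fun_prop)).mem_nhds ht
  filter_upwards [hne, hopen.filter_mono nhdsWithin_le_nhds] with t h1 h2
  exact H.axisProfile_sq h2 h1

/-- A rotation taking e₁ to -e₁ makes S(∂_T, e₁) odd and S(∂_T, ∂_T) even on the axis. If 0 were a
point of the manifold, they would agree up to one sign on both sides of 0, which forces the even one
to vanish there against its finite order. -/
theorem IsStationarySphericalKerrSchild.zero_mem : (0 : E3) ∈ C := by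
  by_contra h0
  have h0' : (0 : ℝ) • e₁ ∉ C := by rwa [zero_smul]
  obtain ⟨m, c, hlead⟩ := H.exists_hasLeadingTerm h0
  rw [norm_zero] at hlead
  obtain ⟨R, hR, hRe⟩ := exists_rotation_map (x := e₁) (y := -e₁) (by rw [norm_neg])
  have hopen : ∀ᶠ t in 𝓝 (0 : ℝ), t • e₁ ∉ C :=
    (H.isClosed.isOpen_compl.preimage (f := fun t : ℝ => t • e₁) (by fun_prop)).mem_nhds h0'
  have hodd : ∀ t : ℝ, t • e₁ ∉ C →
      axisProfile h K (1, 0) (0, e₁) (-t) = -axisProfile h K (1, 0) (0, e₁) t ∧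
        axisProfile h K (1, 0) (1, 0) (-t) = axisProfile h K (1, 0) (1, 0) t := by
    intro t ht
    have hRt : R (t • e₁) = -t • e₁ := by rw [map_smul, hRe, smul_neg, neg_smul]
    have h1 := kerrSchildTerm_rotation H.spherical hR (p := (0, t • e₁)) ht (1, 0) (0, e₁)
    have h2 := kerrSchildTerm_rotation H.spherical hR (p := (0, t • e₁)) ht (1, 0) (1, 0)
    have hneg : ((0, -e₁) : Spacetime) = -(0, e₁) := by simp
    simp only [hRt, map_zero, hRe, hneg, map_neg] at h1 h2
    exact ⟨by simp only [axisProfile]; linarith, by simp only [axisProfile]; linarith⟩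
  have hnegt : Tendsto (fun t : ℝ => -t) (𝓝[≠] 0) (𝓝[≠] 0) := by
    refine tendsto_nhdsWithin_iff.2 ⟨?_, ?_⟩
    · have : Tendsto (fun t : ℝ => -t) (𝓝 0) (𝓝 0) := by simpa using continuous_neg.tendsto (0 : ℝ)
      exact this.mono_left nhdsWithin_le_nhds
    · filter_upwards [self_mem_nhdsWithin] with t ht
      simpa using ht
  have hopen' := hopen.filter_mono (nhdsWithin_le_nhds (s := {(0 : ℝ)}ᶜ))
  rcases H.eventually_eq_or_eq_neg le_rfl h0' with hG | hG
  all_goals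
    obtain ⟨t, h1, h2, h3, h4⟩ :=
      (hlead.eventually_ne.and (hopen'.and (hG.and (hnegt.eventually hG)))).exists
    obtain ⟨h5, h6⟩ := hodd t h2
    rw [h5, h6, h3] at h4
    exact h1 (by linarith)

/-- The radii occurring in the manifold form a connected set. The radii with either sign are open,
cover it, and cannot overlap since the profile is nonzero near each radius apart from the radius
itself. -/
theorem IsStationarySphericalKerrSchild.eq_or_eq_neg (hconn : IsConnected (manifold C)) :
    ∃ σ : ℝ, (σ = 1 ∨ σ = -1) ∧ ∀ t, 0 < t → t • e₁ ∉ C →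
      axisProfile h K (1, 0) (0, e₁) t = -σ * axisProfile h K (1, 0) (1, 0) t := by
  set F := axisProfile h K (1, 0) (1, 0)
  set G := axisProfile h K (1, 0) (0, e₁)
  set I : Set ℝ := (fun p : Spacetime => ‖p.2‖) '' manifold C
  have hI : IsPreconnected I := (hconn.image _ (by fun_prop)).isPreconnected
  have hIC : ∀ t, 0 ≤ t → (t ∈ I ↔ t • e₁ ∉ C) := by
    intro t ht
    constructor
    · rintro ⟨p, hp, rfl⟩ hmem
      exact hp ((map_mem_iff_of_rotation_invariant H.rot
        (by rw [norm_smul_e₁, abs_norm])).1 hmem)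
    · intro hmem
      exact ⟨(0, t • e₁), hmem, by simp [norm_smul_e₁, abs_of_nonneg ht]⟩
  have hI0 : ∀ t ∈ I, 0 ≤ t := by rintro t ⟨p, _, rfl⟩; positivity
  set A : Set ℝ := {t | ∀ᶠ s in 𝓝[≠] t, G s = F s}
  set B : Set ℝ := {t | ∀ᶠ s in 𝓝[≠] t, G s = -F s}
  have hopen : ∀ P : ℝ → Prop, IsOpen {t | ∀ᶠ s in 𝓝[≠] t, P s} := by
    intro P
    rw [isOpen_iff_mem_nhds]
    intro t ht
    have ht' := ht
    simp only [mem_ofPred_eq] at ht'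
    rw [eventually_nhdsWithin_iff] at ht'
    filter_upwards [ht'.eventually_nhds] with u hu
    rcases eq_or_ne u t with rfl | hne
    · exact ht
    · filter_upwards [hu.filter_mono nhdsWithin_le_nhds,
        (eventually_ne_nhds hne).filter_mono nhdsWithin_le_nhds] with s hs hs'
      exact hs hs'
  have hcov : I ⊆ A ∪ B := fun t ht =>
    H.eventually_eq_or_eq_neg (hI0 t ht) ((hIC t (hI0 t ht)).1 ht)
  have hdisj : ∀ t ∈ I, ¬ (t ∈ A ∧ t ∈ B) := by
    rintro t ht ⟨hA, hB⟩
    obtain ⟨m, c, hlead⟩ := H.exists_hasLeadingTerm ((hIC t (hI0 t ht)).1 ht)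
    rw [norm_smul_e₁, abs_of_nonneg (hI0 t ht)] at hlead
    have hA' : ∀ᶠ s in 𝓝[≠] t, G s = F s := hA
    have hB' : ∀ᶠ s in 𝓝[≠] t, G s = -F s := hB
    obtain ⟨s, h1, h2, h3⟩ := (hlead.eventually_ne.and (hA'.and hB')).exists
    change F s ≠ 0 at h1
    exact h1 (by linarith)
  -- The sign relation is known only on punctured neighbourhoods; continuity adds the centre.
  have hlim : ∀ (ε : ℝ) (t : ℝ), t • e₁ ∉ C → (∀ᶠ s in 𝓝[≠] t, G s = ε * F s) →
      G t = ε * F t := by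
    intro ε t ht hev
    have hF := (H.contDiffAt_axisProfile ht (1, 0) (1, 0)).continuousAt.tendsto
    have hG := (H.contDiffAt_axisProfile ht (1, 0) (0, e₁)).continuousAt.tendsto
    exact tendsto_nhds_unique ((hG.mono_left (nhdsWithin_le_nhds (s := {t}ᶜ))).congr' hev)
      ((hF.mono_left nhdsWithin_le_nhds).const_mul ε)
  have hsub : I ⊆ A ∨ I ⊆ B := by
    by_contra! hcon
    obtain ⟨⟨a, haI, haA⟩, b, hbI, hbB⟩ := And.imp not_subset.1 not_subset.1 hcon
    obtain ⟨t, htI, htAB⟩ := hI A B (hopen _) (hopen _) hcov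
      ⟨b, hbI, (hcov hbI).resolve_right hbB⟩ ⟨a, haI, (hcov haI).resolve_left haA⟩
    exact hdisj t htI htAB
  rcases hsub with hA | hB
  · refine ⟨-1, Or.inr rfl, fun t ht htC => ?_⟩
    refine hlim _ t htC ?_
    filter_upwards [hA ((hIC t ht.le).2 htC)] with s hs
    rw [hs]; ring
  · refine ⟨1, Or.inl rfl, fun t ht htC => ?_⟩
    refine hlim _ t htC ?_
    filter_upwards [hB ((hIC t ht.le).2 htC)] with s hs
    rw [hs]; ring

/-- The form of a stationary spherically symmetric Kerr-Schild metric. -/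
theorem IsStationarySphericalKerrSchild.exists_radialKerrSchild
    (hconn : IsConnected (manifold C)) :
    ∃ (σ : ℝ) (F : ℝ → ℝ), (σ = 1 ∨ σ = -1) ∧
      ContDiffOn ℝ ∞ F {r | ∃ x : E3, x ∉ C ∧ ‖x‖ = r} ∧
      ∀ p ∈ manifold C, kerrSchild h K p = radialKerrSchild σ F p := by
  obtain ⟨σ, hσ, hGF⟩ := H.eq_or_eq_neg hconn
  have hmemC : ∀ x : E3, x ∉ C → ‖x‖ • e₁ ∉ C := fun x hx hmem => hx
    ((map_mem_iff_of_rotation_invariant H.rot (by rw [norm_smul_e₁, abs_norm])).1 hmem)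
  refine ⟨σ, axisProfile h K (1, 0) (1, 0), hσ, ?_, ?_⟩
  · rintro r ⟨x, hx, rfl⟩
    exact (H.contDiffAt_axisProfile (hmemC x hx) _ _).contDiffWithinAt
  · rintro ⟨T, x⟩ hp
    have hx : x ∉ C := hp
    have hx0 : x ≠ 0 := fun h0 => hx (h0 ▸ H.zero_mem)
    have hr := norm_pos_iff.2 hx0
    obtain ⟨τ, hτ, hS⟩ := H.exists_sign hx hx0 T
    funext v w
    rw [radialKerrSchild, ← sub_eq_iff_eq_add', kerrSchild_sub_minkowski, hS v w]
    -- Where the profile vanishes the sign is irrelevant. Elsewhere rotating x to the axis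
    -- identifies the sign at x with the global one.
    by_cases hF : axisProfile h K (1, 0) (1, 0) ‖x‖ = 0
    · simp [hF]
    suffices τ = σ by rw [this]
    obtain ⟨R, hR, hRx⟩ := exists_rotation_map (x := x) (y := ‖x‖ • e₁)
      (by rw [norm_smul_e₁, abs_norm])
    have h1 := kerrSchildTerm_rotation H.spherical hR (p := (0, x)) hx (1, 0) (0, (‖x‖)⁻¹ • x)
    have hR1 : R ((‖x‖)⁻¹ • x) = e₁ := by
      rw [map_smul, hRx, smul_smul, inv_mul_cancel₀ hr.ne', one_smul]
    simp only [map_zero, hRx, hR1] at h1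
    rw [← kerrSchildTerm_time_independent H.isClosed H.h_smooth H.K_smooth H.stationary hx T,
      hS] at h1
    have h2 := hGF ‖x‖ hr (hmemC x hx)
    simp only [axisProfile] at h2
    rw [h2] at h1
    simp only [radialPart_self hx0] at h1
    have h3 : radialPart x 0 = 0 := by simp [radialPart]
    rw [h3] at h1
    have h4 : axisProfile h K (1, 0) (1, 0) ‖x‖ * (τ - σ) = 0 := by
      simp only [axisProfile] at h1 ⊢
      linear_combination h1
    exact sub_eq_zero.1 ((mul_eq_zero.1 h4).resolve_left hF)

end FormOfMetric

/-! ### Derivatives of norm, radial part and vector product along curves. -/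

section CurveCalculus

theorem hasDerivAt_norm_curve {x : ℝ → E3} {x' : E3} {s : ℝ} (hx : HasDerivAt x x' s)
    (h0 : x s ≠ 0) : HasDerivAt (fun t => ‖x t‖) (radialPart (x s) x') s := by
  have hr := norm_ne_zero_iff.2 h0
  have h1 := (hx.inner ℝ hx).sqrt (by rw [real_inner_self_eq_norm_sq]; positivity)
  have h2 : (fun t => Real.sqrt (inner ℝ (x t) (x t))) = fun t => ‖x t‖ := by
    funext t
    rw [real_inner_self_eq_norm_sq, Real.sqrt_sq (norm_nonneg _)]
  rw [h2] at h1
  convert h1 using 1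
  rw [real_inner_self_eq_norm_sq, Real.sqrt_sq (norm_nonneg _), real_inner_comm, radialPart]
  rw [real_inner_comm x' (x s)]
  field_simp
  ring

theorem hasDerivAt_radialPart {x v : ℝ → E3} {x' v' : E3} {s : ℝ} (hx : HasDerivAt x x' s)
    (hv : HasDerivAt v v' s) (h0 : x s ≠ 0) :
    HasDerivAt (fun t => radialPart (x t) (v t))
      (radialPart (x s) v' + (inner ℝ x' (v s) / ‖x s‖ -
        inner ℝ (x s) (v s) * inner ℝ (x s) x' / ‖x s‖ ^ 3)) s := by
  have hr := norm_ne_zero_iff.2 h0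
  have h := (hx.inner ℝ hv).fun_div (hasDerivAt_norm_curve hx h0) hr
  refine h.congr_deriv ?_
  simp only [radialPart]
  field_simp
  ring

theorem norm_cross_sq (x v : E3) :
    ‖cross x v‖ ^ 2 = ‖x‖ ^ 2 * ‖v‖ ^ 2 - (inner ℝ x v) ^ 2 := by
  simp only [cross, EuclideanSpace.real_norm_sq_eq, PiLp.inner_apply, Fin.sum_univ_three,
    cross_apply]
  simp
  ring

theorem norm_sq_eq_radialPart_sq_add {x : E3} (hx : x ≠ 0) (v : E3) :
    ‖v‖ ^ 2 = radialPart x v ^ 2 + ‖cross x v‖ ^ 2 / ‖x‖ ^ 2 := by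
  have hr := norm_ne_zero_iff.2 hx
  rw [norm_cross_sq, radialPart]
  field_simp
  ring

theorem cross_smul_self (c : ℝ) (x : E3) : cross x (c • x) = 0 := by
  ext i
  fin_cases i <;> simp [cross]

theorem hasDerivAt_cross {x v : ℝ → E3} {x' v' : E3} {s : ℝ} (hx : HasDerivAt x x' s)
    (hv : HasDerivAt v v' s) :
    HasDerivAt (fun t => cross (x t) (v t))
      (cross x' (v s) + cross (x s) v') s := by
  have hxi : ∀ i, HasDerivAt (fun t => x t i) (x' i) s := fun i =>
    (EuclideanSpace.proj (𝕜 := ℝ) i).hasFDerivAt.comp_hasDerivAt s hx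
  have hvi : ∀ i, HasDerivAt (fun t => v t i) (v' i) s := fun i =>
    (EuclideanSpace.proj (𝕜 := ℝ) i).hasFDerivAt.comp_hasDerivAt s hv
  have hpi : HasDerivAt (fun t => WithLp.ofLp (cross (x t) (v t)))
      (WithLp.ofLp (cross x' (v s) + cross (x s) v')) s := by
    rw [hasDerivAt_pi]
    intro i
    fin_cases i <;> simp only [cross, cross_apply] <;> simp
    · convert ((hxi 1).fun_mul (hvi 2)).fun_sub ((hxi 2).fun_mul (hvi 1)) using 1
      ring
    · convert ((hxi 2).fun_mul (hvi 0)).fun_sub ((hxi 0).fun_mul (hvi 2)) using 1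
      ring
    · convert ((hxi 0).fun_mul (hvi 1)).fun_sub ((hxi 1).fun_mul (hvi 0)) using 1
      ring
  exact (PiLp.continuousLinearEquiv 2 ℝ
    (fun _ : Fin 3 => ℝ)).symm.toContinuousLinearMap.hasFDerivAt.comp_hasDerivAt s hpi

theorem gradient_comp_norm {φ : ℝ → ℝ} {φ' : ℝ} {x : E3} (hx : x ≠ 0)
    (hφ : HasDerivAt φ φ' ‖x‖) : gradient (fun y => φ ‖y‖) x = (φ' / ‖x‖) • x := by
  refine HasGradientAt.gradient ?_
  rw [hasGradientAt_iff_hasFDerivAt]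
  have hd : DifferentiableAt ℝ (fun y : E3 => ‖y‖) x := differentiableAt_id.norm ℝ hx
  have hcomp := hφ.hasFDerivAt.comp x hd.hasFDerivAt
  refine hcomp.congr_fderiv ?_
  symm
  refine ContinuousLinearMap.ext fun (z : E3) => ?_
  have h1 : HasDerivAt (fun t : ℝ => ‖x + t • z‖)
      (fderiv ℝ (fun y : E3 => ‖y‖) x z) 0 := by
    have hl : HasDerivAt (fun t : ℝ => x + t • z) z 0 := by
      simpa using ((hasDerivAt_id (0 : ℝ)).smul_const z).const_add x
    have hd' : HasFDerivAt (fun y : E3 => ‖y‖) (fderiv ℝ (fun y : E3 => ‖y‖) x)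
        (x + (0 : ℝ) • z) := by simpa using hd.hasFDerivAt
    exact hd'.comp_hasDerivAt 0 hl
  have h2 : HasDerivAt (fun t : ℝ => ‖x + t • z‖) (radialPart x z) 0 := by
    have hl : HasDerivAt (fun t : ℝ => x + t • z) z 0 := by
      simpa using ((hasDerivAt_id (0 : ℝ)).smul_const z).const_add x
    simpa using hasDerivAt_norm_curve hl (by simpa using hx)
  have h3 := h1.unique h2
  simp only [ContinuousLinearMap.comp_apply, h3, radialPart]
  simp
  ring

theorem hasDerivAt_of_contDiffOn_two {E : Type*} [NormedAddCommGroup E] [NormedSpace ℝ E]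
    {f : ℝ → E} {J : Set ℝ} (hf : ContDiffOn ℝ 2 f J) (hJ : IsOpen J) {s : ℝ} (hs : s ∈ J) :
    HasDerivAt f (deriv f s) s ∧ HasDerivAt (deriv f) (deriv (deriv f) s) s := by
  have h1 : ContDiffOn ℝ 1 (deriv f) J := ((contDiffOn_succ_iff_deriv_of_isOpen (n := 1) hJ).1
    (by simpa [one_add_one_eq_two] using hf)).2.2
  exact ⟨((hf.differentiableOn (by simp)).differentiableAt (hJ.mem_nhds hs)).hasDerivAt,
    ((h1.differentiableOn (by simp)).differentiableAt (hJ.mem_nhds hs)).hasDerivAt⟩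

theorem eq_of_hasDerivAt_zero {E : Type*} [NormedAddCommGroup E] [NormedSpace ℝ E]
    {f : ℝ → E} {J : Set ℝ} (hJ : IsOpen J) (hJc : J.OrdConnected)
    (hf : ∀ s ∈ J, HasDerivAt f 0 s) {s t : ℝ} (hs : s ∈ J) (ht : t ∈ J) : f s = f t :=
  hJ.is_const_of_deriv_eq_zero hJc.isPreconnected
    (fun u hu => (hf u hu).differentiableAt.differentiableWithinAt)
    (fun u hu => (hf u hu).deriv) hs ht

end CurveCalculus

/-! ### Radial functions: the force of the potential and the derivative of the metric. -/

section RadialFunction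

variable {C : Set E3}

theorem isOpen_radii (hC : IsClosed C) (h0 : (0 : E3) ∈ C) :
    IsOpen {r | ∃ x : E3, x ∉ C ∧ ‖x‖ = r} := by
  rw [isOpen_iff_mem_nhds]
  rintro r ⟨x, hx, rfl⟩
  have hr : 0 < ‖x‖ := norm_pos_iff.2 fun h => hx (h ▸ h0)
  have hcont : Continuous fun t : ℝ => (t / ‖x‖) • x := by fun_prop
  have hmem : ∀ᶠ t in 𝓝 ‖x‖, (t / ‖x‖) • x ∈ Cᶜ :=
    hcont.continuousAt.eventually (hC.isOpen_compl.mem_nhds (by simpa [hr.ne'] using hx))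
  filter_upwards [hmem, eventually_gt_nhds hr] with t ht htpos
  refine ⟨_, ht, ?_⟩
  rw [norm_smul, Real.norm_eq_abs, abs_of_pos (by positivity)]
  field_simp

theorem contDiffAt_radius (hC : IsClosed C) (h0 : (0 : E3) ∈ C) {H : ℝ → ℝ}
    (hH : ContDiffOn ℝ ∞ H {r | ∃ x : E3, x ∉ C ∧ ‖x‖ = r}) {x : E3} (hx : x ∉ C) :
    ContDiffAt ℝ ∞ H ‖x‖ :=
  hH.contDiffAt ((isOpen_radii hC h0).mem_nhds ⟨x, hx, rfl⟩)

theorem hasDerivAt_radius (hC : IsClosed C) (h0 : (0 : E3) ∈ C) {H : ℝ → ℝ}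
    (hH : ContDiffOn ℝ ∞ H {r | ∃ x : E3, x ∉ C ∧ ‖x‖ = r}) {x : E3} (hx : x ∉ C) :
    HasDerivAt H (deriv H ‖x‖) ‖x‖ :=
  ((contDiffAt_radius hC h0 hH hx).differentiableAt (by simp)).hasDerivAt

theorem gradient_potential {H : ℝ → ℝ} {H' : ℝ} {x : E3} (hx : x ≠ 0)
    (hH : HasDerivAt H H' ‖x‖) (ℓ μ : ℝ) :
    -gradient (potential H ℓ μ) x =
      ((H' / 2 * (ℓ ^ 2 / ‖x‖ ^ 2 + μ) - H ‖x‖ * (ℓ ^ 2 / ‖x‖ ^ 3)) / ‖x‖) • x := by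
  have hr := norm_ne_zero_iff.2 hx
  have h1 : HasDerivAt (fun r : ℝ => ℓ ^ 2 / r ^ 2 + μ) (-(2 * ℓ ^ 2 / ‖x‖ ^ 3)) ‖x‖ := by
    have := (((hasDerivAt_const ‖x‖ (ℓ ^ 2)).fun_div ((hasDerivAt_id' ‖x‖).fun_pow 2)
      (pow_ne_zero 2 hr))).add_const μ
    refine this.congr_deriv ?_
    field_simp
    ring
  have h2 : HasDerivAt (fun r : ℝ => -(H r / 2) * (ℓ ^ 2 / r ^ 2 + μ))
      (-(H' / 2 * (ℓ ^ 2 / ‖x‖ ^ 2 + μ) - H ‖x‖ * (ℓ ^ 2 / ‖x‖ ^ 3))) ‖x‖ := by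
    refine (((hH.div_const 2).fun_neg).fun_mul h1).congr_deriv ?_
    field_simp
    ring
  have h3 : gradient (potential H ℓ μ) x = _ := gradient_comp_norm hx h2
  rw [h3, ← neg_smul]
  congr 1
  ring

theorem fderiv_radialKerrSchild {σ : ℝ} {H : ℝ → ℝ} {p : Spacetime} (hp : p.2 ≠ 0)
    (hH : DifferentiableAt ℝ H ‖p.2‖) (v w z : Spacetime) :
    fderiv ℝ (fun q => radialKerrSchild σ H q v w) p z =
      deriv H ‖p.2‖ * radialPart p.2 z.2 * (radialPart p.2 v.2 - σ * v.1) *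
        (radialPart p.2 w.2 - σ * w.1) +
      H ‖p.2‖ * (inner ℝ z.2 v.2 / ‖p.2‖ - inner ℝ p.2 v.2 * inner ℝ p.2 z.2 / ‖p.2‖ ^ 3) *
        (radialPart p.2 w.2 - σ * w.1) +
      H ‖p.2‖ * (radialPart p.2 v.2 - σ * v.1) *
        (inner ℝ z.2 w.2 / ‖p.2‖ - inner ℝ p.2 w.2 * inner ℝ p.2 z.2 / ‖p.2‖ ^ 3) := by
  have hr := norm_ne_zero_iff.2 hp
  have hnorm : DifferentiableAt ℝ (fun q : Spacetime => ‖q.2‖) p :=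
    differentiableAt_snd.norm ℝ hp
  have hrad : ∀ y : E3, DifferentiableAt ℝ (fun q : Spacetime => radialPart q.2 y) p := fun y => by
    simpa only [radialPart, div_eq_mul_inv] using
      (differentiableAt_snd.inner ℝ (differentiableAt_const y)).fun_mul (hnorm.fun_inv hr)
  have hHd : DifferentiableAt ℝ (fun q : Spacetime => H ‖q.2‖) p :=
    DifferentiableAt.comp p (g := H) hH hnorm
  have hd : DifferentiableAt ℝ (fun q => radialKerrSchild σ H q v w) p :=
    (differentiableAt_const _).fun_add ((hHd.fun_mul ((hrad v.2).sub_const _)).fun_mul ((hrad w.2).sub_const _))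
  have hl : HasDerivAt (fun t : ℝ => p + t • z) z 0 := by
    simpa using ((hasDerivAt_id (0 : ℝ)).smul_const z).const_add p
  have hl2 : HasDerivAt (fun t : ℝ => p.2 + t • z.2) z.2 0 := by
    simpa using ((hasDerivAt_id (0 : ℝ)).smul_const z.2).const_add p.2
  have hp0 : p.2 + (0 : ℝ) • z.2 ≠ 0 := by simpa using hp
  -- The derivative in the direction z is read off from the line p + t z, where the calculus of
  -- curves applies.
  have h1 : HasDerivAt (fun t : ℝ => radialKerrSchild σ H (p + t • z) v w)
      (fderiv ℝ (fun q => radialKerrSchild σ H q v w) p z) 0 := by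
    have hd' : HasFDerivAt (fun q => radialKerrSchild σ H q v w)
        (fderiv ℝ (fun q => radialKerrSchild σ H q v w) p) (p + (0 : ℝ) • z) := by
      simpa using hd.hasFDerivAt
    exact hd'.comp_hasDerivAt 0 hl
  have hN := hasDerivAt_norm_curve hl2 hp0
  have hv := (hasDerivAt_radialPart hl2 (hasDerivAt_const (0 : ℝ) v.2) hp0).sub_const (σ * v.1)
  have hw := (hasDerivAt_radialPart hl2 (hasDerivAt_const (0 : ℝ) w.2) hp0).sub_const (σ * w.1)
  have hHt : HasDerivAt (fun t : ℝ => H ‖p.2 + t • z.2‖)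
      (deriv H ‖p.2‖ * radialPart (p.2 + (0 : ℝ) • z.2) z.2) 0 := by
    refine HasDerivAt.comp (0 : ℝ) (h₂ := H) ?_ hN
    simpa using hH.hasDerivAt
  have h2 := ((hHt.fun_mul hv).fun_mul hw).const_add (minkowski v w)
  rw [h1.unique h2]
  have hz : ∀ y : E3, radialPart y 0 = 0 := fun y => by simp [radialPart]
  simp only [zero_smul, add_zero, hz, zero_add]
  ring

end RadialFunction

/-! ### The geodesic equation of the radial metric. -/

section GeodesicEquation

variable {C : Set E3} {σ : ℝ} {H : ℝ → ℝ}

/-- The data of a metric `-dT² + dx·dx + H(r) (dr - σ dT)²` on `ℝ × (ℝ³ ∖ C)`. -/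
structure IsRadialProfile (C : Set E3) (σ : ℝ) (H : ℝ → ℝ) : Prop where
  isClosed : IsClosed C
  zero_mem : (0 : E3) ∈ C
  sign : σ = 1 ∨ σ = -1
  smooth : ContDiffOn ℝ ∞ H {r | ∃ x : E3, x ∉ C ∧ ‖x‖ = r}

theorem IsRadialProfile.sq_sign (P : IsRadialProfile C σ H) : σ ^ 2 = 1 := by
  rcases P.sign with rfl | rfl <;> norm_num

theorem IsRadialProfile.ne_zero (P : IsRadialProfile C σ H) {x : E3} (hx : x ∉ C) : x ≠ 0 :=
  fun h => hx (h ▸ P.zero_mem)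

theorem IsRadialProfile.hasDerivAt (P : IsRadialProfile C σ H) {x : E3} (hx : x ∉ C) :
    HasDerivAt H (deriv H ‖x‖) ‖x‖ :=
  hasDerivAt_radius P.isClosed P.zero_mem P.smooth hx

/-- The value `ṙ - σ Ṫ` of the form `dr - σ dT` on the tangent vector `u`. -/
noncomputable def nullPart (σ : ℝ) (x : E3) (u : Spacetime) : ℝ := radialPart x u.2 - σ * u.1

/-- The derivative of `h (ṙ - σ Ṫ)` along a curve with velocity `u` and acceleration `u'`. -/
noncomputable def nullMomentumRate (σ : ℝ) (H : ℝ → ℝ) (x : E3) (u u' : Spacetime) : ℝ :=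
  deriv H ‖x‖ * radialPart x u.2 * nullPart σ x u +
    H ‖x‖ * (radialPart x u'.2 + ‖cross x u.2‖ ^ 2 / ‖x‖ ^ 3 - σ * u'.1)

/-- Off h = 1 this linear relation determines ṙ - σṪ from ṙ and E; at h = 1 it loses that
information and says ṙ = σE instead. -/
theorem mul_energyOf (hσ : σ ^ 2 = 1) (x : E3) (u : Spacetime) :
    σ * energyOf σ H x u = radialPart x u.2 - (1 - H ‖x‖) * nullPart σ x u := by
  simp only [energyOf, nullPart]
  linear_combination (H ‖x‖ * radialPart x u.2) * hσ

/-- In this form the energy is visibly -g(u, ∂_T), hence conserved along geodesics. -/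
theorem energyOf_eq (hσ : σ ^ 2 = 1) (x : E3) (u : Spacetime) :
    energyOf σ H x u = u.1 + σ * (H ‖x‖ * nullPart σ x u) := by
  simp only [energyOf, nullPart]
  linear_combination (H ‖x‖ * u.1) * hσ

theorem radialMomentum_eq (x : E3) (u : Spacetime) :
    radialMomentum σ H x u = radialPart x u.2 + H ‖x‖ * nullPart σ x u := by
  simp only [radialMomentum, nullPart]
  ring

/-- Both -Ṫ² + ṙ² and h (ṙ - σṪ)² contain the factor ṙ - σṪ; the cofactor is ṙ + σE. -/
theorem radialKerrSchild_self (hσ : σ ^ 2 = 1) {p : Spacetime} (hp : p.2 ≠ 0) (u : Spacetime) :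
    radialKerrSchild σ H p u u =
      nullPart σ p.2 u * (radialPart p.2 u.2 + σ * energyOf σ H p.2 u) +
        ‖cross p.2 u.2‖ ^ 2 / ‖p.2‖ ^ 2 := by
  rw [radialKerrSchild, minkowski, real_inner_self_eq_norm_sq, norm_sq_eq_radialPart_sq_add hp,
    mul_energyOf hσ]
  simp only [nullPart]
  linear_combination (u.1 ^ 2) * hσ

theorem radialPart_smul_self {x : E3} (hx : x ≠ 0) (c : ℝ) :
    radialPart x ((c / ‖x‖) • x) = c := by
  have hr := norm_ne_zero_iff.2 hx
  rw [radialPart, inner_smul_right, real_inner_self_eq_norm_sq]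
  field_simp

/-- The lowered equation is the Minkowski pairing of w with a time residual and a space residual.
Testing with ∂_T and with the space residual itself separates the two, without inverting the metric.
-/
theorem geodesic_equation_iff {p : Spacetime} (hp : p.2 ≠ 0)
    (hH : DifferentiableAt ℝ H ‖p.2‖) (u u' : Spacetime) :
    (∀ w, radialKerrSchild σ H p u' w + christoffel (radialKerrSchild σ H) p u u w = 0) ↔
      u'.1 + σ * nullMomentumRate σ H p.2 u u' = 0 ∧
      u'.2 = ((deriv H ‖p.2‖ / 2 * nullPart σ p.2 u ^ 2 - nullMomentumRate σ H p.2 u u') /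
        ‖p.2‖) • p.2 := by
  have hr := norm_ne_zero_iff.2 hp
  set m := nullMomentumRate σ H p.2 u u' with hm
  set c := deriv H ‖p.2‖ / 2 * nullPart σ p.2 u ^ 2 - m with hc
  have key : ∀ w, radialKerrSchild σ H p u' w + christoffel (radialKerrSchild σ H) p u u w =
      -(u'.1 + σ * m) * w.1 + inner ℝ (u'.2 - (c / ‖p.2‖) • p.2) w.2 := by
    intro w
    rw [christoffel, fderiv_radialKerrSchild hp hH, fderiv_radialKerrSchild hp hH, inner_sub_left,
      inner_smul_left, hc, hm]
    simp only [radialKerrSchild, minkowski, nullMomentumRate, nullPart, radialPart, norm_cross_sq,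
      real_inner_self_eq_norm_sq, real_inner_comm u.2 w.2]
    simp
    field_simp
    ring
  constructor
  · intro h
    have h1 := h (1, 0)
    have h2 := h (0, u'.2 - (c / ‖p.2‖) • p.2)
    rw [key] at h1 h2
    simp only [mul_one, inner_zero_right, add_zero, neg_eq_zero] at h1
    simp only [mul_zero, zero_add, inner_self_eq_zero] at h2
    exact ⟨h1, sub_eq_zero.1 h2⟩
  · rintro ⟨h1, h2⟩ w
    rw [key, h1, sub_eq_zero.2 h2]
    simp

theorem hasDerivAt_radialPart_deriv {x : ℝ → E3} {J : Set ℝ} (hJ : IsOpen J)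
    (hx : ContDiffOn ℝ 2 x J) {s : ℝ} (hs : s ∈ J) (h0 : x s ≠ 0) :
    HasDerivAt (fun t => radialPart (x t) (deriv x t))
      (radialPart (x s) (deriv (deriv x) s) +
        ‖cross (x s) (deriv x s)‖ ^ 2 / ‖x s‖ ^ 3) s := by
  obtain ⟨h1, h2⟩ := hasDerivAt_of_contDiffOn_two hx hJ hs
  refine (hasDerivAt_radialPart h1 h2 h0).congr_deriv ?_
  have hr := norm_ne_zero_iff.2 h0
  rw [norm_cross_sq, real_inner_self_eq_norm_sq]
  field_simp

/-- The curve has velocity `(Ṫ, ẋ)` and acceleration `(T̈, ẍ)`. -/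
theorem hasDerivAt_pair {T : ℝ → ℝ} {x : ℝ → E3} {J : Set ℝ} (hJ : IsOpen J)
    (hT : ContDiffOn ℝ 2 T J) (hx : ContDiffOn ℝ 2 x J) {s : ℝ} (hs : s ∈ J) :
    deriv (fun t => (T t, x t)) s = (deriv T s, deriv x s) ∧
      deriv (deriv fun t => (T t, x t)) s = (deriv (deriv T) s, deriv (deriv x) s) := by
  have h1 : ∀ t ∈ J, deriv (fun t => (T t, x t)) t = (deriv T t, deriv x t) := fun t ht =>
    ((hasDerivAt_of_contDiffOn_two hT hJ ht).1.prodMk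
      (hasDerivAt_of_contDiffOn_two hx hJ ht).1).deriv
  refine ⟨h1 s hs, ?_⟩
  have h2 : deriv (fun t => (T t, x t)) =ᶠ[𝓝 s] fun t => (deriv T t, deriv x t) := by
    filter_upwards [hJ.mem_nhds hs] with t ht using h1 t ht
  rw [h2.deriv_eq]
  exact ((hasDerivAt_of_contDiffOn_two hT hJ hs).2.prodMk
    (hasDerivAt_of_contDiffOn_two hx hJ hs).2).deriv

/-- The equations satisfied at the parameter `s` by a normalized geodesic `(T, x)`. -/
structure GeodesicEquationsAt (σ : ℝ) (H : ℝ → ℝ) (μ : ℝ) (T : ℝ → ℝ) (x : ℝ → E3) (s : ℝ) :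
    Prop where
  time : deriv (deriv T) s + σ * nullMomentumRate σ H (x s) (deriv T s, deriv x s)
    (deriv (deriv T) s, deriv (deriv x) s) = 0
  space : deriv (deriv x) s = ((deriv H ‖x s‖ / 2 * nullPart σ (x s) (deriv T s, deriv x s) ^ 2 -
    nullMomentumRate σ H (x s) (deriv T s, deriv x s)
      (deriv (deriv T) s, deriv (deriv x) s)) / ‖x s‖) • x s
  normalization : nullPart σ (x s) (deriv T s, deriv x s) *
    (radialPart (x s) (deriv x s) + σ * energyOf σ H (x s) (deriv T s, deriv x s)) +
      (‖cross (x s) (deriv x s)‖ ^ 2 / ‖x s‖ ^ 2 + μ) = 0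

theorem IsRadialProfile.isNormalizedGeodesicOn_iff (P : IsRadialProfile C σ H) {μ : ℝ} {J : Set ℝ}
    (hJ : IsOpen J) {T : ℝ → ℝ} {x : ℝ → E3} :
    IsNormalizedGeodesicOn (manifold C) (radialKerrSchild σ H) μ J (fun s => (T s, x s)) ↔
      ContDiffOn ℝ 2 T J ∧ ContDiffOn ℝ 2 x J ∧ (∀ s ∈ J, x s ∉ C) ∧
        ∀ s ∈ J, GeodesicEquationsAt σ H μ T x s := by
  constructor
  · rintro ⟨hg, hn⟩
    have hT : ContDiffOn ℝ 2 T J := hg.contDiffOn.fst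
    have hx : ContDiffOn ℝ 2 x J := hg.contDiffOn.snd
    have hmem : ∀ s ∈ J, x s ∉ C := hg.mem
    refine ⟨hT, hx, hmem, fun s hs => ?_⟩
    obtain ⟨h1, h2⟩ := hasDerivAt_pair hJ hT hx hs
    have he := hg.equation s hs
    have hns := hn s hs
    simp only [h1, h2] at he hns
    have he' := (geodesic_equation_iff (p := (T s, x s)) (P.ne_zero (hmem s hs))
      (P.hasDerivAt (hmem s hs)).differentiableAt _ _).1 he
    rw [radialKerrSchild_self (p := (T s, x s)) P.sq_sign (P.ne_zero (hmem s hs))] at hns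
    exact ⟨he'.1, he'.2, by linear_combination hns⟩
  · rintro ⟨hT, hx, hmem, he⟩
    refine ⟨⟨hT.prodMk hx, hmem, fun s hs => ?_⟩, fun s hs => ?_⟩
    · obtain ⟨h1, h2⟩ := hasDerivAt_pair hJ hT hx hs
      simp only [h1, h2]
      exact (geodesic_equation_iff (p := (T s, x s)) (P.ne_zero (hmem s hs))
        (P.hasDerivAt (hmem s hs)).differentiableAt _ _).2 ⟨(he s hs).time, (he s hs).space⟩
    · simp only [(hasDerivAt_pair hJ hT hx hs).1]
      rw [radialKerrSchild_self (p := (T s, x s)) P.sq_sign (P.ne_zero (hmem s hs))]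
      linear_combination (he s hs).normalization

theorem isNormalizedGeodesicOn_congr {g g' : MetricField} (hC : IsClosed C)
    (h : ∀ p ∈ manifold C, g p = g' p) {μ : ℝ} {J : Set ℝ} {γ : ℝ → Spacetime} :
    IsNormalizedGeodesicOn (manifold C) g μ J γ ↔
      IsNormalizedGeodesicOn (manifold C) g' μ J γ := by
  have hfd : ∀ p ∈ manifold C, ∀ v w,
      fderiv ℝ (fun q => g q v w) p = fderiv ℝ (fun q => g' q v w) p := by
    intro p hp v w
    refine Filter.EventuallyEq.fderiv_eq ?_
    filter_upwards [(isOpen_manifold hC).mem_nhds hp] with q hq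
    rw [h q hq]
  have hch : ∀ p ∈ manifold C, christoffel g p = christoffel g' p := by
    intro p hp
    funext u v w
    simp only [christoffel, hfd p hp]
  constructor
  · rintro ⟨⟨h1, h2, h3⟩, h4⟩
    exact ⟨⟨h1, h2, fun s hs w => by rw [← h _ (h2 s hs), ← hch _ (h2 s hs)]; exact h3 s hs w⟩,
      fun s hs => by rw [← h _ (h2 s hs)]; exact h4 s hs⟩
  · rintro ⟨⟨h1, h2, h3⟩, h4⟩
    exact ⟨⟨h1, h2, fun s hs w => by rw [h _ (h2 s hs), hch _ (h2 s hs)]; exact h3 s hs w⟩,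
      fun s hs => by rw [h _ (h2 s hs)]; exact h4 s hs⟩

variable {μ : ℝ} {J : Set ℝ} {T : ℝ → ℝ} {x : ℝ → E3}

theorem IsRadialProfile.hasDerivAt_nullPart (P : IsRadialProfile C σ H) (hJ : IsOpen J)
    (hT : ContDiffOn ℝ 2 T J) (hx : ContDiffOn ℝ 2 x J) {s : ℝ} (hs : s ∈ J) (hsC : x s ∉ C) :
    HasDerivAt (fun t => nullPart σ (x t) (deriv T t, deriv x t))
      (radialPart (x s) (deriv (deriv x) s) + ‖cross (x s) (deriv x s)‖ ^ 2 / ‖x s‖ ^ 3 -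
        σ * deriv (deriv T) s) s :=
  (hasDerivAt_radialPart_deriv hJ hx hs (P.ne_zero hsC)).sub
    ((hasDerivAt_of_contDiffOn_two hT hJ hs).2.const_mul σ)

theorem IsRadialProfile.hasDerivAt_profile (P : IsRadialProfile C σ H) (hJ : IsOpen J)
    (hx : ContDiffOn ℝ 2 x J) {s : ℝ} (hs : s ∈ J) (hsC : x s ∉ C) :
    HasDerivAt (fun t => H ‖x t‖) (deriv H ‖x s‖ * radialPart (x s) (deriv x s)) s :=
  HasDerivAt.comp s (h₂ := H) (P.hasDerivAt hsC)
    (hasDerivAt_norm_curve (hasDerivAt_of_contDiffOn_two hx hJ hs).1 (P.ne_zero hsC))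

theorem IsRadialProfile.hasDerivAt_nullMomentum (P : IsRadialProfile C σ H) (hJ : IsOpen J)
    (hT : ContDiffOn ℝ 2 T J) (hx : ContDiffOn ℝ 2 x J) {s : ℝ} (hs : s ∈ J) (hsC : x s ∉ C) :
    HasDerivAt (fun t => H ‖x t‖ * nullPart σ (x t) (deriv T t, deriv x t))
      (nullMomentumRate σ H (x s) (deriv T s, deriv x s)
        (deriv (deriv T) s, deriv (deriv x) s)) s :=
  (P.hasDerivAt_profile hJ hx hs hsC).mul (P.hasDerivAt_nullPart hJ hT hx hs hsC)

theorem IsRadialProfile.hasDerivAt_energyOf (P : IsRadialProfile C σ H) (hJ : IsOpen J)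
    (hT : ContDiffOn ℝ 2 T J) (hx : ContDiffOn ℝ 2 x J) {s : ℝ} (hs : s ∈ J) (hsC : x s ∉ C) :
    HasDerivAt (fun t => energyOf σ H (x t) (deriv T t, deriv x t))
      (deriv (deriv T) s + σ * nullMomentumRate σ H (x s) (deriv T s, deriv x s)
        (deriv (deriv T) s, deriv (deriv x) s)) s := by
  simp only [energyOf_eq P.sq_sign]
  exact (hasDerivAt_of_contDiffOn_two hT hJ hs).2.add
    ((P.hasDerivAt_nullMomentum hJ hT hx hs hsC).const_mul σ)

theorem IsRadialProfile.hasDerivAt_radialMomentum (P : IsRadialProfile C σ H) (hJ : IsOpen J)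
    (hT : ContDiffOn ℝ 2 T J) (hx : ContDiffOn ℝ 2 x J) {s : ℝ} (hs : s ∈ J) (hsC : x s ∉ C) :
    HasDerivAt (fun t => radialMomentum σ H (x t) (deriv T t, deriv x t))
      (radialPart (x s) (deriv (deriv x) s) + ‖cross (x s) (deriv x s)‖ ^ 2 / ‖x s‖ ^ 3 +
        nullMomentumRate σ H (x s) (deriv T s, deriv x s)
          (deriv (deriv T) s, deriv (deriv x) s)) s := by
  simp only [radialMomentum_eq]
  exact (hasDerivAt_radialPart_deriv hJ hx hs (P.ne_zero hsC)).add
    (P.hasDerivAt_nullMomentum hJ hT hx hs hsC)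

theorem hasDerivAt_cross_deriv (hJ : IsOpen J) (hx : ContDiffOn ℝ 2 x J) {s : ℝ} (hs : s ∈ J)
    {c : ℝ} (hc : deriv (deriv x) s = c • x s) :
    HasDerivAt (fun t => cross (x t) (deriv x t)) 0 s := by
  obtain ⟨h1, h2⟩ := hasDerivAt_of_contDiffOn_two hx hJ hs
  refine (hasDerivAt_cross h1 h2).congr_deriv ?_
  have : cross (deriv x s) (deriv x s) = 0 := by
    simpa using cross_smul_self 1 (deriv x s)
  rw [hc, cross_smul_self, this, add_zero]

end GeodesicEquation

/-! ### Equivalence of geodesics and the Newtonian system. -/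

section NewtonianSystem

variable {C : Set E3} {σ : ℝ} {H : ℝ → ℝ} {μ : ℝ} {J : Set ℝ} {T : ℝ → ℝ} {x : ℝ → E3} {s : ℝ}

theorem GeodesicEquationsAt.radialPart_acceleration (G : GeodesicEquationsAt σ H μ T x s)
    (h0 : x s ≠ 0) : radialPart (x s) (deriv (deriv x) s) =
      deriv H ‖x s‖ / 2 * nullPart σ (x s) (deriv T s, deriv x s) ^ 2 -
        nullMomentumRate σ H (x s) (deriv T s, deriv x s)
          (deriv (deriv T) s, deriv (deriv x) s) := by
  conv_lhs => rw [G.space]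
  exact radialPart_smul_self h0 _

/-- Write a = ṙ - σṪ and m = d(ha)/ds. The time equation removes T̈ from m, and the normalization a
(2ṙ - (1 - h) a) = -(L²/r² + μ) then removes a from the radial force h' a²/2 - m. -/
theorem GeodesicEquationsAt.newton (G : GeodesicEquationsAt σ H μ T x s) (hσ : σ ^ 2 = 1)
    (h0 : x s ≠ 0) : deriv (deriv x) s =
      ((deriv H ‖x s‖ / 2 * (‖cross (x s) (deriv x s)‖ ^ 2 / ‖x s‖ ^ 2 + μ) -
        H ‖x s‖ * (‖cross (x s) (deriv x s)‖ ^ 2 / ‖x s‖ ^ 3)) / ‖x s‖) • x s := by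
  have hA := G.radialPart_acceleration h0
  conv_lhs => rw [G.space]
  congr 2
  have ht := G.time
  have hn := G.normalization
  rw [mul_energyOf hσ] at hn
  set a := nullPart σ (x s) (deriv T s, deriv x s)
  set m := nullMomentumRate σ H (x s) (deriv T s, deriv x s)
    (deriv (deriv T) s, deriv (deriv x) s) with hm
  have hm' : m = deriv H ‖x s‖ * radialPart (x s) (deriv x s) * a + H ‖x s‖ *
      (radialPart (x s) (deriv (deriv x) s) + ‖cross (x s) (deriv x s)‖ ^ 2 / ‖x s‖ ^ 3 -
        σ * deriv (deriv T) s) := rfl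
  simp only at hn
  linear_combination -hm' - H ‖x s‖ * hA + H ‖x s‖ * σ * ht - H ‖x s‖ * m * hσ -
    deriv H ‖x s‖ / 2 * hn

/-- Multiplying the normalization by 1 - h replaces (1 - h)(ṙ - σṪ) by ṙ - σE. The factor is lost at
h = 1, which is where the horizon conditions come from. -/
theorem GeodesicEquationsAt.energy (G : GeodesicEquationsAt σ H μ T x s) (hσ : σ ^ 2 = 1) :
    radialPart (x s) (deriv x s) ^ 2 - energyOf σ H (x s) (deriv T s, deriv x s) ^ 2 =
      -(1 - H ‖x s‖) * (‖cross (x s) (deriv x s)‖ ^ 2 / ‖x s‖ ^ 2 + μ) := by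
  have hn := G.normalization
  have hE := mul_energyOf (H := H) hσ (x s) (deriv T s, deriv x s)
  simp only at hE hn
  set e := energyOf σ H (x s) (deriv T s, deriv x s)
  linear_combination (1 - H ‖x s‖) * hn + e ^ 2 * hσ -
    (radialPart (x s) (deriv x s) + σ * e) * hE

theorem GeodesicEquationsAt.rate (G : GeodesicEquationsAt σ H μ T x s) (h0 : x s ≠ 0) :
    radialPart (x s) (deriv (deriv x) s) + ‖cross (x s) (deriv x s)‖ ^ 2 / ‖x s‖ ^ 3 +
      nullMomentumRate σ H (x s) (deriv T s, deriv x s) (deriv (deriv T) s, deriv (deriv x) s) =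
      ‖cross (x s) (deriv x s)‖ ^ 2 / ‖x s‖ ^ 3 +
        deriv H ‖x s‖ / 2 * nullPart σ (x s) (deriv T s, deriv x s) ^ 2 := by
  linear_combination G.radialPart_acceleration h0

theorem IsRadialProfile.isNewtonianMotionOn_iff (P : IsRadialProfile C σ H) (hJ : IsOpen J)
    {L : E3} {E : ℝ} :
    IsNewtonianMotionOn C H μ L E J x ↔ ContDiffOn ℝ 2 x J ∧ (∀ s ∈ J, x s ∉ C) ∧
      ∀ s ∈ J, L = cross (x s) (deriv x s) ∧
        deriv (deriv x) s = ((deriv H ‖x s‖ / 2 * (‖L‖ ^ 2 / ‖x s‖ ^ 2 + μ) -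
          H ‖x s‖ * (‖L‖ ^ 2 / ‖x s‖ ^ 3)) / ‖x s‖) • x s ∧
        radialPart (x s) (deriv x s) ^ 2 - E ^ 2 =
          -(1 - H ‖x s‖) * (‖L‖ ^ 2 / ‖x s‖ ^ 2 + μ) := by
  have hgrad : ∀ s, x s ∉ C → -gradient (potential H ‖L‖ μ) (x s) = _ := fun s hs =>
    gradient_potential (P.ne_zero hs) (P.hasDerivAt hs) ‖L‖ μ
  have hrad : ContDiffOn ℝ 2 x J → ∀ s ∈ J, x s ∉ C →
      deriv (fun t => ‖x t‖) s = radialPart (x s) (deriv x s) := fun hx s hs hsC =>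
    (hasDerivAt_norm_curve (hasDerivAt_of_contDiffOn_two hx hJ hs).1 (P.ne_zero hsC)).deriv
  have hsplit : ∀ h N l r : ℝ, (1 - h) * l / (2 * r) - h * μ / 2 =
      ((1 - h) * (l / r + μ) - μ) / 2 := by
    intro h N l r
    rw [mul_div_mul_comm]
    ring
  constructor
  · rintro ⟨h1, h2, h3, h4, h5⟩
    refine ⟨h1, h2, fun s hs => ⟨h4 s hs, ?_, ?_⟩⟩
    · rw [h3 s hs, hgrad s (h2 s hs)]
    · have := h5 s hs
      rw [hrad h1 s hs (h2 s hs), add_sub_assoc, hsplit _ 0] at this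
      linear_combination 2 * this
  · rintro ⟨h1, h2, h3⟩
    refine ⟨h1, h2, fun s hs => ?_, fun s hs => (h3 s hs).1, fun s hs => ?_⟩
    · rw [hgrad s (h2 s hs), (h3 s hs).2.1]
    · rw [hrad h1 s hs (h2 s hs), add_sub_assoc, hsplit _ 0]
      linear_combination (h3 s hs).2.2 / 2

/-- The energy relation differentiates to the time equation, and the normalization holds off h = 1
after division by 1 - h. What remains is the rate of a = ṙ - σṪ. -/
theorem IsRadialProfile.geodesicEquationsAt_of_newtonian (P : IsRadialProfile C σ H)
    (hJ : IsOpen J) {L : E3} {E : ℝ} (hT : ContDiffOn ℝ 2 T J)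
    (hN : IsNewtonianMotionOn C H μ L E J x)
    (hE : ∀ s ∈ J, E = energyOf σ H (x s) (deriv T s, deriv x s))
    (hnorm : ∀ s ∈ J, H ‖x s‖ = 1 → nullPart σ (x s) (deriv T s, deriv x s) *
      (radialPart (x s) (deriv x s) + σ * E) + (‖L‖ ^ 2 / ‖x s‖ ^ 2 + μ) = 0)
    (hrate : ∀ s ∈ J, H ‖x s‖ = 1 → radialPart (x s) (deriv x s) = 0 →
      deriv (fun t => nullPart σ (x t) (deriv T t, deriv x t)) s = ‖L‖ ^ 2 / ‖x s‖ ^ 3 +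
        deriv H ‖x s‖ / 2 * nullPart σ (x s) (deriv T s, deriv x s) ^ 2) :
    ∀ s ∈ J, GeodesicEquationsAt σ H μ T x s := by
  obtain ⟨hx, hmem, heq⟩ := (P.isNewtonianMotionOn_iff hJ).1 hN
  have hσ := P.sq_sign
  have hEσ : ∀ s ∈ J, σ * E = radialPart (x s) (deriv x s) -
      (1 - H ‖x s‖) * nullPart σ (x s) (deriv T s, deriv x s) := fun s hs => by
    rw [hE s hs, mul_energyOf hσ]
  have hB : ∀ s ∈ J, nullPart σ (x s) (deriv T s, deriv x s) *
      (radialPart (x s) (deriv x s) + σ * E) + (‖L‖ ^ 2 / ‖x s‖ ^ 2 + μ) = 0 := by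
    intro s hs
    by_cases h1 : H ‖x s‖ = 1
    · exact hnorm s hs h1
    · refine (mul_eq_zero.1 ?_).resolve_left (sub_ne_zero.2 (Ne.symm h1))
      linear_combination (heq s hs).2.2 - E ^ 2 * hσ +
        (radialPart (x s) (deriv x s) + σ * E) * hEσ s hs
  have htime : ∀ s ∈ J, deriv (deriv T) s + σ * nullMomentumRate σ H (x s)
      (deriv T s, deriv x s) (deriv (deriv T) s, deriv (deriv x) s) = 0 := by
    intro s hs
    have h1 := P.hasDerivAt_energyOf hJ hT hx hs (hmem s hs)
    have h2 : HasDerivAt (fun t => energyOf σ H (x t) (deriv T t, deriv x t)) 0 s := by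
      refine (hasDerivAt_const s E).congr_of_eventuallyEq ?_
      filter_upwards [hJ.mem_nhds hs] with t ht using (hE t ht).symm
    exact h1.unique h2
  intro s hs
  have hs0 := P.ne_zero (hmem s hs)
  have hr := norm_ne_zero_iff.2 hs0
  obtain ⟨hL, hacc, hC⟩ := heq s hs
  have hLn : ‖cross (x s) (deriv x s)‖ = ‖L‖ := by rw [hL]
  have hA : radialPart (x s) (deriv (deriv x) s) = deriv H ‖x s‖ / 2 *
      (‖L‖ ^ 2 / ‖x s‖ ^ 2 + μ) - H ‖x s‖ * (‖L‖ ^ 2 / ‖x s‖ ^ 3) := by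
    rw [hacc]; exact radialPart_smul_self hs0 _
  have ht := htime s hs
  have hda := P.hasDerivAt_nullPart hJ hT hx hs (hmem s hs)
  have hBs := hB s hs
  have hes := hEσ s hs
  have hm' : nullMomentumRate σ H (x s) (deriv T s, deriv x s)
      (deriv (deriv T) s, deriv (deriv x) s) =
      deriv H ‖x s‖ * radialPart (x s) (deriv x s) * nullPart σ (x s) (deriv T s, deriv x s) +
      H ‖x s‖ * (radialPart (x s) (deriv (deriv x) s) + ‖L‖ ^ 2 / ‖x s‖ ^ 3 -
        σ * deriv (deriv T) s) := by rw [← hLn]; rfl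
  rw [hLn] at hda
  set a := nullPart σ (x s) (deriv T s, deriv x s) with ha
  set m := nullMomentumRate σ H (x s) (deriv T s, deriv x s)
    (deriv (deriv T) s, deriv (deriv x) s) with hm
  set ρ := radialPart (x s) (deriv x s) with hρ
  set A := radialPart (x s) (deriv (deriv x) s)
  set T2 := deriv (deriv T) s
  -- This is ȧ = L²/r³ + h' a²/2; together with the time equation it gives the space equation.
  have hG : A + ‖L‖ ^ 2 / ‖x s‖ ^ 3 - σ * T2 =
      ‖L‖ ^ 2 / ‖x s‖ ^ 3 + deriv H ‖x s‖ / 2 * a ^ 2 := by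
    by_cases h1 : H ‖x s‖ = 1
    · by_cases h2 : ρ = 0
      · rw [← hrate s hs h1 h2, hda.deriv]
      -- At h = 1 the factor ṙ + σE equals 2ṙ, and the derivative of the normalization is 2ṙ times
      -- the wanted equation.
      · have hN' : HasDerivAt (fun t => ‖L‖ ^ 2 / ‖x t‖ ^ 2 + μ)
            (-(2 * ‖L‖ ^ 2 * ρ / ‖x s‖ ^ 3)) s := by
          have hn := hasDerivAt_norm_curve (hasDerivAt_of_contDiffOn_two hx hJ hs).1 hs0
          refine (((hasDerivAt_const s (‖L‖ ^ 2)).fun_div (hn.fun_pow 2)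
            (pow_ne_zero 2 hr)).add_const μ).congr_deriv ?_
          rw [← hρ]
          field_simp
          ring
        have hρ' : HasDerivAt (fun t => radialPart (x t) (deriv x t))
            (A + ‖L‖ ^ 2 / ‖x s‖ ^ 3) s := by
          rw [← hLn]; exact hasDerivAt_radialPart_deriv hJ hx hs hs0
        have hder := (hda.fun_mul (hρ'.add_const (σ * E))).fun_add hN'
        have hzero : HasDerivAt (fun t => nullPart σ (x t) (deriv T t, deriv x t) *
            (radialPart (x t) (deriv x t) + σ * E) + (‖L‖ ^ 2 / ‖x t‖ ^ 2 + μ)) 0 s := by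
          refine (hasDerivAt_const s (0 : ℝ)).congr_of_eventuallyEq ?_
          filter_upwards [hJ.mem_nhds hs] with t ht' using hB t ht'
        have h3 := hder.unique hzero
        rw [← ha, ← hρ] at h3
        rw [h1] at hes hA
        have h5 : 2 * ρ ≠ 0 := mul_ne_zero two_ne_zero h2
        refine mul_left_cancel₀ h5 ?_
        rw [hes] at h3 hBs
        have h6 : 2 * ‖L‖ ^ 2 * ρ / ‖x s‖ ^ 3 = 2 * ρ * (‖L‖ ^ 2 / ‖x s‖ ^ 3) := by ring
        rw [h6] at h3
        linear_combination h3 - a * hA - a * deriv H ‖x s‖ / 2 * hBs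
    -- Off h = 1 the rate follows from the derivative of (1 - h) a = ṙ - σE.
    · refine mul_left_cancel₀ (sub_ne_zero.2 (Ne.symm h1)) ?_
      rw [hes] at hBs
      linear_combination hA - σ * ht + m * hσ + hm' + deriv H ‖x s‖ / 2 * hBs
  refine ⟨ht, ?_, ?_⟩
  · conv_lhs => rw [hacc]
    congr 2
    rw [← hA]
    linear_combination hG + σ * ht - m * hσ
  · rw [hLn, ← hE s hs]
    exact hBs

/-- Normalized geodesics are the solutions of the Newtonian system. -/
theorem IsRadialProfile.isNormalizedGeodesicOn_iff_newtonian (P : IsRadialProfile C σ H)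
    (hJ : IsOpen J) (hJc : J.OrdConnected) :
    IsNormalizedGeodesicOn (manifold C) (radialKerrSchild σ H) μ J (fun s => (T s, x s)) ↔
      ∃ (L : E3) (E : ℝ), ContDiffOn ℝ 2 T J ∧ IsNewtonianMotionOn C H μ L E J x ∧
        (∀ s ∈ J, E = energyOf σ H (x s) (deriv T s, deriv x s)) ∧
        HorizonConditions (radialKerrSchild σ H) σ H μ L E J T x := by
  have hσ := P.sq_sign
  rw [P.isNormalizedGeodesicOn_iff hJ]
  constructor
  · rintro ⟨hT, hx, hmem, hG⟩
    have hconst : ∃ (L : E3) (E : ℝ), ∀ s ∈ J, L = cross (x s) (deriv x s) ∧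
        E = energyOf σ H (x s) (deriv T s, deriv x s) := by
      rcases J.eq_empty_or_nonempty with rfl | ⟨s₀, hs₀⟩
      · exact ⟨0, 0, fun s hs => hs.elim⟩
      · refine ⟨cross (x s₀) (deriv x s₀), energyOf σ H (x s₀) (deriv T s₀, deriv x s₀),
          fun s hs => ⟨?_, ?_⟩⟩
        · exact eq_of_hasDerivAt_zero (f := fun t => cross (x t) (deriv x t)) hJ hJc
            (fun t ht => hasDerivAt_cross_deriv hJ hx ht (hG t ht).space) hs₀ hs
        · exact eq_of_hasDerivAt_zero
            (f := fun t => energyOf σ H (x t) (deriv T t, deriv x t)) hJ hJc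
            (fun t ht => (P.hasDerivAt_energyOf hJ hT hx ht (hmem t ht)).congr_deriv
              (hG t ht).time) hs₀ hs
    obtain ⟨L, E, hLE⟩ := hconst
    refine ⟨L, E, hT, ?_, fun s hs => (hLE s hs).2, fun s hs _ => ⟨?_, fun _ => ?_⟩⟩
    · rw [P.isNewtonianMotionOn_iff hJ]
      refine ⟨hx, hmem, fun s hs => ⟨(hLE s hs).1, ?_, ?_⟩⟩
      · have := (hG s hs).newton hσ (P.ne_zero (hmem s hs))
        rwa [← (hLE s hs).1] at this
      · have := (hG s hs).energy hσ
        rwa [← (hLE s hs).1, ← (hLE s hs).2] at this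
    · rw [radialKerrSchild_self (p := (T s, x s)) hσ (P.ne_zero (hmem s hs))]
      linear_combination (hG s hs).normalization
    · rw [(P.hasDerivAt_radialMomentum hJ hT hx hs (hmem s hs)).deriv,
        (hG s hs).rate (P.ne_zero (hmem s hs)), ← (hLE s hs).1, (hLE s hs).2, mul_energyOf hσ,
        radialMomentum_eq]
      ring
  · rintro ⟨L, E, hT, hN, hE, hH⟩
    refine ⟨hT, hN.contDiffOn, hN.mem, ?_⟩
    have hcross : ∀ s ∈ J, L = cross (x s) (deriv x s) := hN.angularMomentum
    refine P.geodesicEquationsAt_of_newtonian hJ hT hN hE (fun s hs h1 => ?_) fun s hs h1 h2 => ?_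
    · have := (hH s hs h1).1
      rw [radialKerrSchild_self (p := (T s, x s)) hσ (P.ne_zero (hN.mem s hs)), ← hE s hs,
        ← hcross s hs] at this
      linear_combination this
    · have := (hH s hs h1).2 h2
      -- The radial momentum is q = a + σE with σE constant, so Hamilton's equation for q is the
      -- equation for a = ṙ - σṪ.
      have hev : (fun t => radialMomentum σ H (x t) (deriv T t, deriv x t)) =ᶠ[𝓝 s]
          fun t => nullPart σ (x t) (deriv T t, deriv x t) + σ * E := by
        filter_upwards [hJ.mem_nhds hs] with t ht
        rw [hE t ht, mul_energyOf hσ, radialMomentum_eq]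
        ring
      rw [hev.deriv_eq, deriv_add_const, hev.eq_of_nhds, add_sub_cancel_right] at this
      exact this

end NewtonianSystem

/-! ### Primitives and linear differential equations on an interval. -/

section Primitives

theorem exists_primitive {w : ℝ → ℝ} {J : Set ℝ} (hJ : IsOpen J) (hJc : J.OrdConnected)
    (hw : ContinuousOn w J) {s₀ : ℝ} (hs₀ : s₀ ∈ J) (c : ℝ) :
    ∃ W : ℝ → ℝ, W s₀ = c ∧ ∀ s ∈ J, HasDerivAt W (w s) s := by
  refine ⟨fun s => c + ∫ t in s₀..s, w t, by simp, fun s hs => ?_⟩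
  have hsub : uIcc s₀ s ⊆ J := hJc.uIcc_subset hs₀ hs
  have hint : IntervalIntegrable w MeasureTheory.volume s₀ s :=
    (hw.mono hsub).intervalIntegrable
  refine HasDerivAt.const_add c (intervalIntegral.integral_hasDerivAt_right hint ?_ ?_)
  · exact ContinuousOn.stronglyMeasurableAtFilter hJ hw s hs
  · exact hw.continuousAt (hJ.mem_nhds hs)

/-- With a primitive W of the coefficient, the product d exp(-W) is constant. -/
theorem eq_zero_of_linear_ode {d k : ℝ → ℝ} {J : Set ℝ} (hJ : IsOpen J) (hJc : J.OrdConnected)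
    (hk : ContinuousOn k J) (hd : ∀ s ∈ J, HasDerivAt d (k s * d s) s) {s₀ : ℝ} (hs₀ : s₀ ∈ J)
    (h0 : d s₀ = 0) : ∀ s ∈ J, d s = 0 := by
  obtain ⟨W, -, hW⟩ := exists_primitive hJ hJc hk hs₀ 0
  intro s hs
  have h := eq_of_hasDerivAt_zero (f := fun t => d t * Real.exp (-W t)) hJ hJc (fun t ht =>
    ((hd t ht).fun_mul (hW t ht).fun_neg.exp).congr_deriv (by ring)) hs hs₀
  simp only [h0, zero_mul] at h
  exact (mul_eq_zero.1 h).resolve_right (Real.exp_pos _).ne'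

theorem contDiffOn_succ_of_hasDerivAt {E : Type*} [NormedAddCommGroup E] [NormedSpace ℝ E]
    {f f' : ℝ → E} {J : Set ℝ} (hJ : IsOpen J) {n : ℕ}
    (hf : ∀ s ∈ J, HasDerivAt f (f' s) s) (hf' : ContDiffOn ℝ n f' J) :
    ContDiffOn ℝ (n + 1) f J := by
  rw [contDiffOn_succ_iff_deriv_of_isOpen hJ]
  exact ⟨fun s hs => (hf s hs).differentiableAt.differentiableWithinAt, by simp,
    hf'.congr fun s hs => (hf s hs).deriv⟩

end Primitives

/-! ### Local reconstruction of the time part. -/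

section TimePart

variable {C : Set E3} {σ : ℝ} {H : ℝ → ℝ} {μ : ℝ} {J : Set ℝ} {T : ℝ → ℝ} {x : ℝ → E3} {s : ℝ}

theorem contDiffOn_deriv_of_two {E : Type*} [NormedAddCommGroup E] [NormedSpace ℝ E]
    {f : ℝ → E} (hJ : IsOpen J) (hf : ContDiffOn ℝ 2 f J) : ContDiffOn ℝ 1 (deriv f) J :=
  hf.deriv_of_isOpen hJ (by norm_num)

theorem contDiffOn_norm_curve (hx : ContDiffOn ℝ 2 x J) (h0 : ∀ s ∈ J, x s ≠ 0) :
    ContDiffOn ℝ 1 (fun t => ‖x t‖) J :=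
  (hx.of_le (by norm_num)).norm ℝ h0

theorem contDiffOn_radialPart_deriv (hJ : IsOpen J) (hx : ContDiffOn ℝ 2 x J)
    (h0 : ∀ s ∈ J, x s ≠ 0) : ContDiffOn ℝ 1 (fun t => radialPart (x t) (deriv x t)) J :=
  ((hx.of_le (by norm_num)).inner ℝ (contDiffOn_deriv_of_two hJ hx)).div
    (contDiffOn_norm_curve hx h0) fun s hs => norm_ne_zero_iff.2 (h0 s hs)

theorem IsRadialProfile.contDiffOn_profile (P : IsRadialProfile C σ H) (hx : ContDiffOn ℝ 2 x J)
    (hmem : ∀ s ∈ J, x s ∉ C) : ContDiffOn ℝ 1 (fun t => H ‖x t‖) J :=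
  (P.smooth.of_le (by exact_mod_cast le_top)).comp
    (contDiffOn_norm_curve hx fun s hs => P.ne_zero (hmem s hs)) fun s hs => ⟨x s, hmem s hs, rfl⟩

theorem IsRadialProfile.contDiffOn_deriv (P : IsRadialProfile C σ H) :
    ContDiffOn ℝ 1 (deriv H) {r | ∃ x : E3, x ∉ C ∧ ‖x‖ = r} :=
  P.smooth.deriv_of_isOpen (isOpen_radii P.isClosed P.zero_mem)
    (by rw [one_add_one_eq_two]; exact WithTop.coe_le_coe.2 (le_top : (2 : ℕ∞) ≤ ⊤))

theorem IsRadialProfile.contDiffOn_deriv_profile (P : IsRadialProfile C σ H)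
    (hx : ContDiffOn ℝ 2 x J) (hmem : ∀ s ∈ J, x s ∉ C) :
    ContDiffOn ℝ 1 (fun t => deriv H ‖x t‖) J :=
  P.contDiffOn_deriv.comp
    (contDiffOn_norm_curve hx fun s hs => P.ne_zero (hmem s hs)) fun s hs => ⟨x s, hmem s hs, rfl⟩

theorem contDiffOn_centrifugal (hx : ContDiffOn ℝ 2 x J) (h0 : ∀ s ∈ J, x s ≠ 0) (ℓ μ : ℝ) :
    ContDiffOn ℝ 1 (fun t => ℓ ^ 2 / ‖x t‖ ^ 2 + μ) J :=
  (contDiffOn_const.div ((contDiffOn_norm_curve hx h0).pow 2)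
    fun s hs => pow_ne_zero 2 (norm_ne_zero_iff.2 (h0 s hs))).add contDiffOn_const

theorem IsNewtonianMotionOn.mono {L : E3} {E : ℝ} {J' : Set ℝ}
    (hN : IsNewtonianMotionOn C H μ L E J x) (h : J' ⊆ J) : IsNewtonianMotionOn C H μ L E J' x :=
  ⟨hN.contDiffOn.mono h, fun s hs => hN.mem s (h hs), fun s hs => hN.newton s (h hs),
    fun s hs => hN.angularMomentum s (h hs), fun s hs => hN.energy s (h hs)⟩

/-- A time function with a prescribed value of `ṙ - σ Ṫ`. -/
theorem IsRadialProfile.exists_time_of_nullPart (P : IsRadialProfile C σ H) (hJ : IsOpen J)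
    (hJc : J.OrdConnected) {E : ℝ} (hx : ContDiffOn ℝ 2 x J) (hmem : ∀ s ∈ J, x s ∉ C)
    {a : ℝ → ℝ} (ha : ContDiffOn ℝ 1 a J)
    (hA : ∀ s ∈ J, (1 - H ‖x s‖) * a s = radialPart (x s) (deriv x s) - σ * E)
    {s₀ : ℝ} (hs₀ : s₀ ∈ J) (T₀ : ℝ) :
    ∃ T : ℝ → ℝ, T s₀ = T₀ ∧ ContDiffOn ℝ 2 T J ∧
      (∀ s ∈ J, nullPart σ (x s) (deriv T s, deriv x s) = a s) ∧
      ∀ s ∈ J, E = energyOf σ H (x s) (deriv T s, deriv x s) := by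
  have hσ := P.sq_sign
  -- Because σ² = 1, the required Ṫ is σ (ṙ - a).
  have hw : ContDiffOn ℝ 1 (fun s => σ * (radialPart (x s) (deriv x s) - a s)) J :=
    contDiffOn_const.mul ((contDiffOn_radialPart_deriv hJ hx
      fun s hs => P.ne_zero (hmem s hs)).sub ha)
  obtain ⟨T, hT0, hT⟩ := exists_primitive hJ hJc hw.continuousOn hs₀ T₀
  have hnull : ∀ s ∈ J, nullPart σ (x s) (deriv T s, deriv x s) = a s := by
    intro s hs
    rw [nullPart, (hT s hs).deriv]
    linear_combination (a s - radialPart (x s) (deriv x s)) * hσ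
  refine ⟨T, hT0, ?_, hnull, fun s hs => ?_⟩
  · have := contDiffOn_succ_of_hasDerivAt hJ hT (n := 1) (by exact_mod_cast hw)
    exact_mod_cast this
  · have h1 := mul_energyOf (H := H) hσ (x s) (deriv T s, deriv x s)
    rw [hnull s hs, hA s hs] at h1
    have hσ0 : σ ≠ 0 := fun h => by simp [h] at hσ
    exact mul_left_cancel₀ hσ0 (by simp only at h1; linear_combination -h1)

/-- The search for T becomes the search for one C¹ function a = ṙ - σṪ satisfying the energy
relation everywhere and the remaining equations only at h = 1. -/
theorem IsRadialProfile.exists_geodesic_of_nullPart (P : IsRadialProfile C σ H) (hJ : IsOpen J)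
    (hJc : J.OrdConnected) {L : E3} {E : ℝ} (hN : IsNewtonianMotionOn C H μ L E J x)
    {a : ℝ → ℝ} (ha : ContDiffOn ℝ 1 a J)
    (hA : ∀ s ∈ J, (1 - H ‖x s‖) * a s = radialPart (x s) (deriv x s) - σ * E)
    (hB : ∀ s ∈ J, H ‖x s‖ = 1 → a s * (radialPart (x s) (deriv x s) + σ * E) +
      (‖L‖ ^ 2 / ‖x s‖ ^ 2 + μ) = 0)
    (hrate : ∀ s ∈ J, H ‖x s‖ = 1 → radialPart (x s) (deriv x s) = 0 →
      HasDerivAt a (‖L‖ ^ 2 / ‖x s‖ ^ 3 + deriv H ‖x s‖ / 2 * a s ^ 2) s)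
    {s₀ : ℝ} (hs₀ : s₀ ∈ J) (T₀ : ℝ) :
    ∃ T : ℝ → ℝ, T s₀ = T₀ ∧
      IsNormalizedGeodesicOn (manifold C) (radialKerrSchild σ H) μ J (fun s => (T s, x s)) ∧
      ∀ s ∈ J, E = energyOf σ H (x s) (deriv T s, deriv x s) := by
  obtain ⟨T, hT0, hT, hnull, hE⟩ :=
    P.exists_time_of_nullPart hJ hJc hN.contDiffOn hN.mem ha hA hs₀ T₀
  refine ⟨T, hT0, (P.isNormalizedGeodesicOn_iff hJ).2 ⟨hT, hN.contDiffOn, hN.mem, ?_⟩, hE⟩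
  refine P.geodesicEquationsAt_of_newtonian hJ hT hN hE (fun s hs h1 => ?_) fun s hs h1 h2 => ?_
  · rw [hnull s hs]; exact hB s hs h1
  · have hev : (fun t => nullPart σ (x t) (deriv T t, deriv x t)) =ᶠ[𝓝 s] a := by
      filter_upwards [hJ.mem_nhds hs] with t ht using hnull t ht
    rw [hev.deriv_eq, (hrate s hs h1 h2).deriv, hnull s hs]

/-- A radial equilibrium: the orbit stays on its sphere. -/
theorem IsRadialProfile.eventually_norm_eq (P : IsRadialProfile C σ H) (hJ : IsOpen J)
    {L : E3} {E : ℝ} (hN : IsNewtonianMotionOn C H μ L E J x) {s₀ : ℝ} (hs₀ : s₀ ∈ J)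
    (h1 : H ‖x s₀‖ = 1) (hρ : radialPart (x s₀) (deriv x s₀) = 0)
    (hn : ‖L‖ ^ 2 / ‖x s₀‖ ^ 2 + μ = 0) :
    ∀ᶠ s in 𝓝 s₀, ‖x s‖ = ‖x s₀‖ ∧ radialPart (x s) (deriv x s) = 0 := by
  obtain ⟨hx, hmem, heq⟩ := (P.isNewtonianMotionOn_iff hJ).1 hN
  -- The radial motion obeys r̈ = Φ(r), the central force plus the centrifugal term. Both summands
  -- of Φ vanish at r₀, so rest at r₀ is a solution and uniqueness applies.
  set Φ : ℝ → ℝ := fun r => deriv H r / 2 * (‖L‖ ^ 2 / r ^ 2 + μ) + (1 - H r) * (‖L‖ ^ 2 / r ^ 3)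
  set v : ℝ × ℝ → ℝ × ℝ := fun y => (y.2, Φ y.1)
  have hr₀ : ‖x s₀‖ ≠ 0 := norm_ne_zero_iff.2 (P.ne_zero (hmem s₀ hs₀))
  have hH' : ContDiffAt ℝ 1 (deriv H) ‖x s₀‖ := P.contDiffOn_deriv.contDiffAt
    ((isOpen_radii P.isClosed P.zero_mem).mem_nhds ⟨x s₀, hmem s₀ hs₀, rfl⟩)
  have hH : ContDiffAt ℝ 1 H ‖x s₀‖ :=
    (contDiffAt_radius P.isClosed P.zero_mem P.smooth (hmem s₀ hs₀)).of_le
      (by exact_mod_cast le_top)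
  have hpow : ∀ n : ℕ, ContDiffAt ℝ 1 (fun r : ℝ => ‖L‖ ^ 2 / r ^ n) ‖x s₀‖ := fun n =>
    contDiffAt_const.div (contDiffAt_id.pow n) (pow_ne_zero n hr₀)
  have hΦ : ContDiffAt ℝ 1 Φ ‖x s₀‖ :=
    ((hH'.div_const 2).mul ((hpow 2).add contDiffAt_const)).add
      ((contDiffAt_const.sub hH).mul (hpow 3))
  have hv : ContDiffAt ℝ 1 v (‖x s₀‖, 0) :=
    contDiffAt_snd.prodMk (ContDiffAt.comp (g := Φ) (‖x s₀‖, (0 : ℝ)) hΦ contDiffAt_fst)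
  obtain ⟨κ, S, hS, hlip⟩ := hv.exists_lipschitzOnWith
  have hderiv : ∀ s ∈ J, HasDerivAt (fun t => (‖x t‖, radialPart (x t) (deriv x t)))
      (v (‖x s‖, radialPart (x s) (deriv x s))) s := by
    intro s hs
    have hs0 := P.ne_zero (hmem s hs)
    refine (hasDerivAt_norm_curve (hasDerivAt_of_contDiffOn_two hx hJ hs).1 hs0).prodMk
      ((hasDerivAt_radialPart_deriv hJ hx hs hs0).congr_deriv ?_)
    obtain ⟨hL, hacc, -⟩ := heq s hs
    rw [hacc, radialPart_smul_self hs0, ← hL]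
    simp only [Φ]
    ring
  have hΦ0 : v (‖x s₀‖, 0) = 0 := by simp [v, Φ, h1, hn]
  have hcont := (hderiv s₀ hs₀).continuousAt
  have hunique := ODE_solution_unique_of_eventually (v := fun _ => v) (s := fun _ => S)
    (f := fun t => (‖x t‖, radialPart (x t) (deriv x t))) (g := fun _ => (‖x s₀‖, 0))
    (t₀ := s₀) (K := κ) (Eventually.of_forall fun _ => hlip)
    (by
      have hS' : S ∈ 𝓝 ((fun t => (‖x t‖, radialPart (x t) (deriv x t))) s₀) := by
        simpa only [hρ] using hS
      filter_upwards [hJ.mem_nhds hs₀, hcont.eventually hS'] with t ht ht'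
      exact ⟨hderiv t ht, ht'⟩)
    (Eventually.of_forall fun t => ⟨by rw [hΦ0]; exact hasDerivAt_const t _, mem_of_mem_nhds hS⟩)
    (by simp only [hρ])
  filter_upwards [hunique] with t ht
  exact Prod.mk.inj ht

theorem exists_interval {p : ℝ → Prop} (hJ : IsOpen J) {s₀ : ℝ} (hs₀ : s₀ ∈ J)
    (hp : ∀ᶠ s in 𝓝 s₀, p s) :
    ∃ J' ⊆ J, IsOpen J' ∧ J'.OrdConnected ∧ s₀ ∈ J' ∧ ∀ s ∈ J', p s := by
  obtain ⟨ε, hε, h⟩ := Metric.eventually_nhds_iff_ball.1 (hp.and (hJ.mem_nhds hs₀))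
  refine ⟨Metric.ball s₀ ε, fun s hs => (h s hs).2, Metric.isOpen_ball, ?_,
    Metric.mem_ball_self hε, fun s hs => (h s hs).1⟩
  rw [Real.ball_eq_Ioo]
  exact ordConnected_Ioo

/-- Only a local solution can be claimed, because for k b > 0 every solution blows up in finite
time. The initial value 0 is an arbitrary choice. -/
theorem exists_riccati (k b s₀ : ℝ) :
    ∃ a : ℝ → ℝ, ∀ᶠ s in 𝓝 s₀, HasDerivAt a (k + b * a s ^ 2) s := by
  have hf : ContDiffAt ℝ 1 (fun y : ℝ => k + b * y ^ 2) 0 := by fun_prop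
  obtain ⟨a, -, ε, hε, ha⟩ :=
    hf.exists_forall_mem_closedBall_exists_eq_forall_mem_Ioo_hasDerivAt₀ s₀
  exact ⟨a, by filter_upwards
    [Ioo_mem_nhds (sub_lt_self s₀ hε) (lt_add_of_pos_right s₀ hε)] with s hs using ha s hs⟩

theorem IsRadialProfile.exists_local_time (P : IsRadialProfile C σ H) (hJ : IsOpen J)
    {L : E3} {E : ℝ} (hN : IsNewtonianMotionOn C H μ L E J x) {s₀ : ℝ} (hs₀ : s₀ ∈ J) (T₀ : ℝ)
    (hcond : H ‖x s₀‖ = 1 → radialPart (x s₀) (deriv x s₀) = σ * E ∧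
      (radialPart (x s₀) (deriv x s₀) = 0 → ‖L‖ ^ 2 / ‖x s₀‖ ^ 2 + μ = 0)) :
    ∃ J' ⊆ J, IsOpen J' ∧ J'.OrdConnected ∧ s₀ ∈ J' ∧ ∃ T : ℝ → ℝ, T s₀ = T₀ ∧
      IsNormalizedGeodesicOn (manifold C) (radialKerrSchild σ H) μ J' (fun s => (T s, x s)) ∧
      ∀ s ∈ J', E = energyOf σ H (x s) (deriv T s, deriv x s) := by
  have hσ := P.sq_sign
  obtain ⟨hx, hmem, heq⟩ := (P.isNewtonianMotionOn_iff hJ).1 hN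
  have h0 : ∀ s ∈ J, x s ≠ 0 := fun s hs => P.ne_zero (hmem s hs)
  have hHc := P.contDiffOn_profile hx hmem
  have hρc := contDiffOn_radialPart_deriv hJ hx h0
  by_cases h1 : H ‖x s₀‖ = 1
  · obtain ⟨hρE, hρ0⟩ := hcond h1
    by_cases hρ : radialPart (x s₀) (deriv x s₀) = 0
    · have hn := hρ0 hρ
      have hE : E = 0 := by
        have : σ * E = 0 := by rw [← hρE, hρ]
        have hσ0 : σ ≠ 0 := fun h => by simp [h] at hσ
        exact (mul_eq_zero.1 this).resolve_left hσ0
      -- The orbit stays on the sphere r = r₀, so the coefficients of the equation for a are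
      -- constant. As ṙ, E and L²/r² + μ vanish, the other conditions hold for every a.
      obtain ⟨a, ha⟩ := exists_riccati (‖L‖ ^ 2 / ‖x s₀‖ ^ 3) (deriv H ‖x s₀‖ / 2) s₀
      obtain ⟨J', hJJ, hJ', hJc', hs', hp⟩ := exists_interval hJ hs₀
        ((P.eventually_norm_eq hJ hN hs₀ h1 hρ hn).and ha)
      refine ⟨J', hJJ, hJ', hJc', hs', P.exists_geodesic_of_nullPart hJ' hJc' (hN.mono hJJ)
        (a := a) ?_ (fun s hs => ?_) (fun s hs _ => ?_) (fun s hs _ _ => ?_) hs' T₀⟩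
      · have hcont : ContinuousOn a J' := fun s hs => (hp s hs).2.continuousAt.continuousWithinAt
        have := contDiffOn_succ_of_hasDerivAt hJ' (fun s hs => (hp s hs).2) (n := 0)
          (by
            rw [Nat.cast_zero, contDiffOn_zero]
            exact continuousOn_const.add (continuousOn_const.mul (hcont.pow 2)))
        simpa using this
      · rw [(hp s hs).1.1, (hp s hs).1.2, h1, hE]; ring
      · rw [(hp s hs).1.1, (hp s hs).1.2, hE]; linear_combination hn
      · rw [(hp s hs).1.1]; exact (hp s hs).2
    · have hne : ∀ᶠ s in 𝓝 s₀, radialPart (x s) (deriv x s) + σ * E ≠ 0 := by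
        have hc : ContinuousAt (fun s => radialPart (x s) (deriv x s) + σ * E) s₀ :=
          (hρc.continuousOn.continuousAt (hJ.mem_nhds hs₀)).add continuousAt_const
        refine hc.eventually_ne ?_
        rw [← hρE]
        intro h
        exact hρ (by linarith)
      obtain ⟨J', hJJ, hJ', hJc', hs', hp⟩ := exists_interval hJ hs₀ hne
      refine ⟨J', hJJ, hJ', hJc', hs', P.exists_geodesic_of_nullPart hJ' hJc' (hN.mono hJJ)
        (a := fun s => -(‖L‖ ^ 2 / ‖x s‖ ^ 2 + μ) / (radialPart (x s) (deriv x s) + σ * E))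
        ?_ (fun s hs => ?_) (fun s hs _ => ?_) (fun s hs h2 h3 => ?_) hs' T₀⟩
      · exact (contDiffOn_centrifugal hx h0 ‖L‖ μ).neg.mono hJJ |>.div
          ((hρc.mono hJJ).add contDiffOn_const) hp
      · have := hp s hs
        field_simp
        linear_combination -(heq s (hJJ hs)).2.2 + E ^ 2 * hσ
      · have := hp s hs
        field_simp
        ring
      -- A point with h = 1 and ṙ = 0 would give E = 0 by the energy law, against ṙ + σE ≠ 0 on the
      -- chosen interval.
      · exfalso
        have hE2 := (heq s (hJJ hs)).2.2
        rw [h2, h3] at hE2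
        have hE0 : E = 0 := by
          have : E ^ 2 = 0 := by linear_combination -hE2
          simpa using this
        exact hp s hs (by rw [h3, hE0]; ring)
  · have hne : ∀ᶠ s in 𝓝 s₀, H ‖x s‖ ≠ 1 :=
      (hHc.continuousOn.continuousAt (hJ.mem_nhds hs₀)).eventually_ne h1
    obtain ⟨J', hJJ, hJ', hJc', hs', hp⟩ := exists_interval hJ hs₀ hne
    refine ⟨J', hJJ, hJ', hJc', hs', P.exists_geodesic_of_nullPart hJ' hJc' (hN.mono hJJ)
      (a := fun s => (radialPart (x s) (deriv x s) - σ * E) / (1 - H ‖x s‖))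
      ?_ (fun s hs => ?_) (fun s hs h => absurd h (hp s hs)) (fun s hs h => absurd h (hp s hs))
      hs' T₀⟩
    · exact ((hρc.mono hJJ).sub contDiffOn_const).div (contDiffOn_const.sub (hHc.mono hJJ))
        fun s hs => sub_ne_zero.2 (Ne.symm (hp s hs))
    · exact mul_div_cancel₀ _ (sub_ne_zero.2 (Ne.symm (hp s hs)))

end TimePart

/-! ### Necessity, global existence and uniqueness of the time part. -/

section TimePartGlobal

variable {C : Set E3} {σ : ℝ} {H : ℝ → ℝ} {μ : ℝ} {J : Set ℝ} {T : ℝ → ℝ} {x : ℝ → E3} {s : ℝ}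

theorem GeodesicEquationsAt.horizon_data (G : GeodesicEquationsAt σ H μ T x s) (hσ : σ ^ 2 = 1)
    (h1 : H ‖x s‖ = 1) :
    radialPart (x s) (deriv x s) = σ * energyOf σ H (x s) (deriv T s, deriv x s) ∧
      (radialPart (x s) (deriv x s) = 0 →
        ‖cross (x s) (deriv x s)‖ ^ 2 / ‖x s‖ ^ 2 + μ = 0) := by
  have hE := mul_energyOf (H := H) hσ (x s) (deriv T s, deriv x s)
  have hn := G.normalization
  rw [h1] at hE
  refine ⟨by rw [hE]; ring, fun h0 => ?_⟩
  rw [hE] at hn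
  simp only [h0] at hn
  linear_combination hn

theorem IsRadialProfile.exists_local_time_iff (P : IsRadialProfile C σ H) (hJ : IsOpen J)
    {L : E3} {E : ℝ} (hN : IsNewtonianMotionOn C H μ L E J x) {s₀ : ℝ} (hs₀ : s₀ ∈ J) (T₀ : ℝ) :
    (∃ J' ⊆ J, IsOpen J' ∧ J'.OrdConnected ∧ s₀ ∈ J' ∧ ∃ T : ℝ → ℝ, T s₀ = T₀ ∧
      IsNormalizedGeodesicOn (manifold C) (radialKerrSchild σ H) μ J' (fun s => (T s, x s)) ∧
      ∀ s ∈ J', E = energyOf σ H (x s) (deriv T s, deriv x s)) ↔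
    (H ‖x s₀‖ = 1 → radialPart (x s₀) (deriv x s₀) = σ * E ∧
      (radialPart (x s₀) (deriv x s₀) = 0 → ‖L‖ ^ 2 / ‖x s₀‖ ^ 2 + μ = 0)) := by
  refine ⟨?_, P.exists_local_time hJ hN hs₀ T₀⟩
  rintro ⟨J', -, hJ', -, hs', T, -, hgeo, hE⟩ h1
  obtain ⟨-, -, -, hG⟩ := (P.isNormalizedGeodesicOn_iff hJ').1 hgeo
  have := (hG s₀ hs').horizon_data P.sq_sign h1
  rwa [← hE s₀ hs', ← hN.angularMomentum s₀ hs₀] at this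

theorem IsRadialProfile.exists_time (P : IsRadialProfile C σ H) (hJ : IsOpen J)
    (hJc : J.OrdConnected) {L : E3} {E : ℝ} (hN : IsNewtonianMotionOn C H μ L E J x)
    (hcond : ∀ s ∈ J, H ‖x s‖ = 1 → radialPart (x s) (deriv x s) = σ * E ∧
      (radialPart (x s) (deriv x s) = 0 → L = 0 ∧ μ = 0)) :
    ∃ T : ℝ → ℝ,
      IsNormalizedGeodesicOn (manifold C) (radialKerrSchild σ H) μ J (fun s => (T s, x s)) ∧
      ∀ s ∈ J, E = energyOf σ H (x s) (deriv T s, deriv x s) := by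
  classical
  have hσ := P.sq_sign
  have hσ0 : σ ≠ 0 := fun h => by simp [h] at hσ
  obtain ⟨hx, hmem, heq⟩ := (P.isNewtonianMotionOn_iff hJ).1 hN
  have h0 : ∀ s ∈ J, x s ≠ 0 := fun s hs => P.ne_zero (hmem s hs)
  have hHc := P.contDiffOn_profile hx hmem
  have hρc := contDiffOn_radialPart_deriv hJ hx h0
  rcases J.eq_empty_or_nonempty with rfl | ⟨s₀, hs₀⟩
  · refine ⟨0, (P.isNormalizedGeodesicOn_iff hJ).2 ⟨?_, hx, hmem, ?_⟩, ?_⟩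
    · exact contDiffOn_const
    · exact fun s hs => hs.elim
    · exact fun s hs => hs.elim
  -- A single point with h = 1 and ṙ = 0 forces L = 0, μ = 0 and E = 0, hence ṙ = 0 on all of J, and
  -- a = 0 is a global solution.
  by_cases hrest : ∃ s ∈ J, H ‖x s‖ = 1 ∧ radialPart (x s) (deriv x s) = 0
  · obtain ⟨s₁, hs₁, h1, hρ1⟩ := hrest
    obtain ⟨hE1, hL⟩ := hcond s₁ hs₁ h1
    obtain ⟨rfl, rfl⟩ := hL hρ1
    have hE : E = 0 := (mul_eq_zero.1 (hE1.symm.trans hρ1)).resolve_left hσ0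
    have hρ : ∀ s ∈ J, radialPart (x s) (deriv x s) = 0 := by
      intro s hs
      have := (heq s hs).2.2
      rw [hE] at this
      simpa using this
    obtain ⟨T, -, hT⟩ := P.exists_geodesic_of_nullPart hJ hJc hN (a := fun _ => 0)
      contDiffOn_const (fun s hs => by rw [hρ s hs, hE]; ring) (fun s hs _ => by simp)
      (fun s hs _ _ => by simpa using hasDerivAt_const s (0 : ℝ)) hs₀ 0
    exact ⟨T, hT⟩
  · push Not at hrest
    set N : ℝ → ℝ := fun s => ‖L‖ ^ 2 / ‖x s‖ ^ 2 + μ with hNdef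
    set e : ℝ := σ * E with he
    set ρ : ℝ → ℝ := fun s => radialPart (x s) (deriv x s) with hρdef
    have hCe : ∀ s ∈ J, (ρ s - e) * (ρ s + e) = -(1 - H ‖x s‖) * N s := by
      intro s hs
      have := (heq s hs).2.2
      simp only [hρdef, hNdef, he]
      linear_combination this - E ^ 2 * hσ
    -- The two expressions agree where both denominators are nonzero, by `hCe`; near each point one
    -- of them is smooth enough, which makes a of class C¹ across h = 1.
    set a : ℝ → ℝ := fun s =>
      if H ‖x s‖ = 1 then -N s / (ρ s + e) else (ρ s - e) / (1 - H ‖x s‖) with ha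
    have hne : ∀ s ∈ J, H ‖x s‖ = 1 → ρ s + e ≠ 0 := by
      intro s hs h1 h
      have h2 : ρ s = e := (hcond s hs h1).1
      exact hrest s hs h1 (show ρ s = 0 by linarith)
    have hacont : ContDiffOn ℝ 1 a J := by
      intro s hs
      refine ContDiffAt.contDiffWithinAt ?_
      have hJs := hJ.mem_nhds hs
      by_cases h1 : H ‖x s‖ = 1
      · have hρa : ContDiffAt ℝ 1 (fun t => ρ t + e) s :=
          (hρc.contDiffAt hJs).add contDiffAt_const
        have hdiv : ContDiffAt ℝ 1 (fun t => -N t / (ρ t + e)) s :=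
          ((contDiffOn_centrifugal hx h0 ‖L‖ μ).neg.contDiffAt hJs).div hρa (hne s hs h1)
        refine hdiv.congr_of_eventuallyEq ?_
        filter_upwards [hJs, hρa.continuousAt.eventually_ne (hne s hs h1)] with t ht ht'
        simp only [ha]
        split_ifs with h2
        · rfl
        · rw [div_eq_div_iff (sub_ne_zero.2 (Ne.symm h2)) ht', hCe t ht]
          ring
      · have hHa : ContDiffAt ℝ 1 (fun t => 1 - H ‖x t‖) s :=
          contDiffAt_const.sub (hHc.contDiffAt hJs)
        have h1' : 1 - H ‖x s‖ ≠ 0 := sub_ne_zero.2 (Ne.symm h1)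
        have hdiv : ContDiffAt ℝ 1 (fun t => (ρ t - e) / (1 - H ‖x t‖)) s :=
          ((hρc.contDiffAt hJs).sub contDiffAt_const).div hHa h1'
        refine hdiv.congr_of_eventuallyEq ?_
        filter_upwards [hHa.continuousAt.eventually_ne h1'] with t ht
        simp only [ha]
        rw [if_neg fun h => ht (by rw [h, sub_self])]
    obtain ⟨T, -, hT⟩ := P.exists_geodesic_of_nullPart hJ hJc hN hacont
      (fun s hs => by
        simp only [ha]
        split_ifs with h2
        · rw [h2, (hcond s hs h2).1]; ring
        · exact mul_div_cancel₀ _ (sub_ne_zero.2 (Ne.symm h2)))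
      (fun s hs h2 => by
        simp only [ha, if_pos h2]
        have := hne s hs h2
        change -N s / (ρ s + e) * (ρ s + e) + N s = 0
        field_simp
        ring)
      (fun s hs h2 h3 => absurd h3 (hrest s hs h2)) hs₀ 0
    exact ⟨T, hT⟩

theorem IsRadialProfile.hasDerivAt_nullPart_of_geodesic (P : IsRadialProfile C σ H)
    (hJ : IsOpen J) (hT : ContDiffOn ℝ 2 T J) (hx : ContDiffOn ℝ 2 x J) (hs : s ∈ J)
    (hsC : x s ∉ C) (G : GeodesicEquationsAt σ H μ T x s) :
    HasDerivAt (fun t => nullPart σ (x t) (deriv T t, deriv x t))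
      (‖cross (x s) (deriv x s)‖ ^ 2 / ‖x s‖ ^ 3 +
        deriv H ‖x s‖ / 2 * nullPart σ (x s) (deriv T s, deriv x s) ^ 2) s := by
  refine (P.hasDerivAt_nullPart hJ hT hx hs hsC).congr_deriv ?_
  have h1 := G.rate (P.ne_zero hsC)
  have h2 := G.time
  set m := nullMomentumRate σ H (x s) (deriv T s, deriv x s)
    (deriv (deriv T) s, deriv (deriv x) s)
  linear_combination h1 - σ * h2 + m * P.sq_sign

theorem IsRadialProfile.contDiffOn_nullPart (P : IsRadialProfile C σ H) (hJ : IsOpen J)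
    (hT : ContDiffOn ℝ 2 T J) (hx : ContDiffOn ℝ 2 x J) (hmem : ∀ s ∈ J, x s ∉ C) :
    ContDiffOn ℝ 1 (fun t => nullPart σ (x t) (deriv T t, deriv x t)) J :=
  (contDiffOn_radialPart_deriv hJ hx fun s hs => P.ne_zero (hmem s hs)).sub
    (contDiffOn_const.mul (contDiffOn_deriv_of_two hJ hT))

/-- The two functions ṙ - σṪ solve the same Riccati-type equation, so their difference solves a
linear homogeneous one. At a point with h ≠ 1 the energy relation makes them equal. -/
theorem IsRadialProfile.time_unique (P : IsRadialProfile C σ H) (hJ : IsOpen J)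
    (hJc : J.OrdConnected) {E : ℝ} (hne : ∃ s ∈ J, H ‖x s‖ ≠ 1) {T₁ T₂ : ℝ → ℝ}
    (h₁ : IsNormalizedGeodesicOn (manifold C) (radialKerrSchild σ H) μ J (fun s => (T₁ s, x s)))
    (hE₁ : ∀ s ∈ J, E = energyOf σ H (x s) (deriv T₁ s, deriv x s))
    (h₂ : IsNormalizedGeodesicOn (manifold C) (radialKerrSchild σ H) μ J (fun s => (T₂ s, x s)))
    (hE₂ : ∀ s ∈ J, E = energyOf σ H (x s) (deriv T₂ s, deriv x s)) :
    ∃ c : ℝ, ∀ s ∈ J, T₁ s = T₂ s + c := by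
  have hσ := P.sq_sign
  have hσ0 : σ ≠ 0 := fun h => by simp [h] at hσ
  obtain ⟨hT₁, hx, hmem, hG₁⟩ := (P.isNormalizedGeodesicOn_iff hJ).1 h₁
  obtain ⟨hT₂, -, -, hG₂⟩ := (P.isNormalizedGeodesicOn_iff hJ).1 h₂
  obtain ⟨s₁, hs₁, hs₁ne⟩ := hne
  set a₁ : ℝ → ℝ := fun t => nullPart σ (x t) (deriv T₁ t, deriv x t)
  set a₂ : ℝ → ℝ := fun t => nullPart σ (x t) (deriv T₂ t, deriv x t)
  have hd : ∀ s ∈ J, HasDerivAt (fun t => a₁ t - a₂ t)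
      ((deriv H ‖x s‖ / 2 * (a₁ s + a₂ s)) * (a₁ s - a₂ s)) s := fun s hs =>
    ((P.hasDerivAt_nullPart_of_geodesic hJ hT₁ hx hs (hmem s hs) (hG₁ s hs)).fun_sub
      (P.hasDerivAt_nullPart_of_geodesic hJ hT₂ hx hs (hmem s hs) (hG₂ s hs))).congr_deriv
        (by simp only [a₁, a₂]; ring)
  have hk : ContinuousOn (fun s => deriv H ‖x s‖ / 2 * (a₁ s + a₂ s)) J :=
    ((P.contDiffOn_deriv_profile hx hmem).continuousOn.div_const 2).mul
      ((P.contDiffOn_nullPart hJ hT₁ hx hmem).continuousOn.add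
        (P.contDiffOn_nullPart hJ hT₂ hx hmem).continuousOn)
  have h0 : a₁ s₁ - a₂ s₁ = 0 := by
    have e₁ := mul_energyOf (H := H) hσ (x s₁) (deriv T₁ s₁, deriv x s₁)
    have e₂ := mul_energyOf (H := H) hσ (x s₁) (deriv T₂ s₁, deriv x s₁)
    rw [← hE₁ s₁ hs₁] at e₁
    rw [← hE₂ s₁ hs₁] at e₂
    refine (mul_eq_zero.1 ?_).resolve_left (sub_ne_zero.2 (Ne.symm hs₁ne))
    simp only [a₁, a₂] at e₁ e₂ ⊢
    linear_combination e₁ - e₂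
  have hall := eq_zero_of_linear_ode hJ hJc hk hd hs₁ h0
  have hconst : ∀ s ∈ J, HasDerivAt (fun t => T₁ t - T₂ t) 0 s := by
    intro s hs
    refine ((hasDerivAt_of_contDiffOn_two hT₁ hJ hs).1.sub
      (hasDerivAt_of_contDiffOn_two hT₂ hJ hs).1).congr_deriv ?_
    have := hall s hs
    simp only [a₁, a₂, nullPart] at this
    refine (mul_eq_zero.1 ?_).resolve_left hσ0
    linear_combination -this
  refine ⟨T₁ s₁ - T₂ s₁, fun s hs => ?_⟩
  have := eq_of_hasDerivAt_zero hJ hJc hconst hs hs₁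
  linarith

end TimePartGlobal

/-! ### Future directed causal vectors in null coordinates. -/

section TimeOrientation

variable {σ : ℝ} {H : ℝ → ℝ}

/-- The part of `v` orthogonal to `x`. -/
noncomputable def transversePart (x v : E3) : E3 := v - (radialPart x v / ‖x‖) • x

theorem inner_transversePart {x : E3} (hx : x ≠ 0) (v w : E3) :
    inner ℝ (transversePart x v) (transversePart x w) =
      inner ℝ v w - radialPart x v * radialPart x w := by
  have hr := norm_ne_zero_iff.2 hx
  simp only [transversePart, inner_sub_left, inner_sub_right, inner_smul_left, inner_smul_right,
    real_inner_self_eq_norm_sq, radialPart, real_inner_comm x v]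
  simp
  field_simp
  ring

/-- The metric in the null coordinates `Ṫ - σ ṙ` and `E + σ ṙ` of the tangent space. -/
theorem radialKerrSchild_null_coordinates (hσ : σ ^ 2 = 1) {p : Spacetime} (hp : p.2 ≠ 0)
    (v w : Spacetime) : radialKerrSchild σ H p v w =
      -(((v.1 - σ * radialPart p.2 v.2) * (energyOf σ H p.2 w + σ * radialPart p.2 w.2) +
        (w.1 - σ * radialPart p.2 w.2) * (energyOf σ H p.2 v + σ * radialPart p.2 v.2)) / 2) +
      inner ℝ (transversePart p.2 v.2) (transversePart p.2 w.2) := by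
  rw [inner_transversePart hp, radialKerrSchild, minkowski, energyOf, energyOf]
  linear_combination (H ‖p.2‖ * v.1 * w.1 - (1 + H ‖p.2‖) * radialPart p.2 v.2 *
    radialPart p.2 w.2) * hσ

theorem radialPart_nullVector {x : E3} (hx : x ≠ 0) : radialPart x (nullVector σ x).2 = σ :=
  radialPart_smul_self hx σ

theorem transversePart_smul_self {x : E3} (hx : x ≠ 0) (c : ℝ) :
    transversePart x ((c / ‖x‖) • x) = 0 := by
  rw [transversePart, radialPart_smul_self hx, sub_self]

/-- If a and b were both nonpositive, Cauchy-Schwarz and (αb + aβ)² ≥ 4 αβ ab would make the product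
with the timelike vector nonnegative. As ab ≥ 0, one negative coordinate makes the other
nonpositive. -/
theorem nonneg_of_reversed_cauchy_schwarz {V : Type*} [NormedAddCommGroup V]
    [InnerProductSpace ℝ V] {a b α β : ℝ} {v z : V} (hα : 0 < α) (hz : ‖z‖ ^ 2 < α * β)
    (hv : ‖v‖ ^ 2 ≤ a * b) (h : -((α * b + a * β) / 2) + inner ℝ z v < 0) : 0 ≤ a ∧ 0 ≤ b := by
  have hβ : 0 < β := by
    by_contra hcon
    nlinarith [sq_nonneg ‖z‖]
  have hab : 0 ≤ a * b := (sq_nonneg _).trans hv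
  have hneg : ¬ (a ≤ 0 ∧ b ≤ 0) := by
    rintro ⟨ha, hb⟩
    have h1 : (inner ℝ z v) ^ 2 ≤ ‖z‖ ^ 2 * ‖v‖ ^ 2 := by
      rw [← mul_pow, ← sq_abs]
      exact pow_le_pow_left₀ (abs_nonneg _) (abs_real_inner_le_norm z v) 2
    have h2 : ‖z‖ ^ 2 * ‖v‖ ^ 2 ≤ (α * β) * (a * b) :=
      mul_le_mul hz.le hv (sq_nonneg _) (by positivity)
    have h3 : 0 ≤ -(α * b + a * β) / 2 := by
      have := mul_nonpos_of_nonneg_of_nonpos hα.le hb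
      have := mul_nonpos_of_nonpos_of_nonneg ha hβ.le
      linarith
    have h4 : -(α * b + a * β) / 2 < -inner ℝ z v := by linarith
    have h5 : (-(α * b + a * β) / 2) ^ 2 < (-inner ℝ z v) ^ 2 := pow_lt_pow_left₀ h4 h3 two_ne_zero
    nlinarith [sq_nonneg (α * b - a * β)]
  constructor
  · by_contra ha
    have ha' := not_le.1 ha
    exact hneg ⟨ha'.le, by by_contra hb; nlinarith [not_le.1 hb]⟩
  · by_contra hb
    have hb' := not_le.1 hb
    exact hneg ⟨by by_contra ha; nlinarith [not_le.1 ha], hb'.le⟩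

theorem isFutureCausal_iff (hσ : σ ^ 2 = 1) {p : Spacetime} (hp : p.2 ≠ 0) (v : Spacetime) :
    IsFutureCausal (radialKerrSchild σ H) p (nullVector σ p.2) v ↔
      radialKerrSchild σ H p v v ≤ 0 ∧ 0 ≤ v.1 - σ * radialPart p.2 v.2 ∧
        0 ≤ energyOf σ H p.2 v + σ * radialPart p.2 v.2 := by
  have hr := norm_ne_zero_iff.2 hp
  have hgN : ∀ z, radialKerrSchild σ H p z (nullVector σ p.2) =
      -(z.1 - σ * radialPart p.2 z.2) := by
    intro z
    rw [radialKerrSchild_null_coordinates hσ hp, radialPart_nullVector hp, energyOf,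
      radialPart_nullVector hp]
    simp only [nullVector, transversePart_smul_self hp, inner_zero_right]
    linear_combination (-(1 / 2) * (z.1 - σ * radialPart p.2 z.2) * (1 + H ‖p.2‖) +
      (energyOf σ H p.2 z + σ * radialPart p.2 z.2) / 2) * hσ
  have hself := radialKerrSchild_null_coordinates (H := H) hσ hp v v
  rw [real_inner_self_eq_norm_sq] at hself
  constructor
  · rintro ⟨hle, rfl | ⟨Z, hZ, hZN, hZv⟩⟩
    · exact ⟨hle, by simp [radialPart], by simp [energyOf, radialPart]⟩
    · refine ⟨hle, ?_⟩
      rw [hgN] at hZN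
      rw [radialKerrSchild_null_coordinates hσ hp, real_inner_self_eq_norm_sq] at hZ
      rw [radialKerrSchild_null_coordinates hσ hp] at hZv
      exact nonneg_of_reversed_cauchy_schwarz (by linarith) (by linarith) (by linarith) hZv
  · rintro ⟨hle, hA, hB⟩
    refine ⟨hle, ?_⟩
    -- If both null coordinates vanish, causality kills the transverse part and the vector is zero.
    rcases (add_nonneg hA hB).eq_or_lt with h0 | hpos
    · left
      have hA0 : v.1 - σ * radialPart p.2 v.2 = 0 := by linarith
      have hB0 : energyOf σ H p.2 v + σ * radialPart p.2 v.2 = 0 := by linarith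
      rw [hself, hA0, hB0] at hle
      have ht : transversePart p.2 v.2 = 0 := by
        have : ‖transversePart p.2 v.2‖ ^ 2 = 0 :=
          le_antisymm (by simpa using hle) (sq_nonneg _)
        simpa using this
      have hv1 : v.1 = 0 := by
        rw [energyOf] at hB0
        linear_combination (1 + H ‖p.2‖) / 2 * hA0 + hB0 / 2
      have hρ : radialPart p.2 v.2 = 0 := by
        rw [hv1] at hA0
        linear_combination -σ * hA0 - radialPart p.2 v.2 * hσ
      refine Prod.ext hv1 ?_
      rw [transversePart, hρ] at ht
      simpa using ht
    · right
      -- This vector has both null coordinates equal to 1 and no transverse part. It is thus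
      -- timelike, and its product with v is minus half the sum of the null coordinates of v.
      set Z : Spacetime := (1 + H ‖p.2‖ / 2, ((σ * H ‖p.2‖ / 2) / ‖p.2‖) • p.2)
      have hZρ : radialPart p.2 Z.2 = σ * H ‖p.2‖ / 2 := radialPart_smul_self hp _
      have hZA : Z.1 - σ * radialPart p.2 Z.2 = 1 := by
        rw [hZρ]; linear_combination (-H ‖p.2‖ / 2) * hσ
      have hZB : energyOf σ H p.2 Z + σ * radialPart p.2 Z.2 = 1 := by
        rw [energyOf, hZρ]
        linear_combination ((1 + H ‖p.2‖) * H ‖p.2‖ / 2) * hσ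
      have hZt : transversePart p.2 Z.2 = 0 := transversePart_smul_self hp _
      refine ⟨Z, ?_, ?_, ?_⟩
      · rw [radialKerrSchild_null_coordinates hσ hp, hZA, hZB, hZt]
        simp
      · rw [hgN, hZA]
        norm_num
      · rw [radialKerrSchild_null_coordinates hσ hp, hZA, hZB, hZt, inner_zero_left]
        linarith

end TimeOrientation

/-! ### The data condition and its propagation along geodesics. -/

section FutureDirected

variable {C : Set E3} {σ : ℝ} {H : ℝ → ℝ} {μ : ℝ} {J : Set ℝ} {T : ℝ → ℝ} {x : ℝ → E3} {s : ℝ}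

theorem eq_sqrt_or_eq_neg_sqrt {y z : ℝ} (h : y ^ 2 = z) :
    y = Real.sqrt z ∨ y = -Real.sqrt z := by
  rw [← h, Real.sqrt_sq_eq_abs]
  rcases abs_choice y with h | h <;> rw [h]
  · exact Or.inl rfl
  · exact Or.inr (neg_neg y).symm

theorem sq_of_eq_sqrt_or {y z : ℝ} (hz : 0 ≤ z) (h : y = Real.sqrt z ∨ y = -Real.sqrt z) :
    y ^ 2 = z := by
  rcases h with rfl | rfl
  · exact Real.sq_sqrt hz
  · rw [neg_sq, Real.sq_sqrt hz]

theorem sq_aZero {h₀ r₀ ℓ : ℝ} (hμ : 0 ≤ μ) :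
    aZero h₀ r₀ ℓ μ ^ 2 = |1 - h₀| * (ℓ ^ 2 / r₀ ^ 2 + μ) :=
  Real.sq_sqrt (by positivity)

/-- The data condition in terms of the null coordinates of the velocity. -/
theorem futureData_iff {h₀ r₀ ℓ ρ τ E : ℝ} (hσ : σ ^ 2 = 1) (hr : r₀ ≠ 0) (hμ : 0 ≤ μ)
    (hA : (1 - h₀) * (τ - σ * ρ) = E - σ * ρ)
    (hAB : (τ - σ * ρ) * (E + σ * ρ) = ℓ ^ 2 / r₀ ^ 2 + μ) :
    FutureData σ h₀ r₀ ℓ μ ρ E ∧ (h₀ = 1 → ρ = 0 → 0 ≤ τ) ↔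
      0 ≤ τ - σ * ρ ∧ 0 ≤ E + σ * ρ := by
  have hN : 0 ≤ ℓ ^ 2 / r₀ ^ 2 + μ := by positivity
  have ha0 : 0 ≤ aZero h₀ r₀ ℓ μ := Real.sqrt_nonneg _
  have ha2 := sq_aZero (h₀ := h₀) (r₀ := r₀) (ℓ := ℓ) hμ
  set A := τ - σ * ρ with hAdef
  set N := ℓ ^ 2 / r₀ ^ 2 + μ with hNdef
  set a := aZero h₀ r₀ ℓ μ with hadef
  -- The sign of 1 - h₀ decides which of |E| and |σρ| dominates, and the sign of the dominating one
  -- fixes the signs of both null coordinates. At h₀ = 1 and ρ = 0 they do not determine τ, whence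
  -- the separate condition on it.
  have hEP : E ^ 2 - (σ * ρ) ^ 2 = (1 - h₀) * N := by
    linear_combination -(E + σ * ρ) * hA + (1 - h₀) * hAB
  have hP2 : (σ * ρ) ^ 2 = ρ ^ 2 := by rw [mul_pow, hσ, one_mul]
  rcases lt_trichotomy h₀ 1 with h | h | h
  · rw [abs_of_pos (by linarith)] at ha2
    have h1 : 0 < 1 - h₀ := by linarith
    constructor
    · rintro ⟨⟨-, hF, -⟩, -⟩
      obtain ⟨haE, -⟩ := hF h
      have hE0 : 0 ≤ E := ha0.trans haE
      have hle : |σ * ρ| ≤ E := abs_le_of_sq_le_sq (by nlinarith) hE0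
      obtain ⟨h2, h3⟩ := abs_le.1 hle
      exact ⟨nonneg_of_mul_nonneg_right (by rw [hA]; linarith) h1, by linarith⟩
    · rintro ⟨hA0, hB0⟩
      have hE0 : 0 ≤ E := by nlinarith
      refine ⟨⟨fun h' => absurd h' (by linarith), fun _ => ⟨?_, ?_⟩, fun h' => absurd h' h.ne⟩,
        fun h' => absurd h' h.ne⟩
      · exact abs_le_of_sq_le_sq' (by nlinarith [sq_nonneg (σ * ρ)]) hE0 |>.2
      · exact eq_sqrt_or_eq_neg_sqrt (by rw [ha2, ← hEP, hP2]; ring)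
  · constructor
    · rintro ⟨⟨-, -, hF⟩, hτ⟩
      obtain ⟨hP, -, hE⟩ := hF h
      refine ⟨?_, by linarith⟩
      by_cases hρ : ρ = 0
      · rw [hAdef, hρ]; simpa using hτ h hρ
      · have hP0 : σ * ρ ≠ 0 := fun h0 => hρ (by
          have : ρ ^ 2 = 0 := by rw [← hP2, h0]; ring
          simpa using this)
        have hpos : 0 < E + σ * ρ := by
          have := lt_of_le_of_ne hP (Ne.symm hP0); linarith
        exact nonneg_of_mul_nonneg_left (by rw [hAB]; exact hN) hpos
    · rintro ⟨hA0, hB0⟩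
      have hE : E = σ * ρ := by rw [h] at hA; linarith
      refine ⟨⟨fun h' => absurd h' (by linarith), fun h' => absurd h' (by linarith), fun _ =>
        ⟨by linarith, fun hρ => ?_, hE⟩⟩, fun _ hρ => by rw [hAdef, hρ] at hA0; simpa using hA0⟩
      rw [hE, hρ] at hAB
      have hN0 : ℓ ^ 2 / r₀ ^ 2 + μ = 0 := by rw [← hNdef, ← hAB]; ring
      have h3 : 0 ≤ ℓ ^ 2 / r₀ ^ 2 := by positivity
      have h4 : ℓ ^ 2 / r₀ ^ 2 = 0 := by linarith
      refine ⟨by linarith, ?_⟩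
      simpa [hr] using h4
  · rw [abs_of_neg (by linarith)] at ha2
    have h1 : 1 - h₀ < 0 := by linarith
    constructor
    · rintro ⟨⟨hF, -, -⟩, -⟩
      obtain ⟨haP, -⟩ := hF h
      have hP0 : 0 ≤ σ * ρ := ha0.trans haP
      have hle : |E| ≤ σ * ρ := abs_le_of_sq_le_sq (by nlinarith) hP0
      obtain ⟨h2, h3⟩ := abs_le.1 hle
      refine ⟨?_, by linarith⟩
      by_contra hcon
      nlinarith [mul_pos_of_neg_of_neg h1 (not_le.1 hcon)]
    · rintro ⟨hA0, hB0⟩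
      have hP0 : 0 ≤ σ * ρ := by nlinarith
      refine ⟨⟨fun _ => ⟨?_, ?_⟩, fun h' => absurd h' (by linarith), fun h' => absurd h' h.ne'⟩,
        fun h' => absurd h' h.ne'⟩
      · exact abs_le_of_sq_le_sq' (by nlinarith [sq_nonneg E]) hP0 |>.2
      · exact eq_sqrt_or_eq_neg_sqrt (by rw [ha2, ← hP2]; linear_combination hEP)

theorem pos_of_continuousOn_ne_zero {f : ℝ → ℝ} (hJc : J.OrdConnected) (hf : ContinuousOn f J)
    (hne : ∀ s ∈ J, f s ≠ 0) {s₀ : ℝ} (hs₀ : s₀ ∈ J) (h0 : 0 < f s₀) : ∀ s ∈ J, 0 < f s := by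
  intro s hs
  by_contra hcon
  obtain ⟨t, ht, ht0⟩ := hJc.isPreconnected.intermediate_value hs hs₀ hf
    ⟨not_lt.1 hcon, h0.le⟩
  exact hne t ht ht0

/-- The null coordinates of the velocity of a normalized geodesic. -/
theorem GeodesicEquationsAt.null_coordinates (G : GeodesicEquationsAt σ H μ T x s)
    (hσ : σ ^ 2 = 1) :
    (1 - H ‖x s‖) * (deriv T s - σ * radialPart (x s) (deriv x s)) =
      energyOf σ H (x s) (deriv T s, deriv x s) - σ * radialPart (x s) (deriv x s) ∧
    (deriv T s - σ * radialPart (x s) (deriv x s)) *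
      (energyOf σ H (x s) (deriv T s, deriv x s) + σ * radialPart (x s) (deriv x s)) =
        ‖cross (x s) (deriv x s)‖ ^ 2 / ‖x s‖ ^ 2 + μ := by
  have hn := G.normalization
  constructor
  · rw [energyOf]; ring
  · simp only [nullPart] at hn
    set e := energyOf σ H (x s) (deriv T s, deriv x s)
    linear_combination -hn - (deriv T s * e + radialPart (x s) (deriv x s) ^ 2) * hσ

/-- The condition of being future directed propagates along causal geodesics. -/
theorem IsRadialProfile.future_propagation (P : IsRadialProfile C σ H) (hJ : IsOpen J)
    (hJc : J.OrdConnected) (hμ : 0 ≤ μ)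
    (hgeo : IsNormalizedGeodesicOn (manifold C) (radialKerrSchild σ H) μ J (fun s => (T s, x s)))
    {s₀ : ℝ} (hs₀ : s₀ ∈ J)
    (hA₀ : 0 ≤ deriv T s₀ - σ * radialPart (x s₀) (deriv x s₀))
    (hB₀ : 0 ≤ energyOf σ H (x s₀) (deriv T s₀, deriv x s₀) +
      σ * radialPart (x s₀) (deriv x s₀)) :
    ∀ s ∈ J, 0 ≤ deriv T s - σ * radialPart (x s) (deriv x s) ∧
      0 ≤ energyOf σ H (x s) (deriv T s, deriv x s) + σ * radialPart (x s) (deriv x s) := by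
  have hσ := P.sq_sign
  obtain ⟨hT, hx, hmem, hG⟩ := (P.isNormalizedGeodesicOn_iff hJ).1 hgeo
  obtain ⟨L, E, -, hN, hE, -⟩ := (P.isNormalizedGeodesicOn_iff_newtonian hJ hJc).1 hgeo
  have hnc := fun s hs => (hG s hs).null_coordinates hσ
  have hAa : ∀ s, deriv T s - σ * radialPart (x s) (deriv x s) =
      -σ * nullPart σ (x s) (deriv T s, deriv x s) := by
    intro s
    rw [nullPart]
    linear_combination -deriv T s * hσ
  have hAc : ContinuousOn (fun s => deriv T s - σ * radialPart (x s) (deriv x s)) J :=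
    (continuousOn_const.mul (P.contDiffOn_nullPart hJ hT hx hmem).continuousOn).congr
      fun s _ => hAa s
  -- If Ṫ - σṙ has no zero it stays positive, and the other null coordinate is (L²/r² + μ) divided
  -- by it.
  have hpos : (∀ s ∈ J, deriv T s - σ * radialPart (x s) (deriv x s) ≠ 0) →
      ∀ s ∈ J, 0 ≤ deriv T s - σ * radialPart (x s) (deriv x s) ∧
        0 ≤ energyOf σ H (x s) (deriv T s, deriv x s) + σ * radialPart (x s) (deriv x s) := by
    intro hne s hs
    have hA := pos_of_continuousOn_ne_zero hJc hAc hne hs₀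
      (lt_of_le_of_ne hA₀ (Ne.symm (hne s₀ hs₀))) s hs
    refine ⟨hA.le, nonneg_of_mul_nonneg_right ?_ hA⟩
    rw [(hnc s hs).2]
    positivity
  by_cases hLμ : L = 0 ∧ μ = 0
  · obtain ⟨hL, hμ0⟩ := hLμ
    have hd : ∀ s ∈ J, HasDerivAt (fun t => nullPart σ (x t) (deriv T t, deriv x t))
        ((deriv H ‖x s‖ / 2 * nullPart σ (x s) (deriv T s, deriv x s)) *
          nullPart σ (x s) (deriv T s, deriv x s)) s := by
      intro s hs
      refine (P.hasDerivAt_nullPart_of_geodesic hJ hT hx hs (hmem s hs) (hG s hs)).congr_deriv ?_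
      rw [← hN.angularMomentum s hs, hL, norm_zero]
      ring
    by_cases hz : ∃ s₁ ∈ J, nullPart σ (x s₁) (deriv T s₁, deriv x s₁) = 0
    · obtain ⟨s₁, hs₁, hz⟩ := hz
      have hall := eq_zero_of_linear_ode hJ hJc
        (((P.contDiffOn_deriv_profile hx hmem).continuousOn.div_const 2).mul
          (P.contDiffOn_nullPart hJ hT hx hmem).continuousOn) hd hs₁ hz
      -- With Ṫ - σṙ identically zero, σṙ = E is constant and the other null coordinate is the
      -- constant 2E.
      have hA : ∀ s ∈ J, deriv T s - σ * radialPart (x s) (deriv x s) = 0 := by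
        intro s hs
        rw [hAa, hall s hs, mul_zero]
      have hEρ : ∀ s ∈ J, σ * radialPart (x s) (deriv x s) = E := by
        intro s hs
        have := (hnc s hs).1
        rw [hA s hs, ← hE s hs] at this
        linarith
      intro s hs
      refine ⟨(hA s hs).ge, ?_⟩
      rw [← hE s hs, hEρ s hs]
      rwa [← hE s₀ hs₀, hEρ s₀ hs₀] at hB₀
    · push Not at hz
      refine hpos fun s hs h => hz s hs ?_
      rw [hAa] at h
      have hσ0 : -σ ≠ 0 := fun h => by
        rw [neg_eq_zero] at h
        simp [h] at hσ
      exact (mul_eq_zero.1 h).resolve_left hσ0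
  · refine hpos fun s hs h => hLμ ?_
    have h2 := (hnc s hs).2
    rw [h, zero_mul, ← hN.angularMomentum s hs] at h2
    have h3 : 0 ≤ ‖L‖ ^ 2 / ‖x s‖ ^ 2 := by positivity
    have h4 : ‖L‖ ^ 2 / ‖x s‖ ^ 2 = 0 := by linarith
    have hr := norm_ne_zero_iff.2 (P.ne_zero (hmem s hs))
    exact ⟨by simpa [hr] using h4, by linarith⟩

theorem IsRadialProfile.isFutureCausal_iff_of_geodesic (P : IsRadialProfile C σ H) (hμ : 0 ≤ μ)
    (hgeo : IsNormalizedGeodesicOn (manifold C) (radialKerrSchild σ H) μ J (fun s => (T s, x s)))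
    (hJ : IsOpen J) (hs : s ∈ J) :
    IsFutureCausal (radialKerrSchild σ H) (T s, x s) (nullVector σ (x s))
      (deriv T s, deriv x s) ↔
      0 ≤ deriv T s - σ * radialPart (x s) (deriv x s) ∧
        0 ≤ energyOf σ H (x s) (deriv T s, deriv x s) + σ * radialPart (x s) (deriv x s) := by
  obtain ⟨hT, hx, hmem, -⟩ := (P.isNormalizedGeodesicOn_iff hJ).1 hgeo
  have hd : deriv (fun s => (T s, x s)) s = (deriv T s, deriv x s) :=
    ((hasDerivAt_of_contDiffOn_two hT hJ hs).1.prodMk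
      (hasDerivAt_of_contDiffOn_two hx hJ hs).1).deriv
  have hn := hgeo.2 s hs
  rw [hd] at hn
  rw [isFutureCausal_iff P.sq_sign (p := (T s, x s)) (P.ne_zero (hmem s hs)), hn]
  exact and_iff_right (neg_nonpos.2 hμ)

theorem IsRadialProfile.forall_isFutureCausal_iff (P : IsRadialProfile C σ H) (hJ : IsOpen J)
    (hJc : J.OrdConnected) (hμ : 0 ≤ μ)
    (hgeo : IsNormalizedGeodesicOn (manifold C) (radialKerrSchild σ H) μ J (fun s => (T s, x s)))
    {s₀ : ℝ} (hs₀ : s₀ ∈ J) :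
    (∀ s ∈ J, IsFutureCausal (radialKerrSchild σ H) (T s, x s) (nullVector σ (x s))
        (deriv T s, deriv x s)) ↔
      FutureData σ (H ‖x s₀‖) ‖x s₀‖ ‖cross (x s₀) (deriv x s₀)‖ μ
        (radialPart (x s₀) (deriv x s₀)) (energyOf σ H (x s₀) (deriv T s₀, deriv x s₀)) ∧
      (H ‖x s₀‖ = 1 → radialPart (x s₀) (deriv x s₀) = 0 → 0 ≤ deriv T s₀) := by
  obtain ⟨-, -, hmem, hG⟩ := (P.isNormalizedGeodesicOn_iff hJ).1 hgeo
  obtain ⟨hA, hAB⟩ := (hG s₀ hs₀).null_coordinates P.sq_sign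
  rw [futureData_iff P.sq_sign (norm_ne_zero_iff.2 (P.ne_zero (hmem s₀ hs₀))) hμ hA hAB]
  constructor
  · exact fun h => (P.isFutureCausal_iff_of_geodesic hμ hgeo hJ hs₀).1 (h s₀ hs₀)
  · rintro ⟨h1, h2⟩ s hs
    exact (P.isFutureCausal_iff_of_geodesic hμ hgeo hJ hs).2
      (P.future_propagation hJ hJc hμ hgeo hs₀ h1 h2 s hs)

end FutureDirected

/-! ### Existence of future directed geodesics with given initial data. -/

section InitialData

variable {C : Set E3} {σ : ℝ} {H : ℝ → ℝ} {μ : ℝ}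

/-- The acceleration in the potential of a motion with angular momentum of length `ℓ`. -/
noncomputable def centralForce (H : ℝ → ℝ) (ℓ μ : ℝ) (x : E3) : E3 :=
  ((deriv H ‖x‖ / 2 * (ℓ ^ 2 / ‖x‖ ^ 2 + μ) - H ‖x‖ * (ℓ ^ 2 / ‖x‖ ^ 3)) / ‖x‖) • x

theorem IsRadialProfile.contDiffAt_centralForce (P : IsRadialProfile C σ H) (ℓ μ : ℝ) {x : E3}
    (hx : x ∉ C) : ContDiffAt ℝ 1 (centralForce H ℓ μ) x := by
  have hx0 := P.ne_zero hx
  have hr := norm_ne_zero_iff.2 hx0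
  have hnorm : ContDiffAt ℝ 1 (fun y : E3 => ‖y‖) x := contDiffAt_id.norm ℝ hx0
  have hH' : ContDiffAt ℝ 1 (fun y : E3 => deriv H ‖y‖) x :=
    ContDiffAt.comp (g := deriv H) x (P.contDiffOn_deriv.contDiffAt
      ((isOpen_radii P.isClosed P.zero_mem).mem_nhds ⟨x, hx, rfl⟩)) hnorm
  have hH : ContDiffAt ℝ 1 (fun y : E3 => H ‖y‖) x :=
    ContDiffAt.comp (g := H) x ((contDiffAt_radius P.isClosed P.zero_mem P.smooth hx).of_le
      (by exact_mod_cast le_top)) hnorm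
  have hpow : ∀ n : ℕ, ContDiffAt ℝ 1 (fun y : E3 => ℓ ^ 2 / ‖y‖ ^ n) x := fun n =>
    contDiffAt_const.div (hnorm.pow n) (pow_ne_zero n hr)
  exact ((((hH'.div_const 2).mul ((hpow 2).add contDiffAt_const)).sub
    (hH.mul (hpow 3))).div hnorm hr).smul contDiffAt_id

/-- The force is solved with ℓ frozen at its initial value. Being central, it conserves the angular
momentum, so ℓ stays correct, and the energy law is then a first integral that holds initially. -/
theorem IsRadialProfile.exists_newtonianMotion (P : IsRadialProfile C σ H) {x₀ v₀ : E3}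
    (hx₀ : x₀ ∉ C) {E : ℝ}
    (hE : radialPart x₀ v₀ ^ 2 - E ^ 2 =
      -(1 - H ‖x₀‖) * (‖cross x₀ v₀‖ ^ 2 / ‖x₀‖ ^ 2 + μ)) :
    ∃ J : Set ℝ, IsOpen J ∧ (0 : ℝ) ∈ J ∧ ∃ x : ℝ → E3, x 0 = x₀ ∧ deriv x 0 = v₀ ∧
      IsNewtonianMotionOn C H μ (cross x₀ v₀) E J x := by
  set ℓ := ‖cross x₀ v₀‖ with hℓ
  set v : E3 × E3 → E3 × E3 := fun y => (y.2, centralForce H ℓ μ y.1)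
  have hv : ContDiffAt ℝ 1 v (x₀, v₀) := contDiffAt_snd.prodMk
    (ContDiffAt.comp (g := centralForce H ℓ μ) (x₀, v₀) (P.contDiffAt_centralForce ℓ μ hx₀)
      contDiffAt_fst)
  obtain ⟨α, hα0, ε, hε, hα⟩ :=
    hv.exists_forall_mem_closedBall_exists_eq_forall_mem_Ioo_hasDerivAt₀ 0
  have h0ε : (0 : ℝ) ∈ Ioo (0 - ε) (0 + ε) := by simp [hε]
  have hopen : ∀ᶠ s in 𝓝 (0 : ℝ), (α s).1 ∉ C := by
    have hc : ContinuousAt (fun s => (α s).1) 0 := (hα 0 h0ε).continuousAt.fst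
    exact hc.eventually (P.isClosed.isOpen_compl.mem_nhds
      (show (α 0).1 ∈ Cᶜ by rw [hα0]; exact hx₀))
  obtain ⟨J, hJJ, hJ, hJc, h0J, hmem⟩ := exists_interval isOpen_Ioo h0ε hopen
  set x : ℝ → E3 := fun s => (α s).1
  have hx' : ∀ s ∈ J, HasDerivAt x (α s).2 s := fun s hs =>
    (ContinuousLinearMap.fst ℝ E3 E3).hasFDerivAt.comp_hasDerivAt s (hα s (hJJ hs))
  have hv' : ∀ s ∈ J, HasDerivAt (fun s => (α s).2) (centralForce H ℓ μ (x s)) s := fun s hs =>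
    (ContinuousLinearMap.snd ℝ E3 E3).hasFDerivAt.comp_hasDerivAt s (hα s (hJJ hs))
  have hxC : ContDiffOn ℝ 2 x J := by
    have h1 : ContDiffOn ℝ ((0 : ℕ) + 1) (fun s => (α s).2) J := by
      refine contDiffOn_succ_of_hasDerivAt hJ hv' ?_
      rw [Nat.cast_zero, contDiffOn_zero]
      exact fun s hs => (ContinuousAt.comp (g := centralForce H ℓ μ) (f := x)
        (P.contDiffAt_centralForce ℓ μ (hmem s hs)).continuousAt
        (hx' s hs).continuousAt).continuousWithinAt
    have h2 := contDiffOn_succ_of_hasDerivAt hJ hx' (n := 1) (by simpa using h1)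
    exact_mod_cast h2
  have hacc : ∀ s ∈ J, deriv (deriv x) s = centralForce H ℓ μ (x s) := by
    intro s hs
    refine HasDerivAt.deriv ((hv' s hs).congr_of_eventuallyEq ?_)
    filter_upwards [hJ.mem_nhds hs] with t ht using (hx' t ht).deriv
  have hx0 : x 0 = x₀ := by simp only [x, hα0]
  have hv0 : deriv x 0 = v₀ := by rw [(hx' 0 h0J).deriv, hα0]
  have hL : ∀ s ∈ J, cross x₀ v₀ = cross (x s) (deriv x s) := by
    intro s hs
    have := eq_of_hasDerivAt_zero hJ hJc
      (fun t ht => hasDerivAt_cross_deriv hJ hxC ht (hacc t ht)) h0J hs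
    rwa [hx0, hv0] at this
  refine ⟨J, hJ, h0J, x, hx0, hv0, (P.isNewtonianMotionOn_iff hJ).2
    ⟨hxC, hmem, fun s hs => ⟨hL s hs, hacc s hs, ?_⟩⟩⟩
  have hQ : ∀ t ∈ J, HasDerivAt (fun t => radialPart (x t) (deriv x t) ^ 2 +
      (1 - H ‖x t‖) * (ℓ ^ 2 / ‖x t‖ ^ 2 + μ)) 0 t := by
    intro t ht
    have ht0 : x t ≠ 0 := P.ne_zero (hmem t ht)
    have hr := norm_ne_zero_iff.2 ht0
    have hρ := hasDerivAt_radialPart_deriv hJ hxC ht ht0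
    rw [hacc t ht, centralForce, radialPart_smul_self ht0, ← hL t ht, ← hℓ] at hρ
    have hn := hasDerivAt_norm_curve (hasDerivAt_of_contDiffOn_two hxC hJ ht).1 ht0
    have hN := ((hasDerivAt_const t (ℓ ^ 2)).fun_div (hn.fun_pow 2)
      (pow_ne_zero 2 hr)).add_const μ
    have hH := P.hasDerivAt_profile hJ hxC ht (hmem t ht)
    refine ((hρ.fun_pow 2).fun_add ((hH.const_sub 1).fun_mul hN)).congr_deriv ?_
    field_simp
    ring
  have := eq_of_hasDerivAt_zero hJ hJc hQ hs h0J
  simp only [hx0, hv0] at this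
  linear_combination this + hE

/-- The inequalities in the data condition make the radicands nonnegative, so that squaring undoes
the roots. -/
theorem FutureData.energy {h₀ r₀ ℓ ρ E : ℝ} (hμ : 0 ≤ μ) (hσ : σ ^ 2 = 1)
    (hF : FutureData σ h₀ r₀ ℓ μ ρ E) : ρ ^ 2 - E ^ 2 = -(1 - h₀) * (ℓ ^ 2 / r₀ ^ 2 + μ) := by
  have ha0 : 0 ≤ aZero h₀ r₀ ℓ μ := Real.sqrt_nonneg _
  have ha2 := sq_aZero (h₀ := h₀) (r₀ := r₀) (ℓ := ℓ) hμ
  rcases lt_trichotomy h₀ 1 with h | h | h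
  · obtain ⟨h1, h2⟩ := hF.2.1 h
    rw [abs_of_pos (by linarith)] at ha2
    rw [sq_of_eq_sqrt_or (sub_nonneg.2 (pow_le_pow_left₀ ha0 h1 2)) h2, ha2]
    ring
  · obtain ⟨-, -, h2⟩ := hF.2.2 h
    rw [h2, h]
    linear_combination -ρ ^ 2 * hσ
  · obtain ⟨h1, h2⟩ := hF.1 h
    rw [abs_of_neg (by linarith)] at ha2
    have h3 : aZero h₀ r₀ ℓ μ ^ 2 ≤ ρ ^ 2 := by
      have := pow_le_pow_left₀ ha0 h1 2
      rwa [mul_pow, hσ, one_mul] at this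
    rw [sq_of_eq_sqrt_or (sub_nonneg.2 h3) h2, ha2]
    ring

theorem isNormalizedGeodesicOn_const {x₀ : E3}
    (hx₀ : x₀ ∉ C) (T₀ : ℝ) :
    IsNormalizedGeodesicOn (manifold C) (radialKerrSchild σ H) 0 univ (fun _ => (T₀, x₀)) := by
  refine ⟨⟨contDiffOn_const, fun _ _ => hx₀, fun s _ w => ?_⟩, fun s _ => ?_⟩
  · simp [christoffel, radialKerrSchild, minkowski, radialPart]
  · simp [radialKerrSchild, minkowski, radialPart]

theorem IsRadialProfile.exists_future_geodesic_iff (P : IsRadialProfile C σ H) (hμ : 0 ≤ μ)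
    (T₀ : ℝ) {x₀ v₀ : E3} (hx₀ : x₀ ∉ C) (E : ℝ) :
    (∃ J : Set ℝ, IsOpen J ∧ J.OrdConnected ∧ (0 : ℝ) ∈ J ∧ ∃ (T : ℝ → ℝ) (x : ℝ → E3),
      IsNormalizedGeodesicOn (manifold C) (radialKerrSchild σ H) μ J (fun s => (T s, x s)) ∧
      T 0 = T₀ ∧ x 0 = x₀ ∧ deriv x 0 = v₀ ∧ E = energyOf σ H x₀ (deriv T 0, v₀) ∧
      ∀ s ∈ J, IsFutureCausal (radialKerrSchild σ H) (T s, x s) (nullVector σ (x s))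
        (deriv T s, deriv x s)) ↔
    FutureData σ (H ‖x₀‖) ‖x₀‖ ‖cross x₀ v₀‖ μ (radialPart x₀ v₀) E := by
  have hσ := P.sq_sign
  have hx0 := P.ne_zero hx₀
  constructor
  · rintro ⟨J, hJ, hJc, h0, T, x, hgeo, -, rfl, rfl, rfl, hfut⟩
    exact ((P.forall_isFutureCausal_iff hJ hJc hμ hgeo h0).1 hfut).1
  · intro hF
    -- In this case the data force μ = 0, L = 0 and E = 0, hence zero spatial velocity; the constant
    -- curve is a geodesic whose zero tangent counts as future directed.
    by_cases hrest : H ‖x₀‖ = 1 ∧ radialPart x₀ v₀ = 0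
    · obtain ⟨h1, hρ⟩ := hrest
      obtain ⟨-, h2, hE⟩ := hF.2.2 h1
      obtain ⟨rfl, hL⟩ := h2 hρ
      have hv₀ : v₀ = 0 := by
        have := norm_sq_eq_radialPart_sq_add hx0 v₀
        rw [hρ, hL] at this
        simpa using this
      subst hv₀
      refine ⟨univ, isOpen_univ, ordConnected_univ, mem_univ _, fun _ => T₀, fun _ => x₀,
        isNormalizedGeodesicOn_const hx₀ T₀, rfl, rfl, by simp, ?_, fun s _ => ?_⟩
      · rw [hE, hρ]
        simp [energyOf, radialPart]
      · refine ⟨?_, Or.inl (by simp)⟩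
        simp [radialKerrSchild, minkowski, radialPart]
    · obtain ⟨J, hJ, h0, x, rfl, rfl, hN⟩ := P.exists_newtonianMotion hx₀ (hF.energy hμ hσ)
      obtain ⟨J', -, hJ', hJc', h0', T, hT0, hgeo, hE⟩ :=
        P.exists_local_time hJ hN h0 T₀ fun h1 => by
          obtain ⟨-, -, hE⟩ := hF.2.2 h1
          refine ⟨?_, fun hρ => absurd ⟨h1, hρ⟩ hrest⟩
          rw [hE]
          linear_combination -radialPart (x 0) (deriv x 0) * hσ
      refine ⟨J', hJ', hJc', h0', T, x, hgeo, hT0, rfl, rfl, hE 0 h0', ?_⟩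
      refine (P.forall_isFutureCausal_iff hJ' hJc' hμ hgeo h0').2 ⟨?_, fun h1 hρ =>
        absurd ⟨h1, hρ⟩ hrest⟩
      rw [← hE 0 h0']
      exact hF

end InitialData

/-! ### The main theorem: transfer from the radial form to the given metric. -/

theorem mainTheorem1
    (C : Set E3) (hC : IsClosed C) (hconn : IsConnected (manifold C))
    (hCrot : ∀ R : E3 ≃ₗᵢ[ℝ] E3, IsRotation R → ∀ x ∈ C, R x ∈ C)
    (h : Spacetime → ℝ) (K : Spacetime → (Spacetime →L[ℝ] ℝ))
    (h_smooth : ContDiffOn ℝ ∞ h (manifold C)) (K_smooth : ContDiffOn ℝ ∞ K (manifold C))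
    (K_null : ∀ p ∈ manifold C, minkowskiCoSq (K p) = 0)
    (h_flat : ∀ p ∈ manifold C, ¬ IsFlatZero h p)
    (K_flat : ∀ p ∈ manifold C, ¬ IsFlatZero K p)
    (g : MetricField) (hg : g = kerrSchild h K)
    (stationary : IsStationaryMetric (manifold C) g)
    (spherical : IsSphericallySymmetric (manifold C) g) :
    -- the form of the metric
    ((0 : E3) ∈ C ∧ ∃ (σ : ℝ) (H : ℝ → ℝ), (σ = 1 ∨ σ = -1) ∧
      ContDiffOn ℝ ∞ H {r | ∃ x : E3, x ∉ C ∧ ‖x‖ = r} ∧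
      ∀ p ∈ manifold C, g p = radialKerrSchild σ H p) ∧
    -- the geodesics, for every way of writing the metric in this form
    ∀ (σ : ℝ) (H : ℝ → ℝ), (σ = 1 ∨ σ = -1) →
      ContDiffOn ℝ ∞ H {r | ∃ x : E3, x ∉ C ∧ ‖x‖ = r} →
      (∀ p ∈ manifold C, g p = radialKerrSchild σ H p) →
      (∀ U : Set E3, U ⊆ Cᶜ → IsOpen U → IsConnected U → ¬ IsExceptionalOn H U) →
      -- a curve is a normalized geodesic exactly if it satisfies the Newtonian system
      (∀ μ ∈ ({-1, 0, 1} : Set ℝ), ∀ J : Set ℝ, IsOpen J → J.OrdConnected →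
        ∀ (T : ℝ → ℝ) (x : ℝ → E3),
          IsNormalizedGeodesicOn (manifold C) g μ J (fun s => (T s, x s)) ↔
            ∃ (L : E3) (E : ℝ), ContDiffOn ℝ 2 T J ∧ IsNewtonianMotionOn C H μ L E J x ∧
              (∀ s ∈ J, E = energyOf σ H (x s) (deriv T s, deriv x s)) ∧
              HorizonConditions g σ H μ L E J T x) ∧
      -- which Newtonian motions are spatial parts of geodesics, and uniqueness of the time part
      (∀ μ ∈ ({-1, 0, 1} : Set ℝ), ∀ J : Set ℝ, IsOpen J → J.OrdConnected →
        ∀ (L : E3) (E : ℝ) (x : ℝ → E3), IsNewtonianMotionOn C H μ L E J x →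
          (∀ s₀ ∈ J, ∀ T₀ : ℝ,
            ((∃ J' ⊆ J, IsOpen J' ∧ J'.OrdConnected ∧ s₀ ∈ J' ∧ ∃ T : ℝ → ℝ, T s₀ = T₀ ∧
              IsNormalizedGeodesicOn (manifold C) g μ J' (fun s => (T s, x s)) ∧
              ∀ s ∈ J', E = energyOf σ H (x s) (deriv T s, deriv x s)) ↔
            (H ‖x s₀‖ = 1 → radialPart (x s₀) (deriv x s₀) = σ * E ∧
              (radialPart (x s₀) (deriv x s₀) = 0 → ‖L‖ ^ 2 / ‖x s₀‖ ^ 2 + μ = 0)))) ∧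
          ((∀ s ∈ J, H ‖x s‖ = 1 → radialPart (x s) (deriv x s) = σ * E ∧
              (radialPart (x s) (deriv x s) = 0 → L = 0 ∧ μ = 0)) →
            ∃ T : ℝ → ℝ,
              IsNormalizedGeodesicOn (manifold C) g μ J (fun s => (T s, x s)) ∧
              ∀ s ∈ J, E = energyOf σ H (x s) (deriv T s, deriv x s)) ∧
          ((∃ s ∈ J, H ‖x s‖ ≠ 1) → ∀ T₁ T₂ : ℝ → ℝ,
            (IsNormalizedGeodesicOn (manifold C) g μ J (fun s => (T₁ s, x s)) ∧
              ∀ s ∈ J, E = energyOf σ H (x s) (deriv T₁ s, deriv x s)) →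
            (IsNormalizedGeodesicOn (manifold C) g μ J (fun s => (T₂ s, x s)) ∧
              ∀ s ∈ J, E = energyOf σ H (x s) (deriv T₂ s, deriv x s)) →
            ∃ c : ℝ, ∀ s ∈ J, T₁ s = T₂ s + c)) ∧
      -- when a given causal geodesic is future directed
      (∀ μ ∈ ({0, 1} : Set ℝ), ∀ J : Set ℝ, IsOpen J → J.OrdConnected →
        ∀ (T : ℝ → ℝ) (x : ℝ → E3),
          IsNormalizedGeodesicOn (manifold C) g μ J (fun s => (T s, x s)) → ∀ s₀ ∈ J,
            ((∀ s ∈ J, IsFutureCausal g (T s, x s) (nullVector σ (x s))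
                (deriv T s, deriv x s)) ↔
              FutureData σ (H ‖x s₀‖) ‖x s₀‖ ‖cross (x s₀) (deriv x s₀)‖ μ
                (radialPart (x s₀) (deriv x s₀))
                (energyOf σ H (x s₀) (deriv T s₀, deriv x s₀)) ∧
              (H ‖x s₀‖ = 1 → radialPart (x s₀) (deriv x s₀) = 0 → 0 ≤ deriv T s₀))) ∧
      -- which spatial initial data belong to future directed causal geodesics
      (∀ μ ∈ ({0, 1} : Set ℝ), ∀ (T₀ : ℝ) (x₀ v₀ : E3) (E : ℝ), x₀ ∉ C →
        ((∃ J : Set ℝ, IsOpen J ∧ J.OrdConnected ∧ (0 : ℝ) ∈ J ∧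
            ∃ (T : ℝ → ℝ) (x : ℝ → E3),
              IsNormalizedGeodesicOn (manifold C) g μ J (fun s => (T s, x s)) ∧
              T 0 = T₀ ∧ x 0 = x₀ ∧ deriv x 0 = v₀ ∧
              E = energyOf σ H x₀ (deriv T 0, v₀) ∧
              ∀ s ∈ J, IsFutureCausal g (T s, x s) (nullVector σ (x s))
                (deriv T s, deriv x s)) ↔
          FutureData σ (H ‖x₀‖) ‖x₀‖ ‖cross x₀ v₀‖ μ (radialPart x₀ v₀) E)) := by
  subst hg
  have S : IsStationarySphericalKerrSchild C h K :=
    ⟨hC, hCrot, h_smooth, K_smooth, K_null, h_flat, K_flat, stationary, spherical⟩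
  refine ⟨⟨S.zero_mem, S.exists_radialKerrSchild hconn⟩, fun σ H hσ hH hg _ => ?_⟩
  have P : IsRadialProfile C σ H := ⟨hC, S.zero_mem, hσ, hH⟩
  have hcongr : ∀ (μ : ℝ) (J : Set ℝ) (T : ℝ → ℝ) (x : ℝ → E3),
      IsNormalizedGeodesicOn (manifold C) (kerrSchild h K) μ J (fun s => (T s, x s)) ↔
        IsNormalizedGeodesicOn (manifold C) (radialKerrSchild σ H) μ J (fun s => (T s, x s)) :=
    fun μ J T x => isNormalizedGeodesicOn_congr hC hg
  have hfuture : ∀ (J : Set ℝ) (T : ℝ → ℝ) (x : ℝ → E3), (∀ s ∈ J, x s ∉ C) →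
      ((∀ s ∈ J, IsFutureCausal (kerrSchild h K) (T s, x s) (nullVector σ (x s))
          (deriv T s, deriv x s)) ↔
        ∀ s ∈ J, IsFutureCausal (radialKerrSchild σ H) (T s, x s) (nullVector σ (x s))
          (deriv T s, deriv x s)) := by
    intro J T x hmem
    refine forall₂_congr fun s hs => ?_
    rw [IsFutureCausal, IsFutureCausal, hg (T s, x s) (hmem s hs)]
  have hnonneg : ∀ μ ∈ ({0, 1} : Set ℝ), 0 ≤ μ := by
    rintro μ (rfl | rfl)
    · exact le_rfl
    · exact zero_le_one
  refine ⟨?_, ?_, ?_, ?_⟩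
  · intro μ _ J hJ hJc T x
    rw [hcongr, P.isNormalizedGeodesicOn_iff_newtonian hJ hJc]
    refine exists₂_congr fun L E => and_congr_right fun _ => and_congr_right fun hN =>
      and_congr_right fun _ => forall₂_congr fun s hs => ?_
    rw [hg (T s, x s) (hN.mem s hs)]
  · intro μ _ J hJ hJc L E x hN
    simp only [hcongr]
    exact ⟨fun s₀ hs₀ T₀ => P.exists_local_time_iff hJ hN hs₀ T₀, P.exists_time hJ hJc hN,
      fun hne T₁ T₂ h₁ h₂ => P.time_unique hJ hJc hne h₁.1 h₁.2 h₂.1 h₂.2⟩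
  · intro μ hμ J hJ hJc T x hgeo s₀ hs₀
    rw [hfuture J T x fun s hs => hgeo.1.mem s hs]
    exact P.forall_isFutureCausal_iff hJ hJc (hnonneg μ hμ) ((hcongr μ J T x).1 hgeo) hs₀
  · intro μ hμ T₀ x₀ v₀ E hx₀
    rw [← P.exists_future_geodesic_iff (hnonneg μ hμ) T₀ hx₀ E]
    refine exists_congr fun J => and_congr_right fun _ => and_congr_right fun _ =>
      and_congr_right fun _ => exists₂_congr fun T x => ?_
    rw [hcongr]
    refine and_congr_right fun hgeo => ?_
    rw [hfuture J T x fun s hs => hgeo.1.mem s hs]
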